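/- Proposition 6.1. Let $M$ be a complete, connected, smooth ($C^\infty$) finite-dimensional Riemannian manifold without boundary, with Riemannian distance $d$; geodesics are parametrized by arclength, on intervals of positive length. Let $p,q\in M$ (possibly $p=q$) and let $A\subset M$ be a nonempty closed set. Suppose that there is a sequence of geodesics $c_n:[0,L_n]\to M$, $n\in\mathbb N$, from $p=c_n(0)$ to $q=c_n(L_n)$ with the following properties: a) $\lim_{n\to\infty}L_n=\infty$; b) if $n\in\mathbb N$ and $t\in(0,L_n)$, then $c_n(t)\notin A$; c) the geodesic $c_n$ has no conjugate points in the interval $[0,L_n)$, i.e. for all $n$ and all $0\le a<b<L_n$, every Jacobi field along $c_n|_{[a,b]}$ that vanishes at $a$ and at $b$ is identically zero; d) for every $\varepsilon>0$ there exists $T=T(\varepsilon)>0$ such that $d(c_n(t),A)<\varepsilon$ for all $n\in\mathbb N$ and all $t$ with $T<t<L_n-T$. Then $p$ and $q$ cannot be blocked away from each other by a finite blocking set: there is no finite set $B\subset M\setminus\{p,q\}$ such that every geodesic $c:[0,L]\to M$ with $c(0)=p$ and $c(L)=q$ satisfies $c(t)\in B$ for some $t\in(0,L)$. -/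

import Mathlib

open Set Filter Topology Bundle
open scoped Manifold ContDiff Bundle

noncomputable section

/-- The model space `ℝᵈ` of a `d`-dimensional manifold. -/
abbrev Coord (d : ℕ) : Type := EuclideanSpace ℝ (Fin d)

section LocalCoordinates

variable {d : ℕ} {M : Type*} [TopologicalSpace M] [ChartedSpace (Coord d) M]
  [RiemannianBundle (fun x : M => TangentSpace (𝓡 d) x)]

/-- The metric tensor in the chart `e`: for `y` in the target of `e`, this is the bilinear form
`g_y(u, v) = ⟨D(e⁻¹)(y) u, D(e⁻¹)(y) v⟩` on `ℝᵈ`, that is, `∑ g_{ij}(y) uⁱ vʲ`. -/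
def metricCoord (e : OpenPartialHomeomorph M (Coord d)) (y : Coord d) :
    Coord d →L[ℝ] Coord d →L[ℝ] ℝ :=
  let D : Coord d →L[ℝ] TangentSpace (𝓡 d) (e.symm y) := mfderiv (𝓡 d) (𝓡 d) e.symm y
  (innerSL ℝ (E := TangentSpace (𝓡 d) (e.symm y))).bilinearComp D D

/-- The Christoffel symbols of the Levi-Civita connection in the chart `e`, as the map
`(u, v) ↦ ∑ Γᵏ_{ij}(y) uⁱ vʲ ∂ₖ`. This is the vector `Γ_y(u, v)` determined by
`2 g(Γ(u, v), w) = (∂_u g)(v, w) + (∂_v g)(u, w) - (∂_w g)(u, v)` for all `w`; the inverse below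
is that of the isomorphism `g_y : ℝᵈ → (ℝᵈ)*`. -/
def christoffel (e : OpenPartialHomeomorph M (Coord d)) (y u v : Coord d) : Coord d :=
  (metricCoord e y).inverse ((1 / 2 : ℝ) •
    (fderiv ℝ (metricCoord e) y u v + fderiv ℝ (metricCoord e) y v u
      - ((fderiv ℝ (metricCoord e) y).flip u).flip v))

/-- The Riemann curvature tensor `R(u, v)w = ∇_u ∇_v w - ∇_v ∇_u w - ∇_[u,v] w` in the chart `e`,
evaluated on vectors with constant coordinates `u, v, w`. -/
def curvatureCoord (e : OpenPartialHomeomorph M (Coord d)) (y u v w : Coord d) : Coord d :=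
  fderiv ℝ (fun z => christoffel e z v w) y u - fderiv ℝ (fun z => christoffel e z u w) y v
    + christoffel e y u (christoffel e y v w) - christoffel e y v (christoffel e y u w)

/-- The covariant derivative `DV/dt = V' + Γ(c', V)` along the curve `c` in the chart `e`, where `V`
is the coordinate expression of a vector field along `c`. -/
def covDerivCoord (e : OpenPartialHomeomorph M (Coord d)) (c : ℝ → M) (V : ℝ → Coord d) (t : ℝ) :
    Coord d :=
  deriv V t + christoffel e (e (c t)) (deriv (fun s => e (c s)) t) (V t)

/-- The restriction of `c` to `[a, b]` is a geodesic parametrized by arclength: it is smooth (up to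
the endpoints), has unit speed, and satisfies the geodesic equation `D c'/dt = 0` in every chart.
By smoothness, it suffices to ask for the equations in the open interval. -/
structure IsGeodesicOn (c : ℝ → M) (a b : ℝ) : Prop where
  lt : a < b
  smooth : ContMDiffOn 𝓘(ℝ, ℝ) (𝓡 d) ∞ c (Icc a b)
  unit_speed : ∀ t ∈ Ioo a b,
    ‖(mfderiv 𝓘(ℝ, ℝ) (𝓡 d) c t (1 : ℝ) : TangentSpace (𝓡 d) (c t))‖ = 1
  geodesic_eq : ∀ e ∈ atlas (Coord d) M, ∀ t ∈ Ioo a b, c t ∈ e.source →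
    covDerivCoord e c (deriv fun s => e (c s)) t = 0

/-- The coordinate expression in the chart `e` of a vector field `J` along the curve `c`. -/
def fieldCoord (e : OpenPartialHomeomorph M (Coord d)) (c : ℝ → M)
    (J : (t : ℝ) → TangentSpace (𝓡 d) (c t)) (t : ℝ) : Coord d :=
  mfderiv (𝓡 d) (𝓡 d) e (c t) (J t)

variable [IsManifold (𝓡 d) ∞ M]

/-- `J` is a Jacobi field along the restriction of `c` to `[a, b]`: it is a smooth vector field along
`c` (up to the endpoints) with `D²J/dt² + R(J, c')c' = 0`, an equation stated in every chart. -/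
structure IsJacobiFieldOn (c : ℝ → M) (a b : ℝ) (J : (t : ℝ) → TangentSpace (𝓡 d) (c t)) :
    Prop where
  smooth : ContMDiffOn 𝓘(ℝ, ℝ) (𝓡 d).tangent ∞
    (fun t => (⟨c t, J t⟩ : TangentBundle (𝓡 d) M)) (Icc a b)
  jacobi_eq : ∀ e ∈ atlas (Coord d) M, ∀ t ∈ Ioo a b, c t ∈ e.source →
    covDerivCoord e c (covDerivCoord e c (fieldCoord e c J)) t
      + curvatureCoord e (e (c t)) (fieldCoord e c J t)
          (deriv (fun s => e (c s)) t) (deriv (fun s => e (c s)) t) = 0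

variable (d) in
/-- The parameters `a < b` (the points `c a` and `c b`) are conjugate along the geodesic `c`: there
is a Jacobi field along `c` on `[a, b]` that vanishes at `a` and at `b` but not identically. -/
def AreConjugate (c : ℝ → M) (a b : ℝ) : Prop :=
  a < b ∧ ∃ J : (t : ℝ) → TangentSpace (𝓡 d) (c t),
    IsJacobiFieldOn c a b J ∧ J a = 0 ∧ J b = 0 ∧ ∃ t ∈ Icc a b, J t ≠ 0

variable (d) in
/-- The geodesic `c` has no conjugate points in the set `S` of parameters: no two parameters in `S`
are conjugate along `c`. -/
def NoConjugatePointsOn (c : ℝ → M) (S : Set ℝ) : Prop :=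
  ∀ a ∈ S, ∀ b ∈ S, ¬ AreConjugate d c a b

variable (d) in
/-- `c` restricted to `[0, L]` is a geodesic (parametrized by arclength) from `x` to `y`. -/
structure IsGeodesicFromTo (c : ℝ → M) (L : ℝ) (x y : M) : Prop where
  geodesic : IsGeodesicOn (d := d) c 0 L
  source : c 0 = x
  target : c L = y

variable (d) in
/-- A blocking set for the pair `x, y`: a finite set `B ⊆ M \ {x, y}` such that every geodesic
joining `x` with `y` passes through a point of `B` at an interior parameter. -/
def IsBlockingSet (x y : M) (B : Set M) : Prop :=
  B.Finite ∧ B ⊆ {x, y}ᶜ ∧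
    ∀ (L : ℝ) (c : ℝ → M), IsGeodesicFromTo d c L x y → ∃ t ∈ Ioo 0 L, c t ∈ B

variable (d) in
/-- The pair `x, y` is insecure: it has no (finite) blocking set. -/
def IsInsecure (x y : M) : Prop :=
  ¬ ∃ B : Set M, IsBlockingSet d x y B

end LocalCoordinates

end

/-! Suppose a finite set B blocks. By the pigeonhole principle infinitely many c_n pass through one
point b of B, at interior times t_n. Since b lies off the closed set A, condition d) keeps t_n
within a bounded distance of 0 or of L_n. Reversing the geodesics exchanges the two cases, so let
t_n ≤ T.

The heart is a rigidity statement, `exists_subseq_eq`: infinitely many of these geodesics agree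
wherever they are defined. Along a subsequence t_n → s > 0 and the initial velocities converge to
some v. Rescale time so that every geodesic meets b exactly at time s; the new initial velocities
w_n still tend to v. If w_n ≠ v for all large n, then (w_n - v)/|w_n - v| accumulates at a unit
vector η, and the difference quotients with respect to the limit geodesic converge to a Jacobi field
J with J(0) = 0 and J'(0) = η. All curves pass through b at time s, hence J(s) = 0. To exclude this
(`variation_eq_zero`), let J_n be the Jacobi field along the n-th geodesic with J_n(0) = 0, J_n'(0)
= η; then J_n(s) → J(s) = 0, while `exists_conjFree_bound` gives |η| ≤ C |J_n(s)| with C independent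
of n. That bound is the quantitative form of the absence of conjugate points: the Riccati operator U
= Y' Y⁻¹ of a matrix Jacobi solution Y exists on the whole open interval, and a solution of U' + U²
+ R = 0 without blow-up is bounded in terms of a bound on R and the distance to the ends of the
interval. Hence w_n = v infinitely often, and unit speed makes the original initial velocities
equal.

To conclude (`false_of_common_point`): coinciding geodesics of unbounded length prolong one another,
so a long one passes through q at the length of a shorter one. By b), q is not in A; but this
parameter can be taken far from both ends, where d) brings q closer to A than its own distance to A.

The analysis consists of ordinary differential equations in charts, pieced together along compact
intervals by `Icc_forward_induction`; completeness of M supplies the limit points. -/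

noncomputable section

set_option maxSynthPendingDepth 3

/-! ### Differentials of charts and the metric tensor in coordinates -/

section ChartGeometry

variable {d : ℕ} {M : Type*} [TopologicalSpace M] [ChartedSpace (Coord d) M]

/-- The differential of the chart `e`, with values in the model space. -/
def chartD (e : OpenPartialHomeomorph M (Coord d)) (x : M) :
    TangentSpace (𝓡 d) x →L[ℝ] Coord d :=
  mfderiv (𝓡 d) (𝓡 d) e x

/-- The inverse of the differential of the chart `e`. -/
def chartV (e : OpenPartialHomeomorph M (Coord d)) (x : M) :
    Coord d →L[ℝ] TangentSpace (𝓡 d) x :=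
  (chartD e x).inverse

theorem fieldCoord_eq_chartD (e : OpenPartialHomeomorph M (Coord d)) (c : ℝ → M)
    (J : (t : ℝ) → TangentSpace (𝓡 d) (c t)) (t : ℝ) :
    fieldCoord e c J t = chartD e (c t) (J t) := rfl

variable [IsManifold (𝓡 d) ∞ M]

variable {e e' : OpenPartialHomeomorph M (Coord d)}

theorem mdiff_of_mem_atlas (he : e ∈ atlas (Coord d) M) : e.MDifferentiable (𝓡 d) (𝓡 d) := by
  have : IsManifold (𝓡 d) 1 M := IsManifold.of_le (n := ∞) (by simp)
  exact mdifferentiable_of_mem_atlas he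

theorem chartD_isInvertible (he : e ∈ atlas (Coord d) M) {x : M} (hx : x ∈ e.source) :
    (chartD e x).IsInvertible :=
  ⟨(mdiff_of_mem_atlas he).mfderiv hx, rfl⟩

theorem chartV_chartD (he : e ∈ atlas (Coord d) M) {x : M} (hx : x ∈ e.source)
    (a : TangentSpace (𝓡 d) x) : chartV e x (chartD e x a) = a := by
  have := (chartD_isInvertible he hx).inverse_apply_self a
  exact this

theorem chartD_chartV (he : e ∈ atlas (Coord d) M) {x : M} (hx : x ∈ e.source)
    (a : Coord d) : chartD e x (chartV e x a) = a :=
  (chartD_isInvertible he hx).self_apply_inverse a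

theorem chartD_injective (he : e ∈ atlas (Coord d) M) {x : M} (hx : x ∈ e.source) :
    Function.Injective (chartD e x) :=
  Function.LeftInverse.injective (chartV_chartD he hx)

theorem mfderiv_symm_chartD (he : e ∈ atlas (Coord d) M) {y : Coord d} (hy : y ∈ e.target)
    (a : Coord d) :
    chartD e (e.symm y) (mfderiv (𝓡 d) (𝓡 d) e.symm y a) = a := by
  have h := (mdiff_of_mem_atlas he).comp_symm_deriv hy
  have := congrArg (fun f => f a) h
  exact this

theorem chartV_eq_mfderiv_symm (he : e ∈ atlas (Coord d) M) {y : Coord d} (hy : y ∈ e.target)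
    (a : Coord d) :
    chartV e (e.symm y) a = mfderiv (𝓡 d) (𝓡 d) e.symm y a := by
  apply chartD_injective he (e.map_target hy)
  rw [chartD_chartV he (e.map_target hy)]
  exact (mfderiv_symm_chartD he hy a).symm

theorem contMDiffOn_symm_of_atlas (he : e ∈ atlas (Coord d) M) :
    ContMDiffOn (𝓡 d) (𝓡 d) ∞ e.symm e.target :=
  contMDiffOn_symm_of_mem_maximalAtlas (IsManifold.subset_maximalAtlas he)

theorem contMDiffOn_of_atlas (he : e ∈ atlas (Coord d) M) :
    ContMDiffOn (𝓡 d) (𝓡 d) ∞ e e.source :=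
  contMDiffOn_of_mem_maximalAtlas (IsManifold.subset_maximalAtlas he)

/-- The field with constant coordinates `a` is the tangent map of `e.symm` applied to a constant
section. Pairing two such fields shows that the metric coefficients are smooth. -/
theorem contMDiffOn_symm_section (he : e ∈ atlas (Coord d) M) (a : Coord d) :
    ContMDiffOn (𝓡 d) (𝓡 d).tangent ∞
      (fun y => (⟨e.symm y, chartV e (e.symm y) a⟩ : TangentBundle (𝓡 d) M)) e.target := by
  have h1 : ContMDiffOn (𝓡 d).tangent (𝓡 d).tangent ∞
      (tangentMapWithin (𝓡 d) (𝓡 d) e.symm e.target)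
      (Bundle.TotalSpace.proj ⁻¹' e.target) :=
    (contMDiffOn_symm_of_atlas he).contMDiffOn_tangentMapWithin (by simp)
      e.open_target.uniqueMDiffOn
  have h2 : ContMDiff (𝓡 d) (𝓡 d).tangent ∞
      (fun y : Coord d => (⟨y, a⟩ : TangentBundle (𝓡 d) (Coord d))) := by
    exact contMDiff_vectorSpace_iff_contDiff (V := fun _ => a) |>.2 contDiff_const
  have h3 := h1.comp h2.contMDiffOn (s := e.target) (fun y hy => hy)
  refine h3.congr fun y hy => ?_
  simp only [Function.comp, tangentMapWithin, chartV_eq_mfderiv_symm he hy]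
  rw [mfderivWithin_of_isOpen e.open_target hy]

section Metric

variable [RiemannianBundle (fun x : M => TangentSpace (𝓡 d) x)]

theorem metricCoord_symm_apply (he : e ∈ atlas (Coord d) M) {y : Coord d} (hy : y ∈ e.target)
    (a b : Coord d) :
    metricCoord e y a b = inner ℝ (chartV e (e.symm y) a) (chartV e (e.symm y) b) := by
  rw [chartV_eq_mfderiv_symm he hy, chartV_eq_mfderiv_symm he hy]
  rfl

theorem metricCoord_chartD (he : e ∈ atlas (Coord d) M) {x : M} (hx : x ∈ e.source)
    (a b : TangentSpace (𝓡 d) x) :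
    metricCoord e (e x) (chartD e x a) (chartD e x b) = inner ℝ a b := by
  obtain ⟨y, hy, rfl⟩ : ∃ y ∈ e.target, e.symm y = x := ⟨e x, e.map_source hx, e.left_inv hx⟩
  rw [e.right_inv hy, metricCoord_symm_apply he hy, chartV_chartD he hx, chartV_chartD he hx]

theorem metricCoord_comm (he : e ∈ atlas (Coord d) M) {y : Coord d} (hy : y ∈ e.target)
    (a b : Coord d) : metricCoord e y a b = metricCoord e y b a := by
  rw [metricCoord_symm_apply he hy, metricCoord_symm_apply he hy, real_inner_comm]

theorem metricCoord_pos (he : e ∈ atlas (Coord d) M) {y : Coord d} (hy : y ∈ e.target)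
    {a : Coord d} (ha : a ≠ 0) : 0 < metricCoord e y a a := by
  rw [metricCoord_symm_apply he hy, real_inner_self_eq_norm_sq]
  have : chartV e (e.symm y) a ≠ 0 := by
    intro h
    apply ha
    rw [← chartD_chartV he (e.map_target hy) a, h, map_zero]
  positivity

variable [IsContMDiffRiemannianBundle (𝓡 d) ∞ (Coord d) (fun x : M => TangentSpace (𝓡 d) x)]

theorem contDiffOn_metricCoord (he : e ∈ atlas (Coord d) M) :
    ContDiffOn ℝ ∞ (metricCoord e) e.target := by
  rw [contDiffOn_clm_apply]
  intro a
  rw [contDiffOn_clm_apply]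
  intro b
  have h := (contMDiffOn_symm_section he a).inner_bundle (contMDiffOn_symm_section he b)
  exact h.contDiffOn.congr fun y hy => metricCoord_symm_apply he hy a b

end Metric
end ChartGeometry

/-! ### Levi-Civita connection and curvature of a metric on an open set of a vector space -/

section LocalLeviCivita

variable {E : Type*} [NormedAddCommGroup E] [NormedSpace ℝ E]

/-- The Christoffel symbols of a metric tensor `G` on an open subset of a vector space, as a
bilinear map depending on the base point. -/
def chr (G : E → E →L[ℝ] E →L[ℝ] ℝ) (y : E) : E →L[ℝ] E →L[ℝ] E :=
  ContinuousLinearMap.compL ℝ E (E →L[ℝ] ℝ) E (G y).inverse ∘L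
    ((1 / 2 : ℝ) • (fderiv ℝ G y + (fderiv ℝ G y).flip
      - ((ContinuousLinearMap.flipₗᵢ ℝ E E ℝ).toContinuousLinearEquiv :
          (E →L[ℝ] E →L[ℝ] ℝ) →L[ℝ] (E →L[ℝ] E →L[ℝ] ℝ)) ∘L (fderiv ℝ G y).flip))

/-- The curvature tensor of a connection with Christoffel symbols `Γ`. -/
def curv (Γ : E → E →L[ℝ] E →L[ℝ] E) (y u v w : E) : E :=
  fderiv ℝ Γ y u v w - fderiv ℝ Γ y v u w + Γ y u (Γ y v w) - Γ y v (Γ y u w)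

/-- `G` is a smooth metric tensor on the open set `U`. -/
structure IsMetricOn (G : E → E →L[ℝ] E →L[ℝ] ℝ) (U : Set E) : Prop where
  isOpen : IsOpen U
  smooth : ContDiffOn ℝ ∞ G U
  comm : ∀ y ∈ U, ∀ a b, G y a b = G y b a
  pos : ∀ y ∈ U, ∀ a, a ≠ 0 → 0 < G y a a

theorem chr_apply (G : E → E →L[ℝ] E →L[ℝ] ℝ) (y u v : E) :
    chr G y u v = (G y).inverse ((1 / 2 : ℝ) • (fderiv ℝ G y u v + fderiv ℝ G y v u
      - ((fderiv ℝ G y).flip u).flip v)) := rfl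

namespace IsMetricOn

variable {G G' : E → E →L[ℝ] E →L[ℝ] ℝ} {U U' : Set E}

theorem isInvertible [FiniteDimensional ℝ E] (h : IsMetricOn G U) {y : E} (hy : y ∈ U) :
    (G y).IsInvertible := by
  have hinj : Function.Injective (G y) := by
    rw [injective_iff_map_eq_zero]
    intro a ha
    by_contra h'
    have := h.pos y hy a h'
    rw [ha] at this
    simp at this
  have hdim : Module.finrank ℝ E = Module.finrank ℝ (E →L[ℝ] ℝ) := by
    rw [← (LinearMap.toContinuousLinearMap (𝕜 := ℝ) (E := E) (F' := ℝ)).finrank_eq]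
    exact (Subspace.dual_finrank_eq).symm
  let f : E ≃ₗ[ℝ] (E →L[ℝ] ℝ) :=
    LinearEquiv.ofInjectiveOfFinrankEq (G y : E →ₗ[ℝ] (E →L[ℝ] ℝ)) hinj hdim
  exact ⟨f.toContinuousLinearEquiv, by ext a; rfl⟩

theorem ext (h : IsMetricOn G U) {y : E} (hy : y ∈ U) {a b : E}
    (hab : ∀ w, G y a w = G y b w) : a = b := by
  by_contra hne
  have := h.pos y hy (a - b) (sub_ne_zero.2 hne)
  rw [map_sub] at this
  simp [hab] at this

theorem differentiableAt (h : IsMetricOn G U) {y : E} (hy : y ∈ U) : DifferentiableAt ℝ G y :=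
  (h.smooth.contDiffAt (h.isOpen.mem_nhds hy)).differentiableAt (by simp)

theorem fderiv_comm (h : IsMetricOn G U) {y : E} (hy : y ∈ U) (u v w : E) :
    fderiv ℝ G y u v w = fderiv ℝ G y u w v := by
  have h1 : ∀ v w, HasFDerivAt (fun z => G z v w) _ y := fun v w =>
    ((h.differentiableAt hy).hasFDerivAt.clm_apply
      (hasFDerivAt_const v y)).clm_apply (hasFDerivAt_const w y)
  have h2 := (h1 v w).congr_of_eventuallyEq (f₁ := fun z => G z w v) (by
    filter_upwards [h.isOpen.mem_nhds hy] with z hz using (h.comm z hz w v))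
  have h3 := congrArg (fun f => f u) ((h1 w v).unique h2)
  simpa using h3.symm

variable [FiniteDimensional ℝ E]

theorem koszul (h : IsMetricOn G U) {y : E} (hy : y ∈ U) (u v w : E) :
    2 * G y (chr G y u v) w = fderiv ℝ G y u v w + fderiv ℝ G y v u w - fderiv ℝ G y w u v := by
  rw [chr_apply, (h.isInvertible hy).self_apply_inverse]
  simp

theorem chr_comm (h : IsMetricOn G U) {y : E} (hy : y ∈ U) (u v : E) :
    chr G y u v = chr G y v u := by
  apply h.ext hy
  intro w
  have h1 := h.koszul hy u v w
  have h2 := h.koszul hy v u w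
  have h3 := h.fderiv_comm hy w u v
  linarith

/-- Metric compatibility: add the Koszul formulas for `(u, v, w)` and `(u, w, v)`. -/
theorem fderiv_eq (h : IsMetricOn G U) {y : E} (hy : y ∈ U) (u v w : E) :
    fderiv ℝ G y u v w = G y (chr G y u v) w + G y v (chr G y u w) := by
  have h1 := h.koszul hy u v w
  have h2 := h.koszul hy u w v
  have h3 := h.fderiv_comm hy u v w
  rw [h.comm y hy v]
  have h4 := h.fderiv_comm hy v u w
  have h5 := h.fderiv_comm hy w u v
  linarith

theorem contDiffOn_chr (h : IsMetricOn G U) : ContDiffOn ℝ ∞ (chr G) U := by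
  have hD : ContDiffOn ℝ ∞ (fderiv ℝ G) U := h.smooth.fderiv_of_isOpen h.isOpen (by simp)
  have hinv : ContDiffOn ℝ ∞ (fun y => (G y).inverse) U := fun y hy =>
    ((h.isInvertible hy).contDiffAt_map_inverse.comp y
      (h.smooth.contDiffAt (h.isOpen.mem_nhds hy))).contDiffWithinAt
  have hflip : ContDiffOn ℝ ∞ (fun y => (fderiv ℝ G y).flip) U :=
    ((ContinuousLinearMap.flipₗᵢ ℝ E E (E →L[ℝ] ℝ)).toContinuousLinearEquiv.contDiff).comp_contDiffOn
      hD
  refine ContDiffOn.clm_comp ?_ ?_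
  · exact (ContinuousLinearMap.contDiff _).comp_contDiffOn hinv
  · exact (contDiffOn_const (c := (1 / 2 : ℝ))).smul ((hD.add hflip).sub (contDiffOn_const.clm_comp hflip))

theorem differentiableAt_chr (h : IsMetricOn G U) {y : E} (hy : y ∈ U) :
    DifferentiableAt ℝ (chr G) y :=
  (h.contDiffOn_chr.contDiffAt (h.isOpen.mem_nhds hy)).differentiableAt (by simp)

theorem fderiv_chr_comm (h : IsMetricOn G U) {y : E} (hy : y ∈ U) (u v w : E) :
    fderiv ℝ (chr G) y u v w = fderiv ℝ (chr G) y u w v := by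
  have h1 : ∀ v w, HasFDerivAt (fun z => chr G z v w) _ y := fun v w =>
    ((h.differentiableAt_chr hy).hasFDerivAt.clm_apply
      (hasFDerivAt_const v y)).clm_apply (hasFDerivAt_const w y)
  have h2 := (h1 v w).congr_of_eventuallyEq (f₁ := fun z => chr G z w v) (by
    filter_upwards [h.isOpen.mem_nhds hy] with z hz using (h.chr_comm hz w v))
  have h3 := congrArg (fun f => f u) ((h1 w v).unique h2)
  simpa using h3.symm

/-- Differentiate the compatibility identity `fderiv_eq` once more. The second derivative of `G` is
symmetric in `u, v`, and antisymmetrizing the right-hand side leaves exactly the two curvature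
terms. -/
theorem curv_antisymm_last (h : IsMetricOn G U) {y : E} (hy : y ∈ U) (u v a b : E) :
    G y (curv (chr G) y u v a) b + G y a (curv (chr G) y u v b) = 0 := by
  have hG := (h.differentiableAt hy).hasFDerivAt
  have hΓ := (h.differentiableAt_chr hy).hasFDerivAt
  have hD : HasFDerivAt (fderiv ℝ G) (fderiv ℝ (fderiv ℝ G) y) y :=
    (((h.smooth.fderiv_of_isOpen h.isOpen (m := ∞) (by simp)).contDiffAt
      (h.isOpen.mem_nhds hy)).differentiableAt (by simp)).hasFDerivAt
  have sym : fderiv ℝ (fderiv ℝ G) y u v = fderiv ℝ (fderiv ℝ G) y v u :=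
    (((h.smooth.contDiffAt (h.isOpen.mem_nhds hy)).of_le
      (ENat.LEInfty.out : (2 : WithTop ℕ∞) ≤ ∞)).isSymmSndFDerivAt (by simp)).eq u v
  have key : ∀ u v, fderiv ℝ (fderiv ℝ G) y u v a b =
      G y (fderiv ℝ (chr G) y u v a) b + fderiv ℝ G y u (chr G y v a) b
      + fderiv ℝ G y u a (chr G y v b) + G y a (fderiv ℝ (chr G) y u v b) := by
    intro u v
    have h1 := ((hD.clm_apply (hasFDerivAt_const v y)).clm_apply
      (hasFDerivAt_const a y)).clm_apply (hasFDerivAt_const b y)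
    have h2 := ((hG.clm_apply ((hΓ.clm_apply (hasFDerivAt_const v y)).clm_apply
      (hasFDerivAt_const a y))).clm_apply (hasFDerivAt_const b y)).add
      ((hG.clm_apply (hasFDerivAt_const a y)).clm_apply
        ((hΓ.clm_apply (hasFDerivAt_const v y)).clm_apply (hasFDerivAt_const b y)))
    have h3 := h2.congr_of_eventuallyEq (f₁ := fun z => fderiv ℝ G z v a b) (by
      filter_upwards [h.isOpen.mem_nhds hy] with z hz using h.fderiv_eq hz v a b)
    have h4 := DFunLike.congr_fun (h1.unique h3) u
    simp at h4
    rw [h4]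
    ring
  have k1 := key u v
  have k2 := key v u
  rw [sym] at k1
  simp only [h.fderiv_eq hy] at k1 k2
  simp only [curv, map_add, map_sub, _root_.add_apply, _root_.sub_apply]
  linarith

omit [FiniteDimensional ℝ E] in
theorem curv_antisymm_first (y u v w : E) : curv (chr G) y u v w = - curv (chr G) y v u w := by
  simp only [curv]; abel

theorem bianchi (h : IsMetricOn G U) {y : E} (hy : y ∈ U) (u v w : E) :
    curv (chr G) y u v w + curv (chr G) y v w u + curv (chr G) y w u v = 0 := by
  simp only [curv]
  rw [h.chr_comm hy w u, h.chr_comm hy v w, h.chr_comm hy v u, h.fderiv_chr_comm hy u v w,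
    h.fderiv_chr_comm hy v u w, h.fderiv_chr_comm hy w u v]
  abel

theorem curv_pair_symm (h : IsMetricOn G U) {y : E} (hy : y ∈ U) (a b c e : E) :
    G y (curv (chr G) y a b c) e = G y (curv (chr G) y c e a) b := by
  have A : ∀ a b c e, G y (curv (chr G) y a b c) e = - G y (curv (chr G) y b a c) e := by
    intro a b c e
    rw [curv_antisymm_first]
    simp
  have B : ∀ a b c e, G y (curv (chr G) y a b c) e = - G y (curv (chr G) y a b e) c := by
    intro a b c e
    have := h.curv_antisymm_last hy a b c e
    rw [h.comm y hy c] at this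
    linarith
  have C : ∀ a b c e, G y (curv (chr G) y a b c) e + G y (curv (chr G) y b c a) e
      + G y (curv (chr G) y c a b) e = 0 := by
    intro a b c e
    have := congrArg (fun z => G y z e) (h.bianchi hy a b c)
    simpa using this
  -- Four Bianchi identities, one for each cyclic shift of `a, b, c, e`; modulo the antisymmetries
  -- `A` and `B` their combination is the claim.
  have c1 := C a b c e
  have c2 := C b c e a
  have c3 := C c e a b
  have c4 := C e a b c
  have := B b c a e
  have := B c a b e
  have := B a b c e
  have := B c e b a
  have := B e b c a
  have := B e a c b
  have := B a c e b
  have := A a c e b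
  have := A b e a c
  have := A e b a c
  have := B b c e a
  have := B c e a b
  have := A b e c a
  have := B b e c a
  have := A a c b e
  have := B a e b c
  have := A e a b c
  have := A e a c b
  linarith

/-- The Jacobi operator `a ↦ R(a, u)u` is symmetric; the Wronskian identity, and with it the Riccati
argument, rests on this. -/
theorem curv_jacobi_symm (h : IsMetricOn G U) {y : E} (hy : y ∈ U) (a b u : E) :
    G y (curv (chr G) y a u u) b = G y (curv (chr G) y b u u) a := by
  rw [h.curv_pair_symm hy]
  have := h.curv_antisymm_last hy u b a u
  rw [h.comm y hy a] at this
  rw [curv_antisymm_first y b u u]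
  simp
  linarith

/-- `τ` is a change of coordinates on the open set `O` from the metric `G` to the metric `G'`. -/
structure Transition (G G' : E → E →L[ℝ] E →L[ℝ] ℝ) (U U' : Set E) (τ : E → E) (O : Set E) :
    Prop where
  isOpen : IsOpen O
  sub : O ⊆ U
  maps : ∀ y ∈ O, τ y ∈ U'
  smooth : ContDiffOn ℝ ∞ τ O
  surj : ∀ y ∈ O, Function.Surjective (fderiv ℝ τ y)
  metric : ∀ y ∈ O, ∀ u v, G y u v = G' (τ y) (fderiv ℝ τ y u) (fderiv ℝ τ y v)

namespace Transition

variable {τ : E → E} {O : Set E}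

omit [FiniteDimensional ℝ E] in
theorem hasFDerivAt (T : Transition G G' U U' τ O) {y : E} (hy : y ∈ O) :
    HasFDerivAt τ (fderiv ℝ τ y) y :=
  ((T.smooth.contDiffAt (T.isOpen.mem_nhds hy)).differentiableAt (by simp)).hasFDerivAt

omit [FiniteDimensional ℝ E] in
theorem contDiffOn_fderiv (T : Transition G G' U U' τ O) : ContDiffOn ℝ ∞ (fderiv ℝ τ) O :=
  T.smooth.fderiv_of_isOpen T.isOpen (by simp)

omit [FiniteDimensional ℝ E] in
theorem hasFDerivAt_fderiv (T : Transition G G' U U' τ O) {y : E} (hy : y ∈ O) :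
    HasFDerivAt (fderiv ℝ τ) (fderiv ℝ (fderiv ℝ τ) y) y :=
  ((T.contDiffOn_fderiv.contDiffAt (T.isOpen.mem_nhds hy)).differentiableAt (by simp)).hasFDerivAt

omit [FiniteDimensional ℝ E] in
theorem fderiv_fderiv_comm (T : Transition G G' U U' τ O) {y : E} (hy : y ∈ O) (a b : E) :
    fderiv ℝ (fderiv ℝ τ) y a b = fderiv ℝ (fderiv ℝ τ) y b a :=
  (((T.smooth.contDiffAt (T.isOpen.mem_nhds hy)).of_le
    (ENat.LEInfty.out : (2 : WithTop ℕ∞) ≤ ∞)).isSymmSndFDerivAt (by simp)).eq a b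

omit [FiniteDimensional ℝ E] in
theorem fderiv_metric (T : Transition G G' U U' τ O) (h : IsMetricOn G U) (h' : IsMetricOn G' U')
    {y : E} (hy : y ∈ O) (a u v : E) :
    fderiv ℝ G y a u v =
      fderiv ℝ G' (τ y) (fderiv ℝ τ y a) (fderiv ℝ τ y u) (fderiv ℝ τ y v)
      + G' (τ y) (fderiv ℝ (fderiv ℝ τ) y a u) (fderiv ℝ τ y v)
      + G' (τ y) (fderiv ℝ τ y u) (fderiv ℝ (fderiv ℝ τ) y a v) := by
  have h1 := ((h.differentiableAt (T.sub hy)).hasFDerivAt.clm_apply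
    (hasFDerivAt_const u y)).clm_apply (hasFDerivAt_const v y)
  have hτ2 := T.hasFDerivAt_fderiv hy
  have hG := (h'.differentiableAt (T.maps y hy)).hasFDerivAt
  have h2 := ((hG.comp y (T.hasFDerivAt hy)).clm_apply
    (hτ2.clm_apply (hasFDerivAt_const u y))).clm_apply (hτ2.clm_apply (hasFDerivAt_const v y))
  have h3 := h2.congr_of_eventuallyEq (f₁ := fun z => G z u v) (by
    filter_upwards [T.isOpen.mem_nhds hy] with z hz using T.metric z hz u v)
  have h4 := DFunLike.congr_fun (h1.unique h3) a
  simp at h4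
  rw [h4]
  ring

/-- Test both sides against vectors `Dτ w`, which suffices by surjectivity, and compare the Koszul
formulas by means of `fderiv_metric`. -/
theorem chr_eq (T : Transition G G' U U' τ O) (h : IsMetricOn G U) (h' : IsMetricOn G' U')
    {y : E} (hy : y ∈ O) (u v : E) :
    fderiv ℝ τ y (chr G y u v) =
      chr G' (τ y) (fderiv ℝ τ y u) (fderiv ℝ τ y v) + fderiv ℝ (fderiv ℝ τ) y u v := by
  apply h'.ext (T.maps y hy)
  intro w'
  obtain ⟨w, rfl⟩ := T.surj y hy w'
  rw [← T.metric y hy]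
  have h1 := h.koszul (T.sub hy) u v w
  have h2 := h'.koszul (T.maps y hy) (fderiv ℝ τ y u) (fderiv ℝ τ y v) (fderiv ℝ τ y w)
  have h3 := T.fderiv_metric h h' hy u v w
  have h4 := T.fderiv_metric h h' hy v u w
  have h5 := T.fderiv_metric h h' hy w u v
  have c4 := h'.comm _ (T.maps y hy) (fderiv ℝ (fderiv ℝ τ) y u w) (fderiv ℝ τ y v)
  rw [T.fderiv_fderiv_comm hy v u] at h4
  rw [T.fderiv_fderiv_comm hy w u, T.fderiv_fderiv_comm hy w v] at h5
  simp only [map_add, _root_.add_apply]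
  linarith

/-- Differentiate the transformation law `chr_eq`. The third derivative of `τ` is symmetric in its
first two arguments and disappears on antisymmetrizing. -/
theorem curv_eq (T : Transition G G' U U' τ O) (h : IsMetricOn G U) (h' : IsMetricOn G' U')
    {y : E} (hy : y ∈ O) (u v w : E) :
    fderiv ℝ τ y (curv (chr G) y u v w) =
      curv (chr G') (τ y) (fderiv ℝ τ y u) (fderiv ℝ τ y v) (fderiv ℝ τ y w) := by
  have hτ := T.hasFDerivAt hy
  have hτ2 := T.hasFDerivAt_fderiv hy
  have hC : ContDiffOn ℝ ∞ (fderiv ℝ (fderiv ℝ τ)) O :=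
    T.contDiffOn_fderiv.fderiv_of_isOpen T.isOpen (by simp)
  have hτ3 : HasFDerivAt (fderiv ℝ (fderiv ℝ τ)) (fderiv ℝ (fderiv ℝ (fderiv ℝ τ)) y) y :=
    ((hC.contDiffAt (T.isOpen.mem_nhds hy)).differentiableAt (by simp)).hasFDerivAt
  have hΓ := (h.differentiableAt_chr (T.sub hy)).hasFDerivAt
  have hΓ' := (h'.differentiableAt_chr (T.maps y hy)).hasFDerivAt
  have key : ∀ a b, fderiv ℝ τ y (fderiv ℝ (chr G) y a b w)
      = fderiv ℝ (chr G') (τ y) (fderiv ℝ τ y a) (fderiv ℝ τ y b) (fderiv ℝ τ y w)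
        + chr G' (τ y) (fderiv ℝ (fderiv ℝ τ) y a b) (fderiv ℝ τ y w)
        + chr G' (τ y) (fderiv ℝ τ y b) (fderiv ℝ (fderiv ℝ τ) y a w)
        + fderiv ℝ (fderiv ℝ (fderiv ℝ τ)) y a b w
        - fderiv ℝ (fderiv ℝ τ) y a (chr G y b w) := by
    intro a b
    have h1 := hτ2.clm_apply ((hΓ.clm_apply (hasFDerivAt_const b y)).clm_apply
      (hasFDerivAt_const w y))
    have h2 := (((hΓ'.comp y hτ).clm_apply (hτ2.clm_apply (hasFDerivAt_const b y))).clm_apply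
      (hτ2.clm_apply (hasFDerivAt_const w y))).add
        ((hτ3.clm_apply (hasFDerivAt_const b y)).clm_apply (hasFDerivAt_const w y))
    have h3 := h2.congr_of_eventuallyEq (f₁ := fun z => fderiv ℝ τ z (chr G z b w)) (by
      filter_upwards [T.isOpen.mem_nhds hy] with z hz using T.chr_eq h h' hz b w)
    have h4 := DFunLike.congr_fun (h1.unique h3) a
    simp at h4
    rw [eq_sub_iff_add_eq, h4]
    abel
  have sym3 : fderiv ℝ (fderiv ℝ (fderiv ℝ τ)) y u v = fderiv ℝ (fderiv ℝ (fderiv ℝ τ)) y v u :=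
    (((T.contDiffOn_fderiv.contDiffAt (T.isOpen.mem_nhds hy)).of_le
      (ENat.LEInfty.out : (2 : WithTop ℕ∞) ≤ ∞)).isSymmSndFDerivAt (by simp)).eq u v
  simp only [curv, map_add, map_sub, T.chr_eq h h' hy, key, sym3, T.fderiv_fderiv_comm hy v u]
  abel

/-- Chart independence of the covariant derivative: the derivative of `Dτ` along the curve cancels
the second-derivative term of `chr_eq`. -/
theorem hasDerivWithinAt_field (T : Transition G G' U U' τ O) (h : IsMetricOn G U)
    (h' : IsMetricOn G' U') {S : Set ℝ} {t : ℝ} {x V : ℝ → E} {u W : E} (hx : x t ∈ O)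
    (hu : HasDerivWithinAt x u S t) (hV : HasDerivWithinAt V (W - chr G (x t) u (V t)) S t) :
    HasDerivWithinAt (fun s => fderiv ℝ τ (x s) (V s))
      (fderiv ℝ τ (x t) W
        - chr G' (τ (x t)) (fderiv ℝ τ (x t) u) (fderiv ℝ τ (x t) (V t))) S t := by
  have h1 := ((T.hasFDerivAt_fderiv hx).comp_hasDerivWithinAt t hu).clm_apply hV
  refine h1.congr_deriv ?_
  simp only [Function.comp, map_sub, T.chr_eq h h' hx]
  abel

end Transition
end IsMetricOn
end LocalLeviCivita

/-! ### Transfer to the manifold: curvature tensor, velocities and covariant derivatives -/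

section Christoffel

variable {d : ℕ} {M : Type*} [TopologicalSpace M]

/-- The coordinate change from the chart `e` to the chart `e'`. -/
def transition (e e' : OpenPartialHomeomorph M (Coord d)) (y : Coord d) : Coord d := e' (e.symm y)

/-- The domain of the coordinate change from `e` to `e'`. -/
def overlap (e e' : OpenPartialHomeomorph M (Coord d)) : Set (Coord d) :=
  e.target ∩ e.symm ⁻¹' e'.source

variable {e e' : OpenPartialHomeomorph M (Coord d)}

theorem isOpen_overlap : IsOpen (overlap e e') :=
  e.symm.isOpen_inter_preimage e'.open_source

theorem mem_overlap {x : M} (hx : x ∈ e.source) (hx' : x ∈ e'.source) : e x ∈ overlap e e' :=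
  ⟨e.map_source hx, by simpa [e.left_inv hx] using hx'⟩

theorem transition_apply {x : M} (hx : x ∈ e.source) : transition e e' (e x) = e' x := by
  simp [transition, e.left_inv hx]

theorem transition_mem {y : Coord d} (hy : y ∈ overlap e e') : transition e e' y ∈ e'.target :=
  e'.map_source hy.2

section Smooth

variable [ChartedSpace (Coord d) M] [IsManifold (𝓡 d) ∞ M]

theorem contDiffOn_transition (he : e ∈ atlas (Coord d) M) (he' : e' ∈ atlas (Coord d) M) :
    ContDiffOn ℝ ∞ (transition e e') (overlap e e') :=
  ((contMDiffOn_of_atlas he').comp ((contMDiffOn_symm_of_atlas he).mono inter_subset_left)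
    (fun _ hy => hy.2)).contDiffOn

theorem fderiv_transition (he : e ∈ atlas (Coord d) M) (he' : e' ∈ atlas (Coord d) M)
    {y : Coord d} (hy : y ∈ overlap e e') (a : Coord d) :
    fderiv ℝ (transition e e') y a = chartD e' (e.symm y) (chartV e (e.symm y) a) := by
  have h1 : HasMFDerivAt (𝓡 d) (𝓡 d) e.symm y (mfderiv (𝓡 d) (𝓡 d) e.symm y) :=
    ((mdiff_of_mem_atlas he).mdifferentiableAt_symm hy.1).hasMFDerivAt
  have h2 : HasMFDerivAt (𝓡 d) (𝓡 d) e' (e.symm y) (mfderiv (𝓡 d) (𝓡 d) e' (e.symm y)) :=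
    ((mdiff_of_mem_atlas he').mdifferentiableAt hy.2).hasMFDerivAt
  have h3 := (h2.comp y h1).mfderiv
  rw [mfderiv_eq_fderiv] at h3
  rw [chartV_eq_mfderiv_symm he hy.1]
  exact DFunLike.congr_fun h3 a

theorem fderiv_transition_chartD (he : e ∈ atlas (Coord d) M) (he' : e' ∈ atlas (Coord d) M)
    {x : M} (hx : x ∈ e.source) (hx' : x ∈ e'.source) (a : TangentSpace (𝓡 d) x) :
    fderiv ℝ (transition e e') (e x) (chartD e x a) = chartD e' x a := by
  obtain ⟨y, hy, rfl⟩ : ∃ y ∈ e.target, e.symm y = x := ⟨e x, e.map_source hx, e.left_inv hx⟩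
  rw [e.right_inv hy, fderiv_transition he he' ⟨hy, hx'⟩, chartV_chartD he hx]

theorem fderiv_transition_surjective (he : e ∈ atlas (Coord d) M) (he' : e' ∈ atlas (Coord d) M)
    {y : Coord d} (hy : y ∈ overlap e e') : Function.Surjective (fderiv ℝ (transition e e') y) := by
  intro b
  refine ⟨chartD e (e.symm y) (chartV e' (e.symm y) b), ?_⟩
  rw [fderiv_transition he he' hy, chartV_chartD he (e.map_target hy.1), chartD_chartV he' hy.2]

end Smooth


section Levi

variable [ChartedSpace (Coord d) M] [RiemannianBundle (fun x : M => TangentSpace (𝓡 d) x)]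

/-- The Christoffel symbols in the chart `e` as a continuous bilinear map. -/
def Gam (e : OpenPartialHomeomorph M (Coord d)) : Coord d → Coord d →L[ℝ] Coord d →L[ℝ] Coord d :=
  chr (metricCoord e)

theorem christoffel_eq (y u v : Coord d) : christoffel e y u v = Gam e y u v := rfl

variable [IsManifold (𝓡 d) ∞ M]
  [IsContMDiffRiemannianBundle (𝓡 d) ∞ (Coord d) (fun x : M => TangentSpace (𝓡 d) x)]

theorem isMetricOn_metricCoord (he : e ∈ atlas (Coord d) M) :
    IsMetricOn (metricCoord e) e.target where
  isOpen := e.open_target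
  smooth := contDiffOn_metricCoord he
  comm _ hy := metricCoord_comm he hy
  pos _ hy _ ha := metricCoord_pos he hy ha

theorem transition_metricCoord (he : e ∈ atlas (Coord d) M) (he' : e' ∈ atlas (Coord d) M) :
    IsMetricOn.Transition (metricCoord e) (metricCoord e') e.target e'.target (transition e e')
      (overlap e e') where
  isOpen := isOpen_overlap
  sub _ hy := hy.1
  maps _ hy := transition_mem hy
  smooth := contDiffOn_transition he he'
  surj _ hy := fderiv_transition_surjective he he' hy
  metric y hy u v := by
    rw [fderiv_transition he he' hy, fderiv_transition he he' hy, transition,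
      metricCoord_chartD he' hy.2, metricCoord_symm_apply he hy.1]

theorem curvatureCoord_eq (he : e ∈ atlas (Coord d) M) {y : Coord d} (hy : y ∈ e.target)
    (u v w : Coord d) : curvatureCoord e y u v w = curv (Gam e) y u v w := by
  have key : ∀ u v, fderiv ℝ (fun z => Gam e z v w) y u = fderiv ℝ (Gam e) y u v w := by
    intro u v
    have h1 : HasFDerivAt (fun z => Gam e z v w) _ y :=
      ((((isMetricOn_metricCoord he).differentiableAt_chr hy).hasFDerivAt.clm_apply
        (hasFDerivAt_const v y)).clm_apply (hasFDerivAt_const w y))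
    rw [h1.fderiv]
    simp [Gam]
  simp only [curvatureCoord, christoffel_eq, curv]
  rw [key, key]

/-- The Riemann curvature tensor on the tangent space at `x`. -/
def Rm (x : M) (a b w : TangentSpace (𝓡 d) x) : TangentSpace (𝓡 d) x :=
  let e := chartAt (Coord d) x
  chartV e x (curvatureCoord e (e x) (chartD e x a) (chartD e x b) (chartD e x w))

/-- `Rm` is defined through the preferred chart at `x`; tensoriality of the curvature makes the
formula valid in every chart. -/
theorem chartD_Rm (he : e ∈ atlas (Coord d) M) {x : M} (hx : x ∈ e.source)
    (a b w : TangentSpace (𝓡 d) x) :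
    chartD e x (Rm x a b w) =
      curv (Gam e) (e x) (chartD e x a) (chartD e x b) (chartD e x w) := by
  set e₀ := chartAt (Coord d) x with he₀
  have h0 : e₀ ∈ atlas (Coord d) M := chart_mem_atlas _ x
  have hx0 : x ∈ e₀.source := mem_chart_source _ x
  have hy := mem_overlap hx0 hx
  have h := (transition_metricCoord h0 he).curv_eq (isMetricOn_metricCoord h0)
    (isMetricOn_metricCoord he) hy (chartD e₀ x a) (chartD e₀ x b) (chartD e₀ x w)
  rw [transition_apply hx0, fderiv_transition_chartD h0 he hx0 hx,
    fderiv_transition_chartD h0 he hx0 hx, fderiv_transition_chartD h0 he hx0 hx] at h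
  unfold Gam
  rw [← h, Rm, ← he₀, curvatureCoord_eq h0 (e₀.map_source hx0),
    ← fderiv_transition_chartD h0 he hx0 hx, chartD_chartV h0 hx0]
  rfl

theorem Rm_add_left (x : M) (a a' b w : TangentSpace (𝓡 d) x) :
    Rm x (a + a') b w = Rm x a b w + Rm x a' b w := by
  apply chartD_injective (chart_mem_atlas _ x) (mem_chart_source (Coord d) x)
  simp only [map_add, chartD_Rm (chart_mem_atlas _ x) (mem_chart_source (Coord d) x), curv,
    _root_.add_apply]
  abel

theorem Rm_smul_left (x : M) (r : ℝ) (a b w : TangentSpace (𝓡 d) x) :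
    Rm x (r • a) b w = r • Rm x a b w := by
  apply chartD_injective (chart_mem_atlas _ x) (mem_chart_source (Coord d) x)
  simp only [map_smul, chartD_Rm (chart_mem_atlas _ x) (mem_chart_source (Coord d) x), curv,
    _root_.smul_apply]
  module

theorem Rm_smul_smul (x : M) (r : ℝ) (a b w : TangentSpace (𝓡 d) x) :
    Rm x a (r • b) (r • w) = (r * r) • Rm x a b w := by
  apply chartD_injective (chart_mem_atlas _ x) (mem_chart_source (Coord d) x)
  simp only [map_smul, chartD_Rm (chart_mem_atlas _ x) (mem_chart_source (Coord d) x), curv,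
    _root_.smul_apply]
  module

theorem inner_Rm_symm (x : M) (a b u : TangentSpace (𝓡 d) x) :
    inner ℝ (Rm x a u u) b = inner ℝ (Rm x b u u) a := by
  have he := chart_mem_atlas (Coord d) x
  have hx := mem_chart_source (Coord d) x
  rw [← metricCoord_chartD he hx, ← metricCoord_chartD he hx, chartD_Rm he hx, chartD_Rm he hx]
  exact (isMetricOn_metricCoord he).curv_jacobi_symm (OpenPartialHomeomorph.map_source _ hx) _ _ _

section Fields

variable {c : ℝ → M} {S : Set ℝ} {t : ℝ}

/-- `U` is the velocity at time `t` of the curve `c` restricted to `S`. -/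
structure HasVelocityWithinAt (c : ℝ → M) (S : Set ℝ) (t : ℝ)
    (U : TangentSpace (𝓡 d) (c t)) : Prop where
  continuousWithinAt : ContinuousWithinAt c S t
  deriv : ∀ e ∈ atlas (Coord d) M, c t ∈ e.source →
    HasDerivWithinAt (fun s => e (c s)) (chartD e (c t) U) S t

/-- `W` is the covariant derivative at time `t` of the vector field `V` along the curve `c` with
velocity `U`. -/
def HasCovDerivWithinAt (c : ℝ → M) (V : (t : ℝ) → TangentSpace (𝓡 d) (c t)) (S : Set ℝ) (t : ℝ)
    (U W : TangentSpace (𝓡 d) (c t)) : Prop :=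
  ∀ e ∈ atlas (Coord d) M, c t ∈ e.source →
    HasDerivWithinAt (fieldCoord e c V)
      (chartD e (c t) W - Gam e (e (c t)) (chartD e (c t) U) (chartD e (c t) (V t))) S t

theorem HasVelocityWithinAt.of_chart (he : e ∈ atlas (Coord d) M) (hc : ContinuousWithinAt c S t)
    (ht : c t ∈ e.source) {U : TangentSpace (𝓡 d) (c t)}
    (h : HasDerivWithinAt (fun s => e (c s)) (chartD e (c t) U) S t) :
    HasVelocityWithinAt c S t U where
  continuousWithinAt := hc
  deriv e' he' ht' := by
    have hy := mem_overlap ht ht'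
    have h1 := ((transition_metricCoord he he').hasFDerivAt hy).comp_hasDerivWithinAt t h
    rw [fderiv_transition_chartD he he' ht ht'] at h1
    refine h1.congr_of_eventuallyEq ?_ (transition_apply ht).symm
    filter_upwards [hc.preimage_mem_nhdsWithin (e.open_source.mem_nhds ht)] with s hs
    exact (transition_apply hs).symm

/-- One chart is enough, so equations can be solved in a convenient chart and then read in any
other. -/
theorem HasCovDerivWithinAt.of_chart (he : e ∈ atlas (Coord d) M) (ht : c t ∈ e.source)
    {V : (t : ℝ) → TangentSpace (𝓡 d) (c t)} {U W : TangentSpace (𝓡 d) (c t)}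
    (hU : HasVelocityWithinAt c S t U)
    (h : HasDerivWithinAt (fieldCoord e c V)
      (chartD e (c t) W - Gam e (e (c t)) (chartD e (c t) U) (chartD e (c t) (V t))) S t) :
    HasCovDerivWithinAt c V S t U W := by
  intro e' he' ht'
  have hy := mem_overlap ht ht'
  have h1 := (transition_metricCoord he he').hasDerivWithinAt_field (isMetricOn_metricCoord he)
    (isMetricOn_metricCoord he') (x := fun s => e (c s)) hy (hU.deriv e he ht) h
  have h2 : ∀ a : TangentSpace (𝓡 d) (c t), fderiv ℝ (transition e e') (e (c t)) (chartD e (c t) a)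
      = chartD e' (c t) a := fderiv_transition_chartD he he' ht ht'
  have h3 : fderiv ℝ (transition e e') (e (c t)) (fieldCoord e c V t)
      = chartD e' (c t) (V t) := h2 (V t)
  simp only [h2, h3, transition_apply ht] at h1
  refine h1.congr_of_eventuallyEq ?_ h3.symm
  filter_upwards [hU.continuousWithinAt.preimage_mem_nhdsWithin (e.open_source.mem_nhds ht),
    hU.continuousWithinAt.preimage_mem_nhdsWithin (e'.open_source.mem_nhds ht')] with s hs hs'
  exact (fderiv_transition_chartD he he' hs hs' (V s)).symm

end Fields

end Levi
end Christoffel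

/-! ### Real induction on a compact interval -/

section RealInduction

/-- Induction along a compact interval: a property that propagates to the right near every point of
the interval below which it holds, holds on the whole interval. -/
theorem Icc_forward_induction {a b : ℝ} {P : ℝ → Prop} (h0 : P a)
    (step : ∀ t₀ ∈ Icc a b, (∀ s ∈ Ico a t₀, P s) → ∃ δ > 0, ∀ s ∈ Icc a b, ∀ t ∈ Icc a b,
      |s - t₀| < δ → |t - t₀| < δ → s ≤ t → P s → P t) :
    ∀ t ∈ Icc a b, P t := by
  intro t₁ ht₁
  have hab : a ≤ b := ht₁.1.trans ht₁.2
  let S : Set ℝ := {t | t ∈ Icc a b ∧ ∀ r ∈ Icc a t, P r}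
  have haS : a ∈ S := ⟨⟨le_rfl, hab⟩, fun r hr => by
    rw [le_antisymm hr.2 hr.1]; exact h0⟩
  have hbdd : BddAbove S := ⟨b, fun t ht => ht.1.2⟩
  set m := sSup S with hm
  have ham : a ≤ m := le_csSup hbdd haS
  have hmb : m ≤ b := csSup_le ⟨a, haS⟩ fun t ht => ht.1.2
  have hlt : ∀ s ∈ Ico a m, P s := by
    intro s hs
    obtain ⟨t, htS, hst⟩ := exists_lt_of_lt_csSup ⟨a, haS⟩ hs.2
    exact htS.2 s ⟨hs.1, hst.le⟩
  obtain ⟨δ, hδ, H⟩ := step m ⟨ham, hmb⟩ hlt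
  obtain ⟨s, hsab, hsm, hsm', hPs⟩ : ∃ s ∈ Icc a b, s ≤ m ∧ |s - m| < δ ∧ P s := by
    rcases ham.eq_or_lt with h | h
    · exact ⟨a, ⟨le_rfl, hab⟩, ham, by rw [h]; simpa using hδ, h0⟩
    · refine ⟨max a (m - δ / 2), ⟨le_max_left _ _, max_le hab (by linarith)⟩,
        max_le ham (by linarith), ?_, hlt _ ⟨le_max_left _ _, max_lt h (by linarith)⟩⟩
      rw [abs_lt]
      constructor
      · have := le_max_right a (m - δ / 2); linarith
      · have : max a (m - δ / 2) < m := max_lt h (by linarith)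
        linarith
  have hP : ∀ t ∈ Icc a b, t < m + δ → P t := by
    intro t ht htm
    rcases lt_or_ge t m with h | h
    · exact hlt t ⟨ht.1, h⟩
    · exact H s hsab t ht hsm' (by rw [abs_lt]; constructor <;> linarith) (hsm.trans h) hPs
  -- The property reaches past the supremum `m` unless the interval ends there, so `m = b`.
  have hmin : min (m + δ / 2) b ∈ S :=
    ⟨⟨le_min (by linarith) hab, min_le_right _ _⟩, fun r hr =>
      hP r ⟨hr.1, hr.2.trans (min_le_right _ _)⟩ (by
        have := hr.2.trans (min_le_left _ _); linarith)⟩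
  have hle : min (m + δ / 2) b ≤ m := le_csSup hbdd hmin
  have hbm : b ≤ m := by
    rcases min_le_iff.1 hle with h | h
    · linarith
    · exact h
  exact hP t₁ ht₁ (by linarith [ht₁.2])

end RealInduction

/-! ### Linear differential equations on compact intervals -/

section LinearODE

variable {V : Type*} [NormedAddCommGroup V] [NormedSpace ℝ V]

theorem HasDerivWithinAt.Ici_of_Icc {f : ℝ → V} {f' : V} {a b t : ℝ}
    (h : HasDerivWithinAt f f' (Icc a b) t) (ht : t ∈ Ico a b) :
    HasDerivWithinAt f f' (Ici t) t :=
  (h.mono (Icc_subset_Icc_left ht.1)).mono_of_mem_nhdsWithin (Icc_mem_nhdsGE ht.2)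

theorem hasDerivWithinAt_ite_Icc {f g f' g' : ℝ → V} {a s t : ℝ} (hs : s ∈ Icc a t)
    (hf : ∀ τ ∈ Icc a s, HasDerivWithinAt f (f' τ) (Icc a s) τ)
    (hg : ∀ τ ∈ Icc s t, HasDerivWithinAt g (g' τ) (Icc s t) τ) (hfg : f s = g s)
    (hfg' : f' s = g' s) {τ : ℝ} (hτ : τ ∈ Icc a t) :
    HasDerivWithinAt (fun τ => if τ ≤ s then f τ else g τ) (if τ ≤ s then f' τ else g' τ)
      (Icc a t) τ := by
  have e1 : EqOn (fun τ => if τ ≤ s then f τ else g τ) f (Icc a s) := fun τ hτ => if_pos hτ.2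
  have e2 : EqOn (fun τ => if τ ≤ s then f τ else g τ) g (Icc s t) := by
    intro τ hτ
    rcases hτ.1.eq_or_lt with h | h
    · subst h; simp [hfg]
    · exact if_neg (not_le.2 h)
  rcases lt_trichotomy τ s with h | h | h
  · rw [if_pos h.le]
    refine ((hf τ ⟨hτ.1, h.le⟩).congr e1 (e1 ⟨hτ.1, h.le⟩)).mono_of_mem_nhdsWithin ?_
    filter_upwards [self_mem_nhdsWithin, mem_nhdsWithin_of_mem_nhds (Iio_mem_nhds h)] with r hr hr'
    exact ⟨hr.1, le_of_lt hr'⟩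
  · subst h
    rw [if_pos le_rfl, ← Icc_union_Icc_eq_Icc hs.1 hs.2]
    refine ((hf τ ⟨hs.1, le_rfl⟩).congr e1 (e1 ⟨hs.1, le_rfl⟩)).union ?_
    rw [hfg']
    exact (hg τ ⟨le_rfl, hs.2⟩).congr e2 (e2 ⟨le_rfl, hs.2⟩)
  · rw [if_neg (not_le.2 h)]
    refine ((hg τ ⟨h.le, hτ.2⟩).congr e2 (e2 ⟨h.le, hτ.2⟩)).mono_of_mem_nhdsWithin ?_
    filter_upwards [self_mem_nhdsWithin, mem_nhdsWithin_of_mem_nhds (Ioi_mem_nhds h)] with r hr hr'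
    exact ⟨le_of_lt hr', hr.2⟩

theorem exists_linear_ode_solution_short [CompleteSpace V] {A : ℝ → V →L[ℝ] V} {a b K : ℝ}
    (hab : a ≤ b) (hA : ContinuousOn A (Icc a b)) (hK0 : 0 ≤ K) (hK : ∀ t ∈ Icc a b, ‖A t‖ ≤ K)
    (hsmall : K * (b - a) ≤ 1 / 2) (x₀ : V) :
    ∃ y : ℝ → V, y a = x₀ ∧ ∀ t ∈ Icc a b, HasDerivWithinAt y (A t (y t)) (Icc a b) t := by
  -- On the ball of radius `‖x₀‖ + 1` about `x₀` the field is at most `K (2‖x₀‖ + 1)`; over a length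
  -- with `K (b - a) ≤ 1/2` the solution cannot leave this ball.
  have hP : IsPicardLindelof (fun t x => A t x) (⟨a, le_rfl, hab⟩ : Icc a b) x₀
      (‖x₀‖₊ + 1) 0 (K.toNNReal * (2 * ‖x₀‖₊ + 1)) K.toNNReal := by
    refine ⟨fun t ht => ?_, fun x _ => hA.clm_apply continuousOn_const, fun t ht x hx => ?_, ?_⟩
    · refine ((A t).lipschitz.weaken ?_).lipschitzOnWith
      rw [← NNReal.coe_le_coe, Real.coe_toNNReal _ hK0]
      exact hK t ht
    · have h1 : ‖x‖ ≤ 2 * ‖x₀‖ + 1 := by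
        have h2 : ‖x - x₀‖ ≤ ‖x₀‖ + 1 := by simpa [dist_eq_norm] using hx
        have h3 := norm_sub_norm_le x x₀
        linarith
      have h4 := (A t).le_opNorm x
      push_cast
      rw [Real.coe_toNNReal _ hK0]
      exact h4.trans (mul_le_mul (hK t ht) h1 (norm_nonneg _) hK0)
    · push_cast
      rw [Real.coe_toNNReal _ hK0, sub_self, max_eq_left (by linarith)]
      have := norm_nonneg x₀
      nlinarith
  exact hP.exists_eq_forall_mem_Icc_hasDerivWithinAt₀

theorem exists_linear_ode_solution [CompleteSpace V] {A : ℝ → V →L[ℝ] V} {a b : ℝ}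
    (hab : a ≤ b) (hA : ContinuousOn A (Icc a b)) (x₀ : V) :
    ∃ y : ℝ → V, y a = x₀ ∧ ∀ t ∈ Icc a b, HasDerivWithinAt y (A t (y t)) (Icc a b) t := by
  obtain ⟨K, hK⟩ := isCompact_Icc.exists_bound_of_continuousOn hA
  have hK0 : 0 ≤ K := (norm_nonneg _).trans (hK a ⟨le_rfl, hab⟩)
  refine Icc_forward_induction (a := a) (b := b) (P := fun t => ∃ y : ℝ → V, y a = x₀ ∧
    ∀ s ∈ Icc a t, HasDerivWithinAt y (A s (y s)) (Icc a t) s) ?_ ?_ b ⟨hab, le_rfl⟩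
  · refine ⟨fun _ => x₀, rfl, fun s hs => ?_⟩
    rw [Icc_self] at hs ⊢
    rw [mem_singleton_iff.1 hs]
    exact HasFDerivWithinAt.of_subsingleton subsingleton_singleton
  · intro t₀ _ _
    -- Two points within this distance of `t₀` are at most `1 / (2 (K + 1))` apart. The step depends
    -- neither on `t₀` nor on the value reached, by linearity.
    refine ⟨1 / (4 * (K + 1)), by positivity, ?_⟩
    rintro s hs t ht hs' ht' hst ⟨y, hy0, hy⟩
    have hsub : Icc s t ⊆ Icc a b := Icc_subset_Icc hs.1 ht.2
    obtain ⟨z, hz0, hz⟩ := exists_linear_ode_solution_short hst (hA.mono hsub) hK0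
      (fun r hr => hK r (hsub hr)) (by
        have h1 : t - s ≤ 1 / (2 * (K + 1)) := by
          have : 1 / (2 * (K + 1)) = 1 / (4 * (K + 1)) + 1 / (4 * (K + 1)) := by
            field_simp; norm_num
          rw [abs_lt] at hs' ht'
          linarith
        calc K * (t - s) ≤ (K + 1) * (1 / (2 * (K + 1))) :=
              mul_le_mul (by linarith) h1 (by linarith) (by linarith)
          _ = 1 / 2 := by field_simp) (y s)
    refine ⟨fun τ => if τ ≤ s then y τ else z τ, by simp [hs.1, hy0], fun τ hτ => ?_⟩
    have := hasDerivWithinAt_ite_Icc ⟨hs.1, hst⟩ hy hz hz0.symm (by rw [hz0]) hτ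
    convert this using 1
    by_cases h : τ ≤ s <;> simp [h]

end LinearODE

/-! ### The equation y'' + R y = 0: energy, Wronskian and Riccati estimates -/

section JacobiODE

variable {V : Type*} [NormedAddCommGroup V] [InnerProductSpace ℝ V]

/-- The pair `(y, z)` solves `y' = z`, `z' = - R y` on the set `S`. -/
structure SolvesJacobi (R : ℝ → V →L[ℝ] V) (y z : ℝ → V) (S : Set ℝ) : Prop where
  left : ∀ t ∈ S, HasDerivWithinAt y (z t) S t
  right : ∀ t ∈ S, HasDerivWithinAt z (-(R t (y t))) S t

/-- No nonzero solution of `y'' + R y = 0` vanishes at two parameters in `S`. -/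
def ConjFree (R : ℝ → V →L[ℝ] V) (S : Set ℝ) : Prop :=
  ∀ a ∈ S, ∀ b ∈ S, a < b → ∀ y z : ℝ → V, SolvesJacobi R y z (Icc a b) → y a = 0 → y b = 0 →
    ∀ t ∈ Icc a b, y t = 0

variable {R : ℝ → V →L[ℝ] V}

theorem SolvesJacobi.mono {y z : ℝ → V} {S S' : Set ℝ} (h : SolvesJacobi R y z S) (hS : S' ⊆ S) :
    SolvesJacobi R y z S' :=
  ⟨fun t ht => (h.left t (hS ht)).mono hS, fun t ht => (h.right t (hS ht)).mono hS⟩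

theorem SolvesJacobi.sub {y z y' z' : ℝ → V} {S : Set ℝ} (h : SolvesJacobi R y z S)
    (h' : SolvesJacobi R y' z' S) :
    SolvesJacobi R (fun t => y t - y' t) (fun t => z t - z' t) S :=
  ⟨fun t ht => (h.left t ht).sub (h'.left t ht), fun t ht => by
    have := (h.right t ht).sub (h'.right t ht)
    rwa [← neg_sub', ← map_sub] at this⟩

/-- The energy `φ = |y|² + |z|²` satisfies `|φ'| ≤ (1 + k) φ`, so `φ` is controlled both forwards
and backwards in time. -/
theorem SolvesJacobi.energy {y z : ℝ → V} {a b k : ℝ} (hab : a ≤ b)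
    (h : SolvesJacobi R y z (Icc a b)) (hk : ∀ t ∈ Icc a b, ‖R t‖ ≤ k) :
    ‖y b‖ ^ 2 + ‖z b‖ ^ 2 ≤ Real.exp ((1 + k) * (b - a)) * (‖y a‖ ^ 2 + ‖z a‖ ^ 2) ∧
    ‖y a‖ ^ 2 + ‖z a‖ ^ 2 ≤ Real.exp ((1 + k) * (b - a)) * (‖y b‖ ^ 2 + ‖z b‖ ^ 2) := by
  set φ : ℝ → ℝ := fun t => ‖y t‖ ^ 2 + ‖z t‖ ^ 2 with hφ
  have hd : ∀ t ∈ Icc a b, HasDerivWithinAt φ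
      (2 * inner ℝ (y t) (z t) + 2 * inner ℝ (z t) (-(R t (y t)))) (Icc a b) t := fun t ht =>
    (h.left t ht).norm_sq.add (h.right t ht).norm_sq
  have hbound : ∀ t ∈ Icc a b,
      |2 * inner ℝ (y t) (z t) + 2 * inner ℝ (z t) (-(R t (y t)))| ≤ (1 + k) * φ t := by
    intro t ht
    have h1 := abs_real_inner_le_norm (y t) (z t)
    have h2 := abs_real_inner_le_norm (z t) (-(R t (y t)))
    rw [norm_neg] at h2
    have h3 := ((R t).le_opNorm (y t)).trans
      (mul_le_mul_of_nonneg_right (hk t ht) (norm_nonneg (y t)))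
    have h4 : ‖z t‖ * ‖R t (y t)‖ ≤ ‖z t‖ * (k * ‖y t‖) :=
      mul_le_mul_of_nonneg_left h3 (norm_nonneg _)
    have hk0 : 0 ≤ k := (norm_nonneg _).trans (hk t ht)
    have h5 : 2 * (‖y t‖ * ‖z t‖) ≤ φ t := by
      have := sq_nonneg (‖y t‖ - ‖z t‖)
      simp only [hφ]; nlinarith
    have h6 := abs_add_le (2 * inner ℝ (y t) (z t)) (2 * inner ℝ (z t) (-(R t (y t))))
    rw [abs_mul, abs_mul, abs_two] at h6
    nlinarith
  have hexp : ∀ (κ t : ℝ), HasDerivAt (fun t => Real.exp (κ * (t - a)))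
      (Real.exp (κ * (t - a)) * κ) t := by
    intro κ t
    have := (((hasDerivAt_id t).sub_const a).const_mul κ).exp
    simpa using this
  have hcont : ContinuousOn φ (Icc a b) := fun t ht => (hd t ht).continuousWithinAt
  have hint : interior (Icc a b) ⊆ Icc a b := interior_subset
  have hcexp : ∀ κ, ContinuousOn (fun t => Real.exp (κ * (t - a))) (Icc a b) := fun κ t _ =>
    (hexp κ t).continuousAt.continuousWithinAt
  have m1 : AntitoneOn (fun t => Real.exp (-(1 + k) * (t - a)) * φ t) (Icc a b) := by
    refine antitoneOn_of_hasDerivWithinAt_nonpos (convex_Icc a b) ((hcexp _).mul hcont)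
      (fun t ht => (hexp _ t).hasDerivWithinAt.mul ((hd t (hint ht)).mono hint)) fun t ht => ?_
    have h1 := (abs_le.1 (hbound t (hint ht))).2
    have h2 := Real.exp_pos (-(1 + k) * (t - a))
    nlinarith
  have m2 : MonotoneOn (fun t => Real.exp ((1 + k) * (t - a)) * φ t) (Icc a b) := by
    refine monotoneOn_of_hasDerivWithinAt_nonneg (convex_Icc a b) ((hcexp _).mul hcont)
      (fun t ht => (hexp _ t).hasDerivWithinAt.mul ((hd t (hint ht)).mono hint)) fun t ht => ?_
    have h1 := (abs_le.1 (hbound t (hint ht))).1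
    have h2 := Real.exp_pos ((1 + k) * (t - a))
    nlinarith
  have e1 := m1 ⟨le_rfl, hab⟩ ⟨hab, le_rfl⟩ hab
  have e2 := m2 ⟨le_rfl, hab⟩ ⟨hab, le_rfl⟩ hab
  simp only [sub_self, mul_zero, Real.exp_zero, one_mul] at e1 e2
  refine ⟨?_, e2⟩
  have h3 : Real.exp ((1 + k) * (b - a)) * Real.exp (-(1 + k) * (b - a)) = 1 := by
    rw [← Real.exp_add, Real.exp_eq_one_iff]; ring
  calc φ b = Real.exp ((1 + k) * (b - a)) * (Real.exp (-(1 + k) * (b - a)) * φ b) := by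
        rw [← mul_assoc, h3, one_mul]
    _ ≤ _ := mul_le_mul_of_nonneg_left e1 (Real.exp_pos _).le

theorem exists_solvesJacobi [CompleteSpace V] {a b : ℝ} (hab : a ≤ b)
    (hR : ContinuousOn R (Icc a b)) (y₀ z₀ : V) :
    ∃ y z : ℝ → V, y a = y₀ ∧ z a = z₀ ∧ SolvesJacobi R y z (Icc a b) := by
  obtain ⟨w, hw0, hw⟩ := exists_linear_ode_solution (V := V × V)
    (A := fun t => (ContinuousLinearMap.snd ℝ V V).prod
      (-((R t) ∘L ContinuousLinearMap.fst ℝ V V))) hab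
    (by
      have h1 : ContinuousOn (fun t => -((R t) ∘L ContinuousLinearMap.fst ℝ V V)) (Icc a b) :=
        (hR.clm_comp continuousOn_const).neg
      exact (ContinuousLinearMap.prodₗᵢ ℝ).continuous.comp_continuousOn
        (continuousOn_const.prodMk h1)) (y₀, z₀)
  refine ⟨fun t => (w t).1, fun t => (w t).2, by simp [hw0], by simp [hw0], fun t ht => ?_,
    fun t ht => ?_⟩
  · exact (hw t ht).fst
  · exact (hw t ht).snd

/-- A fundamental solution of the matrix equation `Y'' + R Y = 0` with `Y(a) = 0`, `Y'(a) = 1`. -/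
structure IsFundamental (R Y Z : ℝ → V →L[ℝ] V) (a b : ℝ) : Prop where
  left : ∀ t ∈ Icc a b, HasDerivWithinAt Y (Z t) (Icc a b) t
  right : ∀ t ∈ Icc a b, HasDerivWithinAt Z (-(R t ∘L Y t)) (Icc a b) t
  initY : Y a = 0
  initZ : Z a = 1

theorem exists_isFundamental [CompleteSpace V] {a b : ℝ} (hab : a ≤ b)
    (hR : ContinuousOn R (Icc a b)) : ∃ Y Z, IsFundamental R Y Z a b := by
  let W := V →L[ℝ] V
  obtain ⟨w, hw0, hw⟩ := exists_linear_ode_solution (V := W × W)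
    (A := fun t => (ContinuousLinearMap.snd ℝ W W).prod
      (-((ContinuousLinearMap.compL ℝ V V V (R t)) ∘L ContinuousLinearMap.fst ℝ W W))) hab
    (by
      have h0 : ContinuousOn (fun t => ContinuousLinearMap.compL ℝ V V V (R t)) (Icc a b) :=
        (ContinuousLinearMap.compL ℝ V V V).continuous.comp_continuousOn hR
      have h1 : ContinuousOn (fun t => -((ContinuousLinearMap.compL ℝ V V V (R t)) ∘L
          ContinuousLinearMap.fst ℝ W W)) (Icc a b) := (h0.clm_comp continuousOn_const).neg
      exact (ContinuousLinearMap.prodₗᵢ ℝ).continuous.comp_continuousOn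
        (continuousOn_const.prodMk h1)) ((0 : W), (1 : W))
  exact ⟨fun t => (w t).1, fun t => (w t).2, fun t ht => (hw t ht).fst, fun t ht => (hw t ht).snd,
    by simp [hw0], by simp [hw0]⟩

namespace IsFundamental

variable {Y Z : ℝ → V →L[ℝ] V} {a b k : ℝ}

theorem solves (h : IsFundamental R Y Z a b) (w : V) :
    SolvesJacobi R (fun t => Y t w) (fun t => Z t w) (Icc a b) :=
  ⟨fun t ht => by simpa using (h.left t ht).clm_apply (hasDerivWithinAt_const t _ w),
   fun t ht => by simpa using (h.right t ht).clm_apply (hasDerivWithinAt_const t _ w)⟩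

/-- The Wronskian is constant because `R` is symmetric, and it vanishes at `a` because `Y a = 0`.
Consequently `Z Y⁻¹` is symmetric wherever `Y` is invertible. -/
theorem wronskian (h : IsFundamental R Y Z a b)
    (hsymm : ∀ t ∈ Icc a b, ∀ v w, inner ℝ (R t v) w = inner ℝ v (R t w)) {t : ℝ}
    (ht : t ∈ Icc a b) (v w : V) : inner ℝ (Z t v) (Y t w) = inner ℝ (Y t v) (Z t w) := by
  have hd : ∀ t ∈ Icc a b, HasDerivWithinAt
      (fun t => inner ℝ (Z t v) (Y t w) - inner ℝ (Y t v) (Z t w)) 0 (Icc a b) t := by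
    intro t ht
    have h1 := (((h.solves v).right t ht).inner ℝ ((h.solves w).left t ht)).sub
      (((h.solves v).left t ht).inner ℝ ((h.solves w).right t ht))
    refine h1.congr_deriv ?_
    rw [inner_neg_left, inner_neg_right, hsymm t ht]
    ring
  have := constant_of_has_deriv_right_zero (fun t ht => (hd t ht).continuousWithinAt)
    (fun t ht => (hd t ⟨ht.1, ht.2.le⟩).Ici_of_Icc ht) t ht
  simp only [h.initY] at this
  simpa [sub_eq_zero] using this

variable [FiniteDimensional ℝ V]

/-- A kernel vector `w` of `Y t` gives a solution `Y w` vanishing at `a` and `t`, hence identically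
on `[a, t]`; its derivative at `a` is `Z a w = w`, so `w = 0`. -/
theorem isUnit_of_conjFree (h : IsFundamental R Y Z a b) {S : Set ℝ} (hS : ConjFree R S)
    (ha : a ∈ S) {t : ℝ} (htS : t ∈ S) (hat : a < t) (htb : t ≤ b) : IsUnit (Y t) := by
  have hinj : Function.Injective (Y t : V →ₗ[ℝ] V) := by
    rw [injective_iff_map_eq_zero]
    intro w hw
    have hsub : Icc a t ⊆ Icc a b := Icc_subset_Icc_right htb
    have h0 := hS a ha t htS hat _ _ ((h.solves w).mono hsub) (by simp [h.initY]) hw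
    have h1 : HasDerivWithinAt (fun s => Y s w) (Z a w) (Icc a t) a :=
      ((h.solves w).mono hsub).left a ⟨le_rfl, hat.le⟩
    have h2 : HasDerivWithinAt (fun s => Y s w) 0 (Icc a t) a :=
      (hasDerivWithinAt_const a _ (0 : V)).congr (fun s hs => h0 s hs) (h0 a ⟨le_rfl, hat.le⟩)
    have h3 := (uniqueDiffOn_Icc hat a ⟨le_rfl, hat.le⟩).eq_deriv _ h1 h2
    simpa [h.initZ] using h3
  let f := LinearEquiv.ofInjectiveEndo (Y t : V →ₗ[ℝ] V) hinj
  exact ⟨ContinuousLinearEquiv.toUnit f.toContinuousLinearEquiv, by ext; rfl⟩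

/-- Solutions of the matrix Riccati equation `U' + U² + R = 0` satisfy a differential inequality
for `f² ⟨U w, w⟩`. -/
theorem riccati_bound (h : IsFundamental R Y Z a b)
    (hsymm : ∀ t ∈ Icc a b, ∀ v w, inner ℝ (R t v) w = inner ℝ v (R t w))
    (hk : ∀ t ∈ Icc a b, ‖R t‖ ≤ k) {s₁ s₂ : ℝ} (h1 : a < s₁) (h12 : s₁ ≤ s₂) (h2 : s₂ < b)
    (hunit : ∀ t ∈ Icc s₁ s₂, IsUnit (Y t)) (w : V) {α β : ℝ}
    (hf : ∀ t ∈ Icc s₁ s₂, (α * t + β) ^ 2 ≤ 1) :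
    (α * s₂ + β) ^ 2 * inner ℝ ((Z s₂ * Ring.inverse (Y s₂)) w) w
      - (α * s₁ + β) ^ 2 * inner ℝ ((Z s₁ * Ring.inverse (Y s₁)) w) w
      ≤ (α ^ 2 + k) * (s₂ - s₁) * ‖w‖ ^ 2 := by
  set U : ℝ → V →L[ℝ] V := fun t => Z t * Ring.inverse (Y t) with hU
  have hmem : ∀ t ∈ Icc s₁ s₂, t ∈ Icc a b := fun t ht => ⟨h1.le.trans ht.1, ht.2.trans h2.le⟩
  have hnhds : ∀ t ∈ Icc s₁ s₂, Icc a b ∈ 𝓝 t := fun t ht =>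
    Icc_mem_nhds (h1.trans_le ht.1) (ht.2.trans_lt h2)
  have hUY : ∀ t ∈ Icc s₁ s₂, U t * Y t = Z t := fun t ht => by
    rw [hU, mul_assoc, Ring.inverse_mul_cancel _ (hunit t ht), mul_one]
  have hUsymm : ∀ t ∈ Icc s₁ s₂, ∀ v w, inner ℝ (U t v) w = inner ℝ v (U t w) := by
    intro t ht v w
    have hYi : ∀ v, Y t (Ring.inverse (Y t) v) = v := fun v =>
      DFunLike.congr_fun (Ring.mul_inverse_cancel _ (hunit t ht)) v
    have := h.wronskian hsymm (hmem t ht) (Ring.inverse (Y t) v) (Ring.inverse (Y t) w)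
    rwa [hYi, hYi] at this
  -- The Riccati equation, from `Z' = -R Y` and the derivative of inversion.
  have hUd : ∀ t ∈ Icc s₁ s₂, HasDerivAt U (-(R t) - U t * U t) t := by
    intro t ht
    obtain ⟨u, hu⟩ := hunit t ht
    have hY := (h.left t (hmem t ht)).hasDerivAt (hnhds t ht)
    have hZ := (h.right t (hmem t ht)).hasDerivAt (hnhds t ht)
    have hinv := hasFDerivAt_ringInverse (𝕜 := ℝ) u
    rw [hu] at hinv
    have hYi := hinv.comp_hasDerivAt t hY
    have := hZ.mul hYi
    refine this.congr_deriv ?_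
    have e1 : Ring.inverse (Y t) = ↑u⁻¹ := by rw [← hu, Ring.inverse_unit]
    have e2 : Y t * (↑u⁻¹ : V →L[ℝ] V) = 1 := by rw [← hu]; simp
    change -(R t * Y t) * Ring.inverse (Y t) + Z t * _ = _
    simp only [hU, e1, neg_mul, mul_assoc, e2, mul_one]
    simp [ContinuousLinearMap.mulLeftRight_apply, mul_assoc, sub_eq_add_neg]
  have hmd : ∀ t ∈ Icc s₁ s₂, HasDerivAt (fun t => inner ℝ (U t w) w)
      (- inner ℝ (R t w) w - ‖U t w‖ ^ 2) t := by
    intro t ht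
    have := ((hUd t ht).clm_apply (hasDerivAt_const t w)).inner ℝ (hasDerivAt_const t w)
    refine this.congr_deriv ?_
    have e1 : inner ℝ ((U t * U t) w) w = ‖U t w‖ ^ 2 := by
      rw [← real_inner_self_eq_norm_sq]
      exact hUsymm t ht (U t w) w
    simp only [inner_zero_right, map_zero, add_zero, zero_add, _root_.sub_apply, _root_.neg_apply,
      inner_sub_left, inner_neg_left, e1]
  have hfd : ∀ t, HasDerivAt (fun t => (α * t + β) ^ 2) (2 * (α * t + β) * α) t := by
    intro t
    have := (((hasDerivAt_id t).const_mul α).add_const β).pow 2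
    refine this.congr_deriv ?_
    simp
  have hg : ∀ t ∈ Icc s₁ s₂, HasDerivAt
      (fun t => (α * t + β) ^ 2 * inner ℝ (U t w) w - (α ^ 2 + k) * ‖w‖ ^ 2 * t)
      (2 * (α * t + β) * α * inner ℝ (U t w) w
        + (α * t + β) ^ 2 * (- inner ℝ (R t w) w - ‖U t w‖ ^ 2) - (α ^ 2 + k) * ‖w‖ ^ 2) t := by
    intro t ht
    have := ((hfd t).mul (hmd t ht)).sub ((hasDerivAt_id t).const_mul ((α ^ 2 + k) * ‖w‖ ^ 2))
    refine this.congr_deriv ?_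
    simp
  have hanti : AntitoneOn (fun t => (α * t + β) ^ 2 * inner ℝ (U t w) w
      - (α ^ 2 + k) * ‖w‖ ^ 2 * t) (Icc s₁ s₂) := by
    have hint : interior (Icc s₁ s₂) ⊆ Icc s₁ s₂ := interior_subset
    refine antitoneOn_of_hasDerivWithinAt_nonpos (convex_Icc _ _)
      (fun t ht => (hg t ht).continuousAt.continuousWithinAt)
      (fun t ht => (hg t (hint ht)).hasDerivWithinAt) fun t ht => ?_
    have ht' := hint ht
    -- With `f = α t + β`, completing the square gives `2 f α ⟨U w, w⟩ - f² |U w|² ≤ α² |w|²`; the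
    -- remaining term `-f² ⟨R w, w⟩` is at most `k |w|²`.
    have c1 : 0 ≤ ‖α • w - (α * t + β) • U t w‖ ^ 2 := sq_nonneg _
    rw [norm_sub_sq_real, norm_smul, norm_smul, real_inner_smul_left, real_inner_smul_right,
      mul_pow, mul_pow, Real.norm_eq_abs, Real.norm_eq_abs, sq_abs, sq_abs, real_inner_comm] at c1
    have c2 : |inner ℝ (R t w) w| ≤ k * ‖w‖ ^ 2 := by
      have e1 := abs_real_inner_le_norm (R t w) w
      have e2 := ((R t).le_opNorm w).trans
        (mul_le_mul_of_nonneg_right (hk t (hmem t ht')) (norm_nonneg w))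
      nlinarith [norm_nonneg w]
    have c3 : (α * t + β) ^ 2 * (- inner ℝ (R t w) w) ≤ k * ‖w‖ ^ 2 := by
      have e1 : (α * t + β) ^ 2 * (- inner ℝ (R t w) w) ≤ (α * t + β) ^ 2 * |inner ℝ (R t w) w| :=
        mul_le_mul_of_nonneg_left (neg_le_abs _) (sq_nonneg _)
      have e2 : (α * t + β) ^ 2 * |inner ℝ (R t w) w| ≤ 1 * |inner ℝ (R t w) w| :=
        mul_le_mul_of_nonneg_right (hf t ht') (abs_nonneg _)
      linarith
    nlinarith
  have := hanti ⟨le_rfl, h12⟩ ⟨h12, le_rfl⟩ h12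
  simp only at this
  simp only [hU] at this ⊢
  linarith

end IsFundamental

/-- A symmetric operator is bounded by its quadratic form: polarize with `v` the multiple of `U w`
of length `|w|`, then use the parallelogram law. -/
theorem norm_apply_le_of_abs_inner_le {U : V →L[ℝ] V} {C : ℝ}
    (hU : ∀ v w, inner ℝ (U v) w = inner ℝ v (U w)) (hC : ∀ w, |inner ℝ (U w) w| ≤ C * ‖w‖ ^ 2)
    (w : V) : ‖U w‖ ≤ C * ‖w‖ := by
  rcases eq_or_ne (U w) 0 with h0 | h0
  · rcases eq_or_ne w 0 with hw | hw
    · simp [hw]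
    · have h1 := (abs_nonneg _).trans (hC w)
      have h2 : 0 < ‖w‖ ^ 2 := by positivity
      have h3 : 0 ≤ C := nonneg_of_mul_nonneg_left h1 h2
      rw [h0, norm_zero]
      positivity
  · have hw : w ≠ 0 := by rintro rfl; simp at h0
    have hn : 0 < ‖U w‖ := norm_pos_iff.2 h0
    have hn' : 0 < ‖w‖ := norm_pos_iff.2 hw
    set v := (‖w‖ / ‖U w‖) • U w with hv
    have hvn : ‖v‖ = ‖w‖ := by
      rw [hv, norm_smul, Real.norm_of_nonneg (by positivity)]
      field_simp
    have hin : inner ℝ (U w) v = ‖w‖ * ‖U w‖ := by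
      rw [hv, real_inner_smul_right, real_inner_self_eq_norm_sq]
      field_simp
    have e1 := hC (w + v)
    have e2 := hC (w - v)
    have e3 : inner ℝ (U (w + v)) (w + v) - inner ℝ (U (w - v)) (w - v)
        = 4 * inner ℝ (U w) v := by
      have := hU v w
      rw [real_inner_comm] at this
      simp only [map_add, map_sub, inner_add_left, inner_add_right, inner_sub_left,
        inner_sub_right]
      have h5 : inner ℝ (U v) w = inner ℝ (U w) v := by rw [hU v w, real_inner_comm]
      rw [h5]; ring
    have e4 : ‖w + v‖ ^ 2 + ‖w - v‖ ^ 2 = 4 * ‖w‖ ^ 2 := by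
      have := parallelogram_law_with_norm ℝ w v
      rw [hvn] at this
      nlinarith
    have e5 := (abs_le.1 e1).2
    have e6 := (abs_le.1 e2).1
    rw [hin] at e3
    have e7 : 4 * (‖w‖ * ‖U w‖) ≤ C * (4 * ‖w‖ ^ 2) := by
      rw [← e4]; linarith
    have e8 : ‖w‖ * ‖U w‖ ≤ ‖w‖ * (C * ‖w‖) := by nlinarith
    exact le_of_mul_le_mul_left e8 hn'

end JacobiODE

/-! ### Quantitative absence of conjugate points -/

section ConjugateBound

variable {V : Type*} [NormedAddCommGroup V] [InnerProductSpace ℝ V] [FiniteDimensional ℝ V]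

/-- Apply `riccati_bound` to `U = Z Y⁻¹` with two linear cutoffs: rising from 0 at `s / 2` to 1 at
`s` bounds `⟨U w, w⟩` at `s` from above, falling from 1 at `s` to 0 at `r` bounds it from below. The
cutoffs remove the unknown values at `s / 2` and `r`, so the constant does not depend on `a`. -/
theorem IsFundamental.norm_le_of_conjFree {k T s r : ℝ} (hs : 0 < s) (hsr : s < r) (hrT : r < T)
    (hk0 : 0 ≤ k)
    {R : ℝ → V →L[ℝ] V}
    (hsymm : ∀ t ∈ Icc 0 T, ∀ v w, inner ℝ (R t v) w = inner ℝ v (R t w))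
    (hk : ∀ t ∈ Icc 0 T, ‖R t‖ ≤ k) (hconj : ConjFree R (Ioo 0 T))
    {a : ℝ} (ha : 0 < a) (has : a < s / 2) {Y Z : ℝ → V →L[ℝ] V} (hF : IsFundamental R Y Z a T)
    (w : V) :
    ‖Z s w‖ ≤ (((2 / s) ^ 2 + k) * (s - s / 2) + ((1 / (r - s)) ^ 2 + k) * (r - s)) *
      ‖Y s w‖ := by
  set C₁ := ((2 / s) ^ 2 + k) * (s - s / 2) + ((1 / (r - s)) ^ 2 + k) * (r - s) with hC₁
  have hsT : s < T := hsr.trans hrT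
  have hrs : 0 < r - s := by linarith
  have hA : 0 ≤ ((2 / s) ^ 2 + k) * (s - s / 2) :=
    mul_nonneg (by positivity) (by linarith)
  have hB : 0 ≤ ((1 / (r - s)) ^ 2 + k) * (r - s) := by positivity
  have hsub : ∀ a, 0 ≤ a → Icc a T ⊆ Icc 0 T := fun a ha => Icc_subset_Icc_left ha
  have hunit : ∀ t, a < t → t < T → IsUnit (Y t) := fun t hat htT =>
    hF.isUnit_of_conjFree hconj ⟨ha, by linarith⟩ ⟨ha.trans hat, htT⟩ hat htT.le
  have hsymm' : ∀ t ∈ Icc a T, ∀ v w, inner ℝ (R t v) w = inner ℝ v (R t w) :=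
    fun t ht => hsymm t (hsub a ha.le ht)
  have hk' : ∀ t ∈ Icc a T, ‖R t‖ ≤ k := fun t ht => hk t (hsub a ha.le ht)
  set U := Z s * Ring.inverse (Y s) with hU
  have hus := hunit s (by linarith) hsT
  have hYi : ∀ v, Y s (Ring.inverse (Y s) v) = v := fun v =>
    DFunLike.congr_fun (Ring.mul_inverse_cancel _ hus) v
  have hUsymm : ∀ v w, inner ℝ (U v) w = inner ℝ v (U w) := by
    intro v w
    have := hF.wronskian hsymm' (t := s) ⟨by linarith, hsT.le⟩
      (Ring.inverse (Y s) v) (Ring.inverse (Y s) w)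
    rwa [hYi, hYi] at this
  have hUb : ∀ w, |inner ℝ (U w) w| ≤ C₁ * ‖w‖ ^ 2 := by
    intro w
    have e1 := hF.riccati_bound hsymm' hk' (s₁ := s / 2) (s₂ := s) has (by linarith) hsT
      (fun t ht => hunit t (by linarith [ht.1]) (by linarith [ht.2])) w (α := 2 / s) (β := -1)
      (fun t ht => by
        have h1 : 2 / s * t - 1 ≤ 1 := by
          have : 2 / s * t ≤ 2 / s * s := mul_le_mul_of_nonneg_left ht.2 (by positivity)
          rw [div_mul_cancel₀ _ hs.ne'] at this
          linarith
        have h2 : 0 ≤ 2 / s * t - 1 := by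
          have : 2 / s * (s / 2) ≤ 2 / s * t := mul_le_mul_of_nonneg_left ht.1 (by positivity)
          rw [show 2 / s * (s / 2) = 1 by field_simp] at this
          linarith
        have : (2 / s * t + -1) = 2 / s * t - 1 := by ring
        rw [this]
        nlinarith)
    have e2 := hF.riccati_bound hsymm' hk' (s₁ := s) (s₂ := r) (by linarith) hsr.le hrT
      (fun t ht => hunit t (by linarith [ht.1]) (by linarith [ht.2])) w
      (α := -(1 / (r - s))) (β := r / (r - s))
      (fun t ht => by
        have h0 : -(1 / (r - s)) * t + r / (r - s) = (r - t) / (r - s) := by field_simp; ring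
        rw [h0]
        have h1 : (r - t) / (r - s) ≤ 1 := by rw [div_le_one hrs]; linarith [ht.1]
        have h2 : 0 ≤ (r - t) / (r - s) := div_nonneg (by linarith [ht.2]) hrs.le
        nlinarith)
    have f1 : 2 / s * s + -1 = 1 := by rw [div_mul_cancel₀ _ hs.ne']; norm_num
    have f2 : 2 / s * (s / 2) + -1 = 0 := by field_simp; norm_num
    have f3 : -(1 / (r - s)) * r + r / (r - s) = 0 := by field_simp; ring
    have f4 : -(1 / (r - s)) * s + r / (r - s) = 1 := by field_simp; ring
    rw [f1, f2] at e1
    rw [f3, f4, neg_sq] at e2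
    have hw2 : 0 ≤ ‖w‖ ^ 2 := sq_nonneg _
    rw [abs_le]
    rw [← hU] at e1 e2
    constructor
    · nlinarith
    · nlinarith
  have h1 : U (Y s w) = Z s w := by
    have : U * Y s = Z s := by rw [hU, mul_assoc, Ring.inverse_mul_cancel _ hus, mul_one]
    exact DFunLike.congr_fun this w
  rw [← h1]
  exact norm_apply_le_of_abs_inner_le hUsymm hUb _

/-- The time 0 is not covered by conjugate-freeness on the open interval. It is approached by
solutions vanishing at small `a > 0`, whose bound is uniform in `a`. -/
theorem SolvesJacobi.norm_le_of_conjFree {k T s C₁ : ℝ} (hs : 0 < s) (hsT : s < T)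
    (hk0 : 0 ≤ k) (hC₁0 : 0 ≤ C₁)
    {R : ℝ → V →L[ℝ] V} (hR : ContinuousOn R (Icc 0 T))
    (hk : ∀ t ∈ Icc 0 T, ‖R t‖ ≤ k)
    (step1 : ∀ a, 0 < a → a < s / 2 → ∀ Y Z, IsFundamental R Y Z a T → ∀ w,
      ‖Z s w‖ ≤ C₁ * ‖Y s w‖)
    {y z : ℝ → V} (hyz : SolvesJacobi R y z (Icc 0 T)) (hy0 : y 0 = 0) :
    ‖z s‖ ≤ C₁ * ‖y s‖ := by
  set Ex := Real.exp ((1 + k) * T) with hEx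
  have hEx0 : 0 < Ex := Real.exp_pos _
  have hsub : ∀ a, 0 ≤ a → Icc a T ⊆ Icc 0 T := fun a ha => Icc_subset_Icc_left ha
  have hev : ∀ᶠ a in 𝓝[>] (0 : ℝ),
      ‖z s‖ ≤ C₁ * (‖y s‖ + Real.sqrt Ex * ‖y a‖) + Real.sqrt Ex * ‖y a‖ := by
    have : Ioo (0 : ℝ) (s / 2) ∈ 𝓝[>] (0 : ℝ) := Ioo_mem_nhdsGT (by linarith)
    filter_upwards [this] with a ha
    have haT : a ≤ T := by linarith [ha.2]
    obtain ⟨Y, Z, hF⟩ := exists_isFundamental haT (hR.mono (hsub a ha.1.le))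
    have h1 := step1 a ha.1 ha.2 Y Z hF (z a)
    have has : a ≤ s := by linarith [ha.2]
    -- The solution `Y (z a)` has data `(0, z a)` at `a`, against `(y a, z a)` for `(y, z)`; by the
    -- energy estimate they differ at `s` by at most a constant times `‖y a‖`, which tends to 0.
    have h2 := (((hF.solves (z a)).sub (hyz.mono (hsub a ha.1.le))).mono
      (Icc_subset_Icc_right hsT.le : Icc a s ⊆ Icc a T)).energy has
      (fun t ht => hk t ⟨ha.1.le.trans ht.1, ht.2.trans hsT.le⟩)
    have h3 := h2.1
    simp only [hF.initY, hF.initZ, one_apply_eq_self, sub_self, norm_zero,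
      _root_.zero_apply, zero_sub, norm_neg] at h3
    have h4 : Real.exp ((1 + k) * (s - a)) ≤ Ex := by
      apply Real.exp_le_exp.2
      apply mul_le_mul_of_nonneg_left _ (by linarith)
      linarith [ha.1]
    have h5 : ‖Y s (z a) - y s‖ ^ 2 + ‖Z s (z a) - z s‖ ^ 2 ≤ (Real.sqrt Ex * ‖y a‖) ^ 2 := by
      rw [mul_pow, Real.sq_sqrt hEx0.le]
      refine h3.trans ?_
      simp only [ne_eq, OfNat.ofNat_ne_zero, not_false_eq_true, zero_pow, add_zero]
      exact mul_le_mul_of_nonneg_right h4 (sq_nonneg _)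
    have h0 : 0 ≤ Real.sqrt Ex * ‖y a‖ := by positivity
    have h6 : ‖Y s (z a) - y s‖ ≤ Real.sqrt Ex * ‖y a‖ :=
      abs_le_of_sq_le_sq' (by nlinarith [sq_nonneg ‖Z s (z a) - z s‖]) h0 |>.2
    have h7 : ‖Z s (z a) - z s‖ ≤ Real.sqrt Ex * ‖y a‖ :=
      abs_le_of_sq_le_sq' (by nlinarith [sq_nonneg ‖Y s (z a) - y s‖]) h0 |>.2
    have h8 : ‖z s‖ ≤ ‖Z s (z a)‖ + ‖Z s (z a) - z s‖ := by
      have := norm_sub_norm_le (z s) (Z s (z a))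
      rw [norm_sub_rev] at this
      linarith
    have h9 : ‖Y s (z a)‖ ≤ ‖y s‖ + ‖Y s (z a) - y s‖ := by
      have := norm_sub_norm_le (Y s (z a)) (y s)
      linarith
    have h10 := mul_le_mul_of_nonneg_left (h9.trans (add_le_add_right h6 _)) hC₁0
    linarith
  have hycont : Tendsto (fun a => ‖y a‖) (𝓝[>] 0) (𝓝 0) := by
    have h1 := (hyz.left 0 ⟨le_rfl, by linarith⟩).continuousWithinAt
    have h2 : Tendsto y (𝓝[>] 0) (𝓝 (y 0)) := by
      refine h1.mono_left ?_
      rw [← nhdsWithin_Ioo_eq_nhdsGT (show (0 : ℝ) < T by linarith)]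
      exact nhdsWithin_mono _ Ioo_subset_Icc_self
    rw [hy0] at h2
    simpa using h2.norm
  have hlim : Tendsto (fun a => C₁ * (‖y s‖ + Real.sqrt Ex * ‖y a‖) + Real.sqrt Ex * ‖y a‖)
      (𝓝[>] 0) (𝓝 (C₁ * (‖y s‖ + Real.sqrt Ex * 0) + Real.sqrt Ex * 0)) :=
    ((((hycont.const_mul _).const_add _).const_mul _).add (hycont.const_mul _))
  simpa using ge_of_tendsto hlim hev

/-- In the absence of conjugate points, a solution of `y'' + R y = 0` with `y 0 = 0` is controlled
by its value at a later time, uniformly in `R`. -/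
theorem exists_conjFree_bound {k T s : ℝ} (hs : 0 < s) (hsT : s < T) (hk0 : 0 ≤ k) :
    ∃ C ≥ 0, ∀ R : ℝ → V →L[ℝ] V, ContinuousOn R (Icc 0 T) →
      (∀ t ∈ Icc 0 T, ∀ v w, inner ℝ (R t v) w = inner ℝ v (R t w)) →
      (∀ t ∈ Icc 0 T, ‖R t‖ ≤ k) → ConjFree R (Ioo 0 T) →
      ∀ y z : ℝ → V, SolvesJacobi R y z (Icc 0 T) → y 0 = 0 → ‖z 0‖ ≤ C * ‖y s‖ := by
  set r := (s + T) / 2 with hr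
  have hsr : s < r := by rw [hr]; linarith
  have hrT : r < T := by rw [hr]; linarith
  set C₁ := ((2 / s) ^ 2 + k) * (s - s / 2) + ((1 / (r - s)) ^ 2 + k) * (r - s) with hC₁
  have hrs : 0 < r - s := by linarith
  have hA : 0 ≤ ((2 / s) ^ 2 + k) * (s - s / 2) :=
    mul_nonneg (by positivity) (by linarith)
  have hB : 0 ≤ ((1 / (r - s)) ^ 2 + k) * (r - s) := by positivity
  have hC₁0 : 0 ≤ C₁ := add_nonneg hA hB
  set Ex := Real.exp ((1 + k) * T) with hEx
  have hEx0 : 0 < Ex := Real.exp_pos _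
  -- Combine `‖z s‖ ≤ C₁ ‖y s‖` with the backward energy estimate from `s` to 0.
  refine ⟨Real.sqrt (Ex * (1 + C₁ ^ 2)), Real.sqrt_nonneg _, ?_⟩
  intro R hR hsymm hk hconj y z hyz hy0
  have step2 : ‖z s‖ ≤ C₁ * ‖y s‖ :=
    hyz.norm_le_of_conjFree hs hsT hk0 hC₁0 hR hk (fun a ha has Y Z hF w =>
      hF.norm_le_of_conjFree hs hsr hrT hk0 hsymm hk hconj ha has w) hy0
  have h1 := (hyz.mono (Icc_subset_Icc_right hsT.le : Icc 0 s ⊆ Icc 0 T)).energy hs.le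
    (fun t ht => hk t ⟨ht.1, ht.2.trans hsT.le⟩)
  have h2 := h1.2
  rw [hy0] at h2
  have h4 : Real.exp ((1 + k) * (s - 0)) ≤ Ex := by
    apply Real.exp_le_exp.2
    apply mul_le_mul_of_nonneg_left _ (by linarith)
    linarith
  have h5 : ‖z s‖ ^ 2 ≤ C₁ ^ 2 * ‖y s‖ ^ 2 := by
    rw [← mul_pow]
    exact pow_le_pow_left₀ (norm_nonneg _) step2 2
  have h6 : ‖z 0‖ ^ 2 ≤ (Real.sqrt (Ex * (1 + C₁ ^ 2)) * ‖y s‖) ^ 2 := by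
    rw [mul_pow, Real.sq_sqrt (by positivity)]
    have h7 : Real.exp ((1 + k) * (s - 0)) * (‖y s‖ ^ 2 + ‖z s‖ ^ 2)
        ≤ Ex * (‖y s‖ ^ 2 + C₁ ^ 2 * ‖y s‖ ^ 2) :=
      mul_le_mul h4 (by linarith) (by positivity) hEx0.le
    simp only [norm_zero] at h2
    nlinarith
  exact abs_le_of_sq_le_sq' h6 (by positivity) |>.2

end ConjugateBound

/-! ### Limits and difference quotients of solutions of autonomous equations -/

section Limits

variable {E : Type*} [NormedAddCommGroup E] [NormedSpace ℝ E]

/-- Solutions of an autonomous Lipschitz equation in a closed set whose initial values converge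
converge to a solution. -/
theorem exists_tendsto_ode [CompleteSpace E] {F : E → E} {K : Set E} {C : NNReal} {B : ℝ}
    (hF : LipschitzOnWith C F K) (hB : ∀ x ∈ K, ‖F x‖ ≤ B) (hK : IsClosed K) {s t : ℝ}
    {X : ℕ → ℝ → E}
    (hX : ∀ᶠ n in atTop, ∀ τ ∈ Icc s t, X n τ ∈ K ∧
      HasDerivWithinAt (X n) (F (X n τ)) (Icc s t) τ)
    {x₀ : E} (h0 : Tendsto (fun n => X n s) atTop (𝓝 x₀)) :
    ∃ Y : ℝ → E, ∀ τ ∈ Icc s t, Tendsto (fun n => X n τ) atTop (𝓝 (Y τ)) ∧ Y τ ∈ K ∧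
      HasDerivWithinAt Y (F (Y τ)) (Icc s t) τ := by
  obtain ⟨N, hN⟩ := eventually_atTop.1 hX
  have hgron : ∀ n ≥ N, ∀ m ≥ N, ∀ τ ∈ Icc s t,
      dist (X n τ) (X m τ) ≤ dist (X n s) (X m s) * Real.exp (C * (τ - s)) := by
    intro n hn m hm
    refine dist_le_of_trajectories_ODE_of_mem (v := fun _ => F) (s := fun _ => K)
      (fun _ _ => hF) (fun τ hτ => (hN n hn τ hτ).2.continuousWithinAt)
      (fun τ hτ => (hN n hn τ ⟨hτ.1, hτ.2.le⟩).2.Ici_of_Icc hτ)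
      (fun τ hτ => (hN n hn τ ⟨hτ.1, hτ.2.le⟩).1)
      (fun τ hτ => (hN m hm τ hτ).2.continuousWithinAt)
      (fun τ hτ => (hN m hm τ ⟨hτ.1, hτ.2.le⟩).2.Ici_of_Icc hτ)
      (fun τ hτ => (hN m hm τ ⟨hτ.1, hτ.2.le⟩).1) le_rfl
  have hlim : ∀ τ ∈ Icc s t, ∃ y, Tendsto (fun n => X n τ) atTop (𝓝 y) := by
    intro τ hτ
    apply cauchySeq_tendsto_of_complete
    rw [Metric.cauchySeq_iff]
    intro ε hε
    have hexp := Real.exp_pos (C * (τ - s))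
    obtain ⟨N', hN'⟩ := Metric.cauchySeq_iff.1 h0.cauchySeq (ε / Real.exp (C * (τ - s)))
      (by positivity)
    refine ⟨max N N', fun m hm n hn => ?_⟩
    refine (hgron m ((le_max_left _ _).trans hm) n ((le_max_left _ _).trans hn) τ hτ).trans_lt ?_
    have := hN' m ((le_max_right _ _).trans hm) n ((le_max_right _ _).trans hn)
    rwa [lt_div_iff₀ hexp] at this
  choose! Y hY using hlim
  have hYK : ∀ τ ∈ Icc s t, Y τ ∈ K := fun τ hτ =>
    hK.mem_of_tendsto (hY τ hτ) (hX.mono fun n hn => (hn τ hτ).1)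
  refine ⟨Y, fun τ hτ => ⟨hY τ hτ, hYK τ hτ, ?_⟩⟩
  have hB0 : 0 ≤ B := (norm_nonneg _).trans (hB _ (hYK τ hτ))
  -- The first-order Taylor remainder of `X n` is quadratic with a constant independent of `n`, so
  -- the estimate survives the pointwise limit and yields differentiability.
  have hquad : ∀ σ ∈ Icc s t, ‖Y σ - Y τ - (σ - τ) • F (Y τ)‖ ≤ C * B * |σ - τ| ^ 2 := by
    intro σ hσ
    have hFlim : Tendsto (fun n => F (X n τ)) atTop (𝓝 (F (Y τ))) := by
      have h1 : Tendsto (fun n => X n τ) atTop (𝓝[K] (Y τ)) :=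
        tendsto_nhdsWithin_iff.2 ⟨hY τ hτ, hX.mono fun n hn => (hn τ hτ).1⟩
      exact (hF.continuousOn (Y τ) (hYK τ hτ)).tendsto.comp h1
    refine le_of_tendsto (((hY σ hσ).sub (hY τ hτ)).sub (hFlim.const_smul (σ - τ))).norm ?_
    filter_upwards [hX] with n hn
    have hsub : uIcc τ σ ⊆ Icc s t := uIcc_subset_Icc hτ hσ
    have hlip : ∀ ρ ∈ uIcc τ σ, ‖X n ρ - X n τ‖ ≤ B * ‖ρ - τ‖ := fun ρ hρ =>
      Convex.norm_image_sub_le_of_norm_hasDerivWithin_le (fun r hr => (hn r hr).2)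
        (fun r hr => hB _ (hn r hr).1) (convex_Icc s t) hτ (hsub hρ)
    have h1 := Convex.norm_image_sub_le_of_norm_hasDerivWithin_le
      (f := fun ρ => X n ρ - ρ • F (X n τ)) (f' := fun ρ => F (X n ρ) - F (X n τ))
      (s := uIcc τ σ) (C := C * (B * |σ - τ|)) (x := τ) (y := σ)
      (fun ρ hρ => by
        have := (hasDerivWithinAt_id ρ (uIcc τ σ)).smul_const (F (X n τ))
        rw [one_smul] at this
        exact ((hn ρ (hsub hρ)).2.mono hsub).sub this)
      (fun ρ hρ => by
        have e1 := hF.dist_le_mul _ (hn ρ (hsub hρ)).1 _ (hn τ hτ).1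
        rw [dist_eq_norm, dist_eq_norm] at e1
        refine e1.trans (mul_le_mul_of_nonneg_left ((hlip ρ hρ).trans ?_) C.2)
        refine mul_le_mul_of_nonneg_left ?_ hB0
        rw [Real.norm_eq_abs, abs_sub_comm ρ, abs_sub_comm σ]
        exact abs_sub_left_of_mem_uIcc hρ |> fun h => by simpa [abs_sub_comm] using h)
      (convex_uIcc _ _) left_mem_uIcc right_mem_uIcc
    have e2 : X n σ - σ • F (X n τ) - (X n τ - τ • F (X n τ))
        = X n σ - X n τ - (σ - τ) • F (X n τ) := by rw [sub_smul]; abel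
    simp only [e2, Real.norm_eq_abs] at h1
    calc _ ≤ _ := h1
      _ = _ := by ring
  rw [hasDerivWithinAt_iff_isLittleO]
  have hO : (fun σ => Y σ - Y τ - (σ - τ) • F (Y τ)) =O[𝓝[Icc s t] τ]
      fun σ => ‖σ - τ‖ ^ 2 := by
    refine Asymptotics.IsBigO.of_bound (C * B) ?_
    filter_upwards [self_mem_nhdsWithin] with σ hσ
    simpa using hquad σ hσ
  refine hO.trans_isLittleO ?_
  have h2 : (fun σ : ℝ => ‖σ - τ‖ ^ 2) =o[𝓝 τ] fun σ => σ - τ :=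
    Asymptotics.isLittleO_pow_sub_sub τ one_lt_two
  exact h2.mono nhdsWithin_le_nhds

/-- Difference quotients of solutions of an autonomous equation converge to a solution of the
linearized equation if their initial values do. -/
theorem tendsto_ode_quotient {F : E → E} {DF : E → E →L[ℝ] E} {K : Set E} {C C₂ : NNReal}
    (hK : Convex ℝ K) (hF : ∀ x ∈ K, HasFDerivWithinAt F (DF x) K x)
    (hC : ∀ x ∈ K, ‖DF x‖ ≤ C) (hC₂ : LipschitzOnWith C₂ DF K) {s t : ℝ}
    {X : ℕ → ℝ → E} {Y ζ : ℝ → E}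
    (hX : ∀ᶠ n in atTop, ∀ τ ∈ Icc s t, X n τ ∈ K ∧
      HasDerivWithinAt (X n) (F (X n τ)) (Icc s t) τ)
    (hY : ∀ τ ∈ Icc s t, Y τ ∈ K ∧ HasDerivWithinAt Y (F (Y τ)) (Icc s t) τ)
    (hζ : ∀ τ ∈ Icc s t, HasDerivWithinAt ζ (DF (Y τ) (ζ τ)) (Icc s t) τ)
    {δ : ℕ → ℝ} (hδ : ∀ n, 0 < δ n) (hδ0 : Tendsto δ atTop (𝓝 0))
    (h0 : Tendsto (fun n => (δ n)⁻¹ • (X n s - Y s)) atTop (𝓝 (ζ s))) :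
    ∀ τ ∈ Icc s t, Tendsto (fun n => (δ n)⁻¹ • (X n τ - Y τ)) atTop (𝓝 (ζ τ)) := by
  intro τ hτ
  have hst : s ≤ t := hτ.1.trans hτ.2
  have hFlip : LipschitzOnWith C F K := hK.lipschitzOnWith_of_nnnorm_hasFDerivWithin_le hF
    (fun x hx => by exact_mod_cast hC x hx)
  set z : ℕ → ℝ → E := fun n σ => (δ n)⁻¹ • (X n σ - Y σ) with hz
  set Ex := Real.exp (C * (t - s)) with hEx
  -- Adding 1 keeps the constant nonzero, so that the explicit formula for `gronwallBound` applies.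
  set κ : NNReal := C + 1 with hκ
  have hdiff : ∀ n, ‖X n s - Y s‖ = δ n * ‖z n s‖ := by
    intro n
    rw [hz]
    simp only [norm_smul, norm_inv, Real.norm_of_nonneg (hδ n).le]
    rw [mul_inv_cancel_left₀ (hδ n).ne']
  -- The defect of the quotient `z n` in the linearized equation: at most `C₂ ‖X n - Y‖ ‖z n‖`, of
  -- order `δ n`.
  set ε : ℕ → ℝ := fun n => C₂ * (δ n * ‖z n s‖ * Ex) * (‖z n s‖ * Ex) with hε
  have hmain : ∀ᶠ n in atTop,
      dist (z n τ) (ζ τ) ≤ gronwallBound (dist (z n s) (ζ s)) κ (ε n) (τ - s) := by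
    filter_upwards [hX] with n hn
    have hgron : ∀ σ ∈ Icc s t, ‖X n σ - Y σ‖ ≤ δ n * ‖z n s‖ * Ex := by
      intro σ hσ
      have h1 := dist_le_of_trajectories_ODE_of_mem (v := fun _ => F) (s := fun _ => K)
        (fun _ _ => hFlip) (fun r hr => (hn r hr).2.continuousWithinAt)
        (fun r hr => (hn r ⟨hr.1, hr.2.le⟩).2.Ici_of_Icc hr)
        (fun r hr => (hn r ⟨hr.1, hr.2.le⟩).1)
        (fun r hr => (hY r hr).2.continuousWithinAt)
        (fun r hr => (hY r ⟨hr.1, hr.2.le⟩).2.Ici_of_Icc hr)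
        (fun r hr => (hY r ⟨hr.1, hr.2.le⟩).1) le_rfl σ hσ
      rw [dist_eq_norm, dist_eq_norm, hdiff] at h1
      refine h1.trans (mul_le_mul_of_nonneg_left ?_ (by have := (hδ n).le; positivity))
      apply Real.exp_le_exp.2
      exact mul_le_mul_of_nonneg_left (by linarith [hσ.2]) C.2
    have hzb : ∀ σ ∈ Icc s t, ‖z n σ‖ ≤ ‖z n s‖ * Ex := by
      intro σ hσ
      have h1 := hgron σ hσ
      simp only [hz, norm_smul, norm_inv, Real.norm_of_nonneg (hδ n).le] at h1 ⊢
      rw [inv_mul_le_iff₀ (hδ n)]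
      linarith
    have hzd : ∀ σ ∈ Icc s t,
        HasDerivWithinAt (z n) ((δ n)⁻¹ • (F (X n σ) - F (Y σ))) (Icc s t) σ := fun σ hσ =>
      ((hn σ hσ).2.sub (hY σ hσ).2).const_smul _
    have herr : ∀ σ ∈ Icc s t,
        dist ((δ n)⁻¹ • (F (X n σ) - F (Y σ))) (DF (Y σ) (z n σ)) ≤ ε n := by
      intro σ hσ
      have hseg : segment ℝ (Y σ) (X n σ) ⊆ K := hK.segment_subset (hY σ hσ).1 (hn σ hσ).1
      have h1 := Convex.norm_image_sub_le_of_norm_hasFDerivWithin_le' (f := F) (f' := DF)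
        (φ := DF (Y σ)) (s := segment ℝ (Y σ) (X n σ)) (C := C₂ * ‖X n σ - Y σ‖)
        (fun x hx => (hF x (hseg hx)).mono hseg)
        (fun x hx => by
          have e1 := hC₂.dist_le_mul _ (hseg hx) _ (hY σ hσ).1
          rw [dist_eq_norm, dist_eq_norm] at e1
          refine e1.trans (mul_le_mul_of_nonneg_left ?_ C₂.2)
          exact norm_sub_le_of_mem_segment hx)
        (convex_segment _ _) (left_mem_segment _ _ _) (right_mem_segment _ _ _)
      have e2 : (δ n)⁻¹ • (F (X n σ) - F (Y σ)) - DF (Y σ) (z n σ)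
          = (δ n)⁻¹ • (F (X n σ) - F (Y σ) - DF (Y σ) (X n σ - Y σ)) := by
        have e4 : DF (Y σ) (z n σ) = (δ n)⁻¹ • DF (Y σ) (X n σ - Y σ) := (DF (Y σ)).map_smul _ _
        rw [e4, smul_sub (δ n)⁻¹ (F (X n σ) - F (Y σ))]
      rw [dist_eq_norm, e2, norm_smul, norm_inv, Real.norm_of_nonneg (hδ n).le]
      have e3 : (δ n)⁻¹ * ‖X n σ - Y σ‖ = ‖z n σ‖ := by
        simp only [hz, norm_smul, norm_inv, Real.norm_of_nonneg (hδ n).le]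
      calc (δ n)⁻¹ * ‖F (X n σ) - F (Y σ) - DF (Y σ) (X n σ - Y σ)‖
          ≤ (δ n)⁻¹ * (C₂ * ‖X n σ - Y σ‖ * ‖X n σ - Y σ‖) :=
            mul_le_mul_of_nonneg_left h1 (inv_nonneg.2 (hδ n).le)
        _ = C₂ * ‖X n σ - Y σ‖ * ((δ n)⁻¹ * ‖X n σ - Y σ‖) := by ring
        _ ≤ ε n := by
            rw [e3, hε]
            exact mul_le_mul (mul_le_mul_of_nonneg_left (hgron σ hσ) C₂.2) (hzb σ hσ)
              (norm_nonneg _) (by have := (hδ n).le; positivity)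
    have := dist_le_of_approx_trajectories_ODE_of_mem (v := fun σ x => DF (Y σ) x)
      (s := fun _ => univ) (K := κ) (εf := ε n) (εg := 0) (a := s) (b := t)
      (fun σ hσ => ((DF (Y σ)).lipschitz.weaken (by
        have := hC _ (hY σ ⟨hσ.1, hσ.2.le⟩).1
        have h2 : ‖DF (Y σ)‖₊ ≤ C := by exact_mod_cast this
        exact h2.trans (le_add_of_nonneg_right zero_le_one))).lipschitzOnWith)
      (fun σ hσ => (hzd σ hσ).continuousWithinAt)
      (fun σ hσ => (hzd σ ⟨hσ.1, hσ.2.le⟩).Ici_of_Icc hσ)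
      (fun σ hσ => herr σ ⟨hσ.1, hσ.2.le⟩) (fun _ _ => mem_univ _)
      (fun σ hσ => (hζ σ hσ).continuousWithinAt)
      (fun σ hσ => (hζ σ ⟨hσ.1, hσ.2.le⟩).Ici_of_Icc hσ)
      (fun σ hσ => (dist_self _).le) (fun _ _ => mem_univ _) le_rfl τ hτ
    rwa [add_zero] at this
  rw [tendsto_iff_dist_tendsto_zero]
  refine squeeze_zero' (Eventually.of_forall fun _ => dist_nonneg) hmain ?_
  have hκ0 : (κ : ℝ) ≠ 0 := by
    rw [hκ]; push_cast
    have : (0 : ℝ) ≤ C := C.2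
    positivity
  have d1 : Tendsto (fun n => dist (z n s) (ζ s)) atTop (𝓝 0) :=
    tendsto_iff_dist_tendsto_zero.1 h0
  have d2 : Tendsto (fun n => ‖z n s‖) atTop (𝓝 ‖ζ s‖) := h0.norm
  have d3 : Tendsto ε atTop (𝓝 0) := by
    have := ((((hδ0.mul d2).mul_const Ex).const_mul (C₂ : ℝ)).mul (d2.mul_const Ex))
    simpa using this
  simp only [gronwallBound_of_K_ne_0 hκ0]
  have := (d1.mul_const (Real.exp (κ * (τ - s)))).add
    ((d3.div_const (κ : ℝ)).mul_const (Real.exp (κ * (τ - s)) - 1))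
  simpa using this

/-- A smooth map on a neighbourhood of a compact convex set satisfies the hypotheses of the
convergence theorems on that set. -/
theorem exists_bounds_of_contDiffOn {F : E → E} {U K : Set E} (hU : IsOpen U)
    (hF : ContDiffOn ℝ ∞ F U) (hK : IsCompact K) (hKc : Convex ℝ K) (hKU : K ⊆ U) :
    ∃ (C C₂ : NNReal) (B : ℝ), LipschitzOnWith C F K ∧ (∀ x ∈ K, ‖F x‖ ≤ B) ∧
      (∀ x ∈ K, HasFDerivWithinAt F (fderiv ℝ F x) K x) ∧ (∀ x ∈ K, ‖fderiv ℝ F x‖ ≤ C) ∧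
      LipschitzOnWith C₂ (fderiv ℝ F) K := by
  have key : ∀ {W : Type _} [NormedAddCommGroup W] [NormedSpace ℝ W] (f : E → W),
      ContDiffOn ℝ ∞ f U → ∃ C : NNReal, (∀ x ∈ K, HasFDerivWithinAt f (fderiv ℝ f x) K x) ∧
        (∀ x ∈ K, ‖fderiv ℝ f x‖ ≤ C) ∧ LipschitzOnWith C f K := by
    intro W _ _ f hf
    have h1 : ContinuousOn (fderiv ℝ f) K :=
      (hf.continuousOn_fderiv_of_isOpen hU (by simp)).mono hKU
    obtain ⟨C, hC⟩ := hK.exists_bound_of_continuousOn h1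
    have hd : ∀ x ∈ K, HasFDerivWithinAt f (fderiv ℝ f x) K x := fun x hx =>
      ((hf.contDiffAt (hU.mem_nhds (hKU hx))).differentiableAt
        (by simp)).hasFDerivAt.hasFDerivWithinAt
    have hC' : ∀ x ∈ K, ‖fderiv ℝ f x‖ ≤ C.toNNReal := fun x hx =>
      (hC x hx).trans (Real.le_coe_toNNReal C)
    exact ⟨C.toNNReal, hd, hC', hKc.lipschitzOnWith_of_nnnorm_hasFDerivWithin_le hd
      (fun x hx => by exact_mod_cast hC' x hx)⟩
  obtain ⟨C, h1, h2, h3⟩ := key F hF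
  obtain ⟨C₂, _, _, h4⟩ := key (fderiv ℝ F) (hF.fderiv_of_isOpen hU (by simp))
  obtain ⟨B, hB⟩ := hK.exists_bound_of_continuousOn (hF.continuousOn.mono hKU)
  exact ⟨C, C₂, B, h3, hB, h1, h2, h4⟩

end Limits

/-! ### Calculus of vector fields along curves and parallel transport -/

section FieldCalculus

theorem IsMetricOn.hasDerivWithinAt_metric {E : Type*} [NormedAddCommGroup E] [NormedSpace ℝ E]
    [FiniteDimensional ℝ E]
    {G : E → E →L[ℝ] E →L[ℝ] ℝ} {O : Set E} (h : IsMetricOn G O) {S : Set ℝ} {t : ℝ}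
    {x V V' : ℝ → E} {u W W' : E} (hx : x t ∈ O) (hu : HasDerivWithinAt x u S t)
    (hV : HasDerivWithinAt V (W - chr G (x t) u (V t)) S t)
    (hV' : HasDerivWithinAt V' (W' - chr G (x t) u (V' t)) S t) :
    HasDerivWithinAt (fun s => G (x s) (V s) (V' s)) (G (x t) W (V' t) + G (x t) (V t) W') S t := by
  have h1 := (((h.differentiableAt hx).hasFDerivAt.comp_hasDerivWithinAt t hu).clm_apply
    hV).clm_apply hV'
  refine h1.congr_deriv ?_
  simp only [Function.comp, _root_.add_apply, h.fderiv_eq hx, map_sub, _root_.sub_apply]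
  abel

variable {d : ℕ} {M : Type*} [TopologicalSpace M] [ChartedSpace (Coord d) M]

section Basic

variable {c : ℝ → M} {S S' : Set ℝ} {t : ℝ} {U : TangentSpace (𝓡 d) (c t)}

theorem HasVelocityWithinAt.mono (h : HasVelocityWithinAt c S t U) (hS : S' ⊆ S) :
    HasVelocityWithinAt c S' t U :=
  ⟨h.continuousWithinAt.mono hS, fun e he ht => (h.deriv e he ht).mono hS⟩

/-- Velocity of a reparametrized curve. -/
theorem HasVelocityWithinAt.comp_affine {α β : ℝ} {U : (t : ℝ) → TangentSpace (𝓡 d) (c t)}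
    (h : HasVelocityWithinAt c S (α * t + β) (U (α * t + β)))
    (hS : MapsTo (fun t => α * t + β) S' S) :
    HasVelocityWithinAt (fun t => c (α * t + β)) S' t (α • U (α * t + β)) := by
  have hd : HasDerivWithinAt (fun t => α * t + β) α S' t := by
    simpa using (((hasDerivAt_id t).const_mul α).add_const β).hasDerivWithinAt
  refine ⟨ContinuousWithinAt.comp (t := S) h.continuousWithinAt hd.continuousWithinAt hS,
    fun e he ht => ?_⟩
  have := (h.deriv e he ht).scomp t hd hS
  rw [map_smul]
  exact this

variable [RiemannianBundle (fun x : M => TangentSpace (𝓡 d) x)]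

variable {V V' : (t : ℝ) → TangentSpace (𝓡 d) (c t)} {W W' : TangentSpace (𝓡 d) (c t)}

theorem HasCovDerivWithinAt.mono (h : HasCovDerivWithinAt c V S t U W) (hS : S' ⊆ S) :
    HasCovDerivWithinAt c V S' t U W :=
  fun e he ht => (h e he ht).mono hS

theorem HasCovDerivWithinAt.mono_of_mem_nhdsWithin (h : HasCovDerivWithinAt c V S t U W)
    (hS : S ∈ 𝓝[S'] t) : HasCovDerivWithinAt c V S' t U W :=
  fun e he ht => (h e he ht).mono_of_mem_nhdsWithin hS

theorem HasCovDerivWithinAt.union (h : HasCovDerivWithinAt c V S t U W)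
    (h' : HasCovDerivWithinAt c V S' t U W) : HasCovDerivWithinAt c V (S ∪ S') t U W :=
  fun e he ht => (h e he ht).union (h' e he ht)

theorem HasCovDerivWithinAt.congr (h : HasCovDerivWithinAt c V S t U W)
    (hV : ∀ s ∈ S, V' s = V s) (ht : t ∈ S) : HasCovDerivWithinAt c V' S t U W := by
  intro e he hs
  rw [hV t ht]
  exact (h e he hs).congr (fun s hs => by rw [fieldCoord_eq_chartD, fieldCoord_eq_chartD, hV s hs])
    (by rw [fieldCoord_eq_chartD, fieldCoord_eq_chartD, hV t ht])

theorem HasCovDerivWithinAt.comp_affine {α β : ℝ} {U W : (t : ℝ) → TangentSpace (𝓡 d) (c t)}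
    (h : HasCovDerivWithinAt c V S (α * t + β) (U (α * t + β)) (W (α * t + β)))
    (hS : MapsTo (fun t => α * t + β) S' S) :
    HasCovDerivWithinAt (fun t => c (α * t + β)) (fun t => V (α * t + β)) S' t
      (α • U (α * t + β)) (α • W (α * t + β)) := by
  have hd : HasDerivWithinAt (fun t => α * t + β) α S' t := by
    simpa using (((hasDerivAt_id t).const_mul α).add_const β).hasDerivWithinAt
  intro e he ht
  have := (h e he ht).scomp t hd hS
  simp only [map_smul, _root_.smul_apply, ← smul_sub]
  exact this

theorem HasCovDerivWithinAt.const_smul (h : HasCovDerivWithinAt c V S t U W) (r : ℝ) :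
    HasCovDerivWithinAt c (fun t => r • V t) S t U (r • W) := by
  intro e he ht
  have := (h e he ht).const_smul r
  simp only [map_smul, ← smul_sub]
  refine this.congr (fun s _ => ?_) ?_ <;> exact (chartD e _).map_smul _ _

/-- The linear combination of the vectors `V i` with coefficients `y i`. -/
def comb {x : M} (V : Fin d → TangentSpace (𝓡 d) x) (y : Coord d) : TangentSpace (𝓡 d) x :=
  ∑ i, y i • V i

/-- In a parallel frame the covariant derivative acts on coefficients; this turns the Jacobi
equation into `y'' + R y = 0`. -/
theorem hasCovDerivWithinAt_comb {V : Fin d → (t : ℝ) → TangentSpace (𝓡 d) (c t)}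
    (hV : ∀ i, HasCovDerivWithinAt c (V i) S t U 0) {y : ℝ → Coord d} {y' : Coord d}
    (hy : HasDerivWithinAt y y' S t) :
    HasCovDerivWithinAt c (fun t => comb (fun i => V i t) (y t)) S t U
      (comb (fun i => V i t) y') := by
  intro e he ht
  have hyi : ∀ i, HasDerivWithinAt (fun s => y s i) (y' i) S t := fun i => by
    exact (EuclideanSpace.proj (𝕜 := ℝ) i).hasFDerivAt.comp_hasDerivWithinAt t hy
  have h1 : HasDerivWithinAt (fun s => ∑ i, y s i • fieldCoord e c (V i) s) _ S t :=
    HasDerivWithinAt.fun_sum fun i (_ : i ∈ Finset.univ) => (hyi i).smul (hV i e he ht)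
  have h2 : fieldCoord e c (fun t => comb (fun i => V i t) (y t))
      = fun s => ∑ i, y s i • fieldCoord e c (V i) s := by
    ext1 s
    simp only [fieldCoord_eq_chartD, comb, map_sum, map_smul]
  rw [h2]
  refine h1.congr_deriv ?_
  simp only [comb, map_sum, map_smul, map_zero, zero_sub, fieldCoord_eq_chartD, smul_neg,
    Finset.sum_add_distrib, Finset.sum_neg_distrib]
  abel

variable [IsManifold (𝓡 d) ∞ M]
  [IsContMDiffRiemannianBundle (𝓡 d) ∞ (Coord d) (fun x : M => TangentSpace (𝓡 d) x)]

theorem HasVelocityWithinAt.hasDerivWithinAt_inner (hc : HasVelocityWithinAt c S t U)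
    (hV : HasCovDerivWithinAt c V S t U W) (hV' : HasCovDerivWithinAt c V' S t U W') :
    HasDerivWithinAt (fun s => inner ℝ (V s) (V' s)) (inner ℝ W (V' t) + inner ℝ (V t) W') S t := by
  set e := chartAt (Coord d) (c t) with he'
  have he : e ∈ atlas (Coord d) M := chart_mem_atlas _ _
  have ht : c t ∈ e.source := mem_chart_source _ _
  have hG := isMetricOn_metricCoord he
  have hy : e (c t) ∈ e.target := e.map_source ht
  have h2 := (hG.hasDerivWithinAt_metric (x := fun s => e (c s)) hy (hc.deriv e he ht) (hV e he ht)
    (hV' e he ht)).congr_deriv (g' := inner ℝ W (V' t) + inner ℝ (V t) W') (by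
      rw [← metricCoord_chartD he ht, ← metricCoord_chartD he ht]; rfl)
  refine h2.congr_of_eventuallyEq ?_ (metricCoord_chartD he ht _ _).symm
  filter_upwards [hc.continuousWithinAt.preimage_mem_nhdsWithin (e.open_source.mem_nhds ht)]
    with s hs
  exact (metricCoord_chartD he hs _ _).symm

theorem inner_eq_of_parallel {a b : ℝ} {U : (t : ℝ) → TangentSpace (𝓡 d) (c t)}
    (hc : ∀ t ∈ Icc a b, HasVelocityWithinAt c (Icc a b) t (U t))
    (hV : ∀ t ∈ Icc a b, HasCovDerivWithinAt c V (Icc a b) t (U t) 0)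
    (hV' : ∀ t ∈ Icc a b, HasCovDerivWithinAt c V' (Icc a b) t (U t) 0) {s t : ℝ}
    (hs : s ∈ Icc a b) (ht : t ∈ Icc a b) : inner ℝ (V s) (V' s) = inner ℝ (V t) (V' t) := by
  have hd : ∀ t ∈ Icc a b, HasDerivWithinAt (fun s => inner ℝ (V s) (V' s)) 0 (Icc a b) t :=
    fun t ht => by simpa using (hc t ht).hasDerivWithinAt_inner (hV t ht) (hV' t ht)
  have key : ∀ t ∈ Icc a b, inner ℝ (V t) (V' t) = inner ℝ (V a) (V' a) :=
    constant_of_has_deriv_right_zero (fun t ht => (hd t ht).continuousWithinAt)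
      (fun t ht => (hd t ⟨ht.1, ht.2.le⟩).Ici_of_Icc ht)
  rw [key s hs, key t ht]

end Basic

section Transport

variable [RiemannianBundle (fun x : M => TangentSpace (𝓡 d) x)] [IsManifold (𝓡 d) ∞ M]
  [IsContMDiffRiemannianBundle (𝓡 d) ∞ (Coord d) (fun x : M => TangentSpace (𝓡 d) x)]
  {c : ℝ → M} {U : (t : ℝ) → TangentSpace (𝓡 d) (c t)}

/-- Parallel transport within a chart domain, when the velocity is continuous in the chart. -/
theorem exists_parallel_of_chart {e : OpenPartialHomeomorph M (Coord d)}
    (he : e ∈ atlas (Coord d) M) {s t : ℝ} (hst : s ≤ t)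
    (hc : ∀ τ ∈ Icc s t, HasVelocityWithinAt c (Icc s t) τ (U τ))
    (hU : ContinuousOn (fieldCoord e c U) (Icc s t)) (hsrc : ∀ τ ∈ Icc s t, c τ ∈ e.source)
    (V₀ : TangentSpace (𝓡 d) (c s)) :
    ∃ V : (t : ℝ) → TangentSpace (𝓡 d) (c t), V s = V₀ ∧
      ∀ τ ∈ Icc s t, HasCovDerivWithinAt c V (Icc s t) τ (U τ) 0 := by
  have hx : ContinuousOn (fun τ => e (c τ)) (Icc s t) := fun τ hτ =>
    ((hc τ hτ).deriv e he (hsrc τ hτ)).continuousWithinAt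
  have hΓ : ContinuousOn (fun τ => Gam e (e (c τ))) (Icc s t) :=
    (isMetricOn_metricCoord he).contDiffOn_chr.continuousOn.comp hx
      (fun τ hτ => e.map_source (hsrc τ hτ))
  obtain ⟨v, hv0, hv⟩ := exists_linear_ode_solution hst
    (A := fun τ => -(Gam e (e (c τ)) (fieldCoord e c U τ))) (hΓ.clm_apply hU).neg
    (chartD e (c s) V₀)
  refine ⟨fun τ => chartV e (c τ) (v τ), ?_, fun τ hτ => ?_⟩
  · simp only [hv0]
    exact chartV_chartD he (hsrc s ⟨le_rfl, hst⟩) V₀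
  · refine HasCovDerivWithinAt.of_chart he (hsrc τ hτ) (hc τ hτ) ?_
    have h1 : ∀ τ ∈ Icc s t, fieldCoord e c (fun τ => chartV e (c τ) (v τ)) τ = v τ := fun τ hτ =>
      chartD_chartV he (hsrc τ hτ) _
    refine ((hv τ hτ).congr h1 (h1 τ hτ)).congr_deriv ?_
    rw [chartD_chartV he (hsrc τ hτ), map_zero, zero_sub]
    rfl

theorem exists_parallel {a b : ℝ} (hab : a ≤ b)
    (hc : ∀ τ ∈ Icc a b, HasVelocityWithinAt c (Icc a b) τ (U τ))
    (hU : ∀ e ∈ atlas (Coord d) M, ∀ t ∈ Icc a b, c t ∈ e.source →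
      ContinuousWithinAt (fieldCoord e c U) (Icc a b) t)
    (V₀ : TangentSpace (𝓡 d) (c a)) :
    ∃ V : (t : ℝ) → TangentSpace (𝓡 d) (c t), V a = V₀ ∧
      ∀ τ ∈ Icc a b, HasCovDerivWithinAt c V (Icc a b) τ (U τ) 0 := by
  refine Icc_forward_induction (a := a) (b := b) (P := fun t =>
    ∃ V : (t : ℝ) → TangentSpace (𝓡 d) (c t), V a = V₀ ∧
      ∀ τ ∈ Icc a t, HasCovDerivWithinAt c V (Icc a t) τ (U τ) 0) ?_ ?_ b ⟨hab, le_rfl⟩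
  · obtain ⟨V, hV, h⟩ := exists_parallel_of_chart (c := c) (U := U) (chart_mem_atlas _ (c a))
      (s := a) (t := a) le_rfl
      (fun τ hτ => (hc τ ⟨hτ.1, hτ.2.trans hab⟩).mono (Icc_subset_Icc_right hab))
      (by rw [Icc_self]; exact continuousOn_singleton _ _)
      (fun τ hτ => by rw [le_antisymm hτ.2 hτ.1]; exact mem_chart_source _ _) V₀
    exact ⟨V, hV, h⟩
  · intro t₀ ht₀ _
    set e := chartAt (Coord d) (c t₀) with he'
    have he : e ∈ atlas (Coord d) M := chart_mem_atlas _ _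
    have hnear := (hc t₀ ht₀).continuousWithinAt.preimage_mem_nhdsWithin
      (e.open_source.mem_nhds (mem_chart_source _ (c t₀)))
    obtain ⟨δ, hδ, hball⟩ := Metric.mem_nhdsWithin_iff.1 hnear
    refine ⟨δ, hδ, fun s hs t ht hsδ htδ hst hP => ?_⟩
    obtain ⟨V, hV0, hV⟩ := hP
    have hsub : Icc s t ⊆ Icc a b := Icc_subset_Icc hs.1 ht.2
    have hsrc : ∀ τ ∈ Icc s t, c τ ∈ e.source := by
      intro τ hτ
      refine hball ⟨?_, hsub hτ⟩
      rw [abs_lt] at hsδ htδ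
      rw [Metric.mem_ball, Real.dist_eq, abs_lt]
      constructor <;> linarith [hτ.1, hτ.2]
    obtain ⟨V', hV'0, hV'⟩ := exists_parallel_of_chart he hst
      (fun τ hτ => (hc τ (hsub hτ)).mono hsub)
      (fun τ hτ => (hU e he τ (hsub hτ) (hsrc τ hτ)).mono hsub) hsrc (V s)
    set Z : (t : ℝ) → TangentSpace (𝓡 d) (c t) := fun τ => if τ ≤ s then V τ else V' τ with hZ
    have e1 : ∀ τ ∈ Icc a s, Z τ = V τ := fun τ hτ => if_pos hτ.2
    have e2 : ∀ τ ∈ Icc s t, Z τ = V' τ := by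
      intro τ hτ
      rcases hτ.1.eq_or_lt with h | h
      · subst h; simp [hZ, hV'0]
      · exact if_neg (not_le.2 h)
    refine ⟨Z, (e1 a ⟨le_rfl, hs.1⟩).trans hV0, fun τ hτ => ?_⟩
    rcases lt_trichotomy τ s with h | h | h
    · refine ((hV τ ⟨hτ.1, h.le⟩).congr e1 ⟨hτ.1, h.le⟩).mono_of_mem_nhdsWithin ?_
      filter_upwards [self_mem_nhdsWithin, mem_nhdsWithin_of_mem_nhds (Iio_mem_nhds h)]
        with r hr hr'
      exact ⟨hr.1, le_of_lt hr'⟩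
    · subst h
      rw [← Icc_union_Icc_eq_Icc hs.1 hst]
      exact ((hV τ ⟨hs.1, le_rfl⟩).congr e1 ⟨hs.1, le_rfl⟩).union
        ((hV' τ ⟨le_rfl, hst⟩).congr e2 ⟨le_rfl, hst⟩)
    · refine ((hV' τ ⟨h.le, hτ.2⟩).congr e2 ⟨h.le, hτ.2⟩).mono_of_mem_nhdsWithin ?_
      filter_upwards [self_mem_nhdsWithin, mem_nhdsWithin_of_mem_nhds (Ioi_mem_nhds h)]
        with r hr hr'
      exact ⟨le_of_lt hr', hr.2⟩

end Transport

end FieldCalculus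

/-! ### The geodesic equation and unit speed up to the endpoints -/

section GeodesicVelocity

variable {d : ℕ} {M : Type*} [TopologicalSpace M] [ChartedSpace (Coord d) M]
  [IsManifold (𝓡 d) ∞ M]

/-- The velocity of the restriction of `c` to `[a, b]`. -/
def velocity (c : ℝ → M) (a b t : ℝ) : TangentSpace (𝓡 d) (c t) :=
  mfderivWithin 𝓘(ℝ, ℝ) (𝓡 d) c (Icc a b) t (1 : ℝ)

theorem hasVelocityWithinAt_velocity {c : ℝ → M} {a b : ℝ}
    (hc : ContMDiffOn 𝓘(ℝ, ℝ) (𝓡 d) ∞ c (Icc a b)) {t : ℝ} (ht : t ∈ Icc a b) :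
    HasVelocityWithinAt c (Icc a b) t (velocity (d := d) c a b t) where
  continuousWithinAt := (hc t ht).continuousWithinAt
  deriv e he hs := by
    have h1 : HasMFDerivWithinAt 𝓘(ℝ, ℝ) (𝓡 d) c (Icc a b) t _ :=
      ((hc t ht).mdifferentiableWithinAt (by simp)).hasMFDerivWithinAt
    have h2 : HasMFDerivAt (𝓡 d) (𝓡 d) e (c t) (mfderiv (𝓡 d) (𝓡 d) e (c t)) :=
      ((mdiff_of_mem_atlas he).mdifferentiableAt hs).hasMFDerivAt
    let D : ℝ →L[ℝ] Coord d :=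
      (chartD e (c t)).comp (mfderivWithin 𝓘(ℝ, ℝ) (𝓡 d) c (Icc a b) t)
    have h3 : HasFDerivWithinAt (fun s => e (c s)) D (Icc a b) t :=
      (h2.comp_hasMFDerivWithinAt t h1).hasFDerivWithinAt
    exact h3.hasDerivWithinAt

theorem exists_Icc_subset_source {c : ℝ → M} {a b : ℝ} (hab : a < b) {t : ℝ} (ht : t ∈ Icc a b)
    (hc : ContinuousWithinAt c (Icc a b) t) {W : Set M} (hW : W ∈ 𝓝 (c t)) :
    ∃ a' b', a' < b' ∧ t ∈ Icc a' b' ∧ Icc a' b' ⊆ Icc a b ∧ Icc a' b' ∈ 𝓝[Icc a b] t ∧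
      ∀ s ∈ Icc a' b', c s ∈ W := by
  obtain ⟨δ, hδ, hball⟩ := Metric.mem_nhdsWithin_iff.1 (hc.preimage_mem_nhdsWithin hW)
  refine ⟨max a (t - δ / 2), min b (t + δ / 2), ?_, ⟨max_le ht.1 (by linarith),
    le_min ht.2 (by linarith)⟩, Icc_subset_Icc (le_max_left _ _) (min_le_left _ _), ?_, ?_⟩
  · refine max_lt (lt_min hab ?_) (lt_min ?_ (by linarith)) <;> linarith [ht.1, ht.2]
  · have : Icc (t - δ / 2) (t + δ / 2) ∈ 𝓝 t := Icc_mem_nhds (by linarith) (by linarith)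
    filter_upwards [self_mem_nhdsWithin, mem_nhdsWithin_of_mem_nhds this] with s hs hs'
    exact ⟨max_le hs.1 hs'.1, le_min hs.2 hs'.2⟩
  · intro s hs
    refine hball ⟨?_, (le_max_left _ _).trans hs.1, hs.2.trans (min_le_left _ _)⟩
    have h1 := (le_max_right _ _).trans hs.1
    have h2 := hs.2.trans (min_le_right _ _)
    rw [Metric.mem_ball, Real.dist_eq, abs_lt]
    constructor <;> linarith

theorem contDiffOn_chart_comp {c : ℝ → M} {S : Set ℝ}
    (hc : ContMDiffOn 𝓘(ℝ, ℝ) (𝓡 d) ∞ c S) {e : OpenPartialHomeomorph M (Coord d)}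
    (he : e ∈ atlas (Coord d) M) (hs : ∀ s ∈ S, c s ∈ e.source) :
    ContDiffOn ℝ ∞ (fun s => e (c s)) S :=
  ((contMDiffOn_of_atlas he).comp hc hs).contDiffOn

variable [RiemannianBundle (fun x : M => TangentSpace (𝓡 d) x)]

theorem IsGeodesicOn.hasVelocityWithinAt {c : ℝ → M} {a b : ℝ} (h : IsGeodesicOn (d := d) c a b)
    {t : ℝ} (ht : t ∈ Icc a b) : HasVelocityWithinAt c (Icc a b) t (velocity (d := d) c a b t) :=
  hasVelocityWithinAt_velocity h.smooth ht

variable [IsContMDiffRiemannianBundle (𝓡 d) ∞ (Coord d) (fun x : M => TangentSpace (𝓡 d) x)]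

theorem IsGeodesicOn.hasCovDerivWithinAt {c : ℝ → M} {a b : ℝ} (h : IsGeodesicOn (d := d) c a b)
    {t : ℝ} (ht : t ∈ Icc a b) :
    HasCovDerivWithinAt c (velocity c a b) (Icc a b) t (velocity (d := d) c a b t) 0 := by
  have hv := h.hasVelocityWithinAt ht
  set e := chartAt (Coord d) (c t) with he'
  have he : e ∈ atlas (Coord d) M := chart_mem_atlas _ _
  have hsrc : c t ∈ e.source := mem_chart_source _ _
  refine HasCovDerivWithinAt.of_chart he hsrc hv ?_
  obtain ⟨a', b', hab', ht', hsub, hnhds, hs⟩ := exists_Icc_subset_source h.lt ht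
    hv.continuousWithinAt (e.open_source.mem_nhds hsrc)
  refine HasDerivWithinAt.mono_of_mem_nhdsWithin ?_ hnhds
  set x : ℝ → Coord d := fun s => e (c s) with hx
  have hud := uniqueDiffOn_Icc hab'
  have hxs : ContDiffOn ℝ ∞ x (Icc a' b') := contDiffOn_chart_comp (h.smooth.mono hsub) he hs
  have hx's : ContDiffOn ℝ ∞ (derivWithin x (Icc a' b')) (Icc a' b') :=
    hxs.derivWithin hud (by simp)
  have hx''s : ContDiffOn ℝ ∞ (derivWithin (derivWithin x (Icc a' b')) (Icc a' b')) (Icc a' b') :=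
    hx's.derivWithin hud (by simp)
  have hU : ∀ s ∈ Icc a' b', fieldCoord e c (velocity c a b) s = derivWithin x (Icc a' b') s :=
    fun s hs' => ((((h.hasVelocityWithinAt (hsub hs')).deriv e he (hs s hs')).mono
      hsub).derivWithin (hud s hs')).symm
  have hΓ : ContinuousOn (fun s => Gam e (x s)) (Icc a' b') :=
    (isMetricOn_metricCoord he).contDiffOn_chr.continuousOn.comp hxs.continuousOn
      (fun s hs' => e.map_source (hs s hs'))
  -- The equation is given at interior parameters; smoothness up to the boundary extends it to the
  -- closed interval by continuity.
  have hzero : EqOn (fun s => derivWithin (derivWithin x (Icc a' b')) (Icc a' b') s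
      + Gam e (x s) (derivWithin x (Icc a' b') s) (derivWithin x (Icc a' b') s)) (fun _ => 0)
      (Icc a' b') := by
    have hIoo : EqOn (fun s => derivWithin (derivWithin x (Icc a' b')) (Icc a' b') s
      + Gam e (x s) (derivWithin x (Icc a' b') s) (derivWithin x (Icc a' b') s)) (fun _ => 0)
      (Ioo a' b') := by
      intro s hs'
      have hd : ∀ r ∈ Ioo a' b', derivWithin x (Icc a' b') r = deriv x r := fun r hr =>
        derivWithin_of_mem_nhds (Icc_mem_nhds hr.1 hr.2)
      have hd2 : derivWithin (derivWithin x (Icc a' b')) (Icc a' b') s = deriv (deriv x) s := by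
        rw [derivWithin_of_mem_nhds (Icc_mem_nhds hs'.1 hs'.2)]
        apply Filter.EventuallyEq.deriv_eq
        filter_upwards [Ioo_mem_nhds hs'.1 hs'.2] with r hr using hd r hr
      have hmem : s ∈ Ioo a b :=
        ⟨(hsub (left_mem_Icc.2 hab'.le)).1.trans_lt hs'.1,
          hs'.2.trans_le (hsub (right_mem_Icc.2 hab'.le)).2⟩
      have := h.geodesic_eq e he s hmem (hs s (Ioo_subset_Icc_self hs'))
      simp only [hd s hs', hd2]
      exact this
    refine hIoo.of_subset_closure ?_ continuousOn_const Ioo_subset_Icc_self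
      (closure_Ioo hab'.ne).ge
    exact hx''s.continuousOn.add ((hΓ.clm_apply hx's.continuousOn).clm_apply hx's.continuousOn)
  have hd := ((hx's.differentiableOn (by simp) t ht').hasDerivWithinAt).congr hU (hU t ht')
  refine hd.congr_deriv ?_
  rw [map_zero, zero_sub, eq_neg_iff_add_eq_zero, ← fieldCoord_eq_chartD, hU t ht']
  exact hzero ht'

/-- The velocity is parallel, so its length is constant and equals the length at an interior
parameter. -/
theorem IsGeodesicOn.norm_velocity {c : ℝ → M} {a b : ℝ} (h : IsGeodesicOn (d := d) c a b)
    {t : ℝ} (ht : t ∈ Icc a b) : ‖velocity (d := d) c a b t‖ = 1 := by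
  obtain ⟨s, hs⟩ := exists_between h.lt
  have h1 := inner_eq_of_parallel (fun t ht => h.hasVelocityWithinAt ht)
    (fun t ht => h.hasCovDerivWithinAt ht) (fun t ht => h.hasCovDerivWithinAt ht) ht
    (Ioo_subset_Icc_self hs)
  have h2 : ‖velocity (d := d) c a b s‖ = 1 := by
    rw [velocity, mfderivWithin_of_mem_nhds (Icc_mem_nhds hs.1 hs.2)]
    exact h.unit_speed s hs
  rw [real_inner_self_eq_norm_sq, real_inner_self_eq_norm_sq, h2] at h1
  exact (pow_left_inj₀ (norm_nonneg _) zero_le_one two_ne_zero).1 h1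

end GeodesicVelocity

/-! ### Geodesics are 1-Lipschitz for the Riemannian distance -/

section Lipschitz

open MeasureTheory Manifold

variable {d : ℕ} {M : Type*} [MetricSpace M] [ChartedSpace (Coord d) M]
  [RiemannianBundle (fun x : M => TangentSpace (𝓡 d) x)]
  [IsRiemannianManifold (𝓡 d) M]

theorem IsGeodesicOn.dist_le {c : ℝ → M} {a b : ℝ} (h : IsGeodesicOn (d := d) c a b) {s t : ℝ}
    (hs : s ∈ Icc a b) (ht : t ∈ Icc a b) : dist (c s) (c t) ≤ |s - t| := by
  wlog hst : s ≤ t generalizing s t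
  · rw [dist_comm, abs_sub_comm]
    exact this ht hs (le_of_not_ge hst)
  have h1 : edist (c s) (c t) ≤ ENNReal.ofReal (t - s) := by
    rw [IsRiemannianManifold.out (I := 𝓡 d)]
    refine (riemannianEDist_le_pathELength (I := 𝓡 d) (γ := c) (a := s) (b := t)
      ((h.smooth.of_le (by simp)).mono (Icc_subset_Icc hs.1 ht.2)) rfl rfl hst).trans ?_
    rw [pathELength_eq_lintegral_mfderiv_Ioo]
    rw [setLIntegral_congr_fun measurableSet_Ioo (g := fun _ => 1) (fun r hr => ?_)]
    · simp
    · have := h.unit_speed r ⟨hs.1.trans_lt hr.1, hr.2.trans_le ht.2⟩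
      rw [← ofReal_norm]
      exact (congrArg ENNReal.ofReal this).trans ENNReal.ofReal_one
  rw [edist_dist, ENNReal.ofReal_le_ofReal_iff (by linarith)] at h1
  rw [abs_sub_comm, abs_of_nonneg (by linarith)]
  exact h1

end Lipschitz

/-! ### Geodesics with Jacobi fields as one autonomous system -/

section JacobiODE

variable {E : Type*} [NormedAddCommGroup E] [NormedSpace ℝ E]

/-- Solutions of an autonomous equation with smooth right hand side are smooth. -/
theorem contDiffOn_of_ode {F : E → E} {O : Set E} {S : Set ℝ} (hS : UniqueDiffOn ℝ S)
    (hF : ContDiffOn ℝ ∞ F O) {X : ℝ → E} (hX : ∀ t ∈ S, X t ∈ O)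
    (hX' : ∀ t ∈ S, HasDerivWithinAt X (F (X t)) S t) : ContDiffOn ℝ ∞ X S := by
  rw [contDiffOn_infty]
  intro n
  induction n with
  | zero => exact contDiffOn_zero.2 fun t ht => (hX' t ht).continuousWithinAt
  | succ n ih =>
    push_cast
    rw [contDiffOn_succ_iff_derivWithin hS]
    refine ⟨fun t ht => (hX' t ht).differentiableWithinAt, by simp, ?_⟩
    refine ((hF.of_le (by exact_mod_cast le_top)).comp ih hX).congr fun t ht => ?_
    exact (hX' t ht).derivWithin (hS t ht)

/-- The vector field whose integral curves are the Jacobi fields along geodesics, for the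
connection with Christoffel symbols `Γ`; the arguments are a point, the velocity, the Jacobi field
and its covariant derivative. -/
def jacField (Γ : E → E →L[ℝ] E →L[ℝ] E) (X : (E × E) × E × E) : (E × E) × E × E :=
  ((X.1.2, -(Γ X.1.1 X.1.2 X.1.2)),
    (X.2.2 - Γ X.1.1 X.1.2 X.2.1, -(curv Γ X.1.1 X.2.1 X.1.2 X.1.2) - Γ X.1.1 X.1.2 X.2.2))

theorem contDiffOn_jacField {Γ : E → E →L[ℝ] E →L[ℝ] E} {O : Set E} (hO : IsOpen O)
    (hΓ : ContDiffOn ℝ ∞ Γ O) : ContDiffOn ℝ ∞ (jacField Γ) {X | X.1.1 ∈ O} := by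
  have hD : ContDiffOn ℝ ∞ (fderiv ℝ Γ) O := hΓ.fderiv_of_isOpen hO (by simp)
  have hmaps : MapsTo (fun X : (E × E) × E × E => X.1.1) {X | X.1.1 ∈ O} O := fun X hX => hX
  have c1 : ContDiff ℝ ∞ fun X : (E × E) × E × E => X.1.1 := contDiff_fst.fst
  have c2 : ContDiffOn ℝ ∞ (fun X : (E × E) × E × E => X.1.2) {X | X.1.1 ∈ O} :=
    contDiff_fst.snd.contDiffOn
  have c3 : ContDiffOn ℝ ∞ (fun X : (E × E) × E × E => X.2.1) {X | X.1.1 ∈ O} :=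
    contDiff_snd.fst.contDiffOn
  have c4 : ContDiffOn ℝ ∞ (fun X : (E × E) × E × E => X.2.2) {X | X.1.1 ∈ O} :=
    contDiff_snd.snd.contDiffOn
  have hΓ' : ContDiffOn ℝ ∞ (fun X : (E × E) × E × E => Γ X.1.1) {X | X.1.1 ∈ O} :=
    hΓ.comp c1.contDiffOn hmaps
  have hD' : ContDiffOn ℝ ∞ (fun X : (E × E) × E × E => fderiv ℝ Γ X.1.1) {X | X.1.1 ∈ O} :=
    hD.comp c1.contDiffOn hmaps
  have ap : ∀ {f g : (E × E) × E × E → E}, ContDiffOn ℝ ∞ f {X | X.1.1 ∈ O} →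
      ContDiffOn ℝ ∞ g {X | X.1.1 ∈ O} →
      ContDiffOn ℝ ∞ (fun X => Γ X.1.1 (f X) (g X)) {X | X.1.1 ∈ O} := fun hf hg =>
    (hΓ'.clm_apply hf).clm_apply hg
  have apD : ∀ {f g h : (E × E) × E × E → E}, ContDiffOn ℝ ∞ f {X | X.1.1 ∈ O} →
      ContDiffOn ℝ ∞ g {X | X.1.1 ∈ O} → ContDiffOn ℝ ∞ h {X | X.1.1 ∈ O} →
      ContDiffOn ℝ ∞ (fun X => fderiv ℝ Γ X.1.1 (f X) (g X) (h X)) {X | X.1.1 ∈ O} :=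
    fun hf hg hh => ((hD'.clm_apply hf).clm_apply hg).clm_apply hh
  exact (c2.prodMk (ap c2 c2).neg).prodMk ((c4.sub (ap c2 c3)).prodMk
    (((((apD c3 c2 c2).sub (apD c2 c3 c2)).add (ap c3 (ap c2 c2))).sub (ap c2 (ap c3 c2))).neg.sub
      (ap c2 c4)))

end JacobiODE

/-! ### Jacobi systems on the manifold -/

section JacobiSystem

variable {d : ℕ} {M : Type*} [TopologicalSpace M] [ChartedSpace (Coord d) M]
  [IsManifold (𝓡 d) ∞ M] [RiemannianBundle (fun x : M => TangentSpace (𝓡 d) x)]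

/-- `c` is a curve with parallel velocity field `U`, and `J` is a Jacobi field along `c` with
covariant derivative `K`, with one-sided derivatives at boundary points of `S`. -/
structure IsJacobiSystemOn (c : ℝ → M) (U J K : (t : ℝ) → TangentSpace (𝓡 d) (c t))
    (S : Set ℝ) : Prop where
  vel : ∀ t ∈ S, HasVelocityWithinAt c S t (U t)
  geo : ∀ t ∈ S, HasCovDerivWithinAt c U S t (U t) 0
  jac : ∀ t ∈ S, HasCovDerivWithinAt c J S t (U t) (K t)
  curv : ∀ t ∈ S, HasCovDerivWithinAt c K S t (U t) (-(Rm (c t) (J t) (U t) (U t)))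

/-- The coordinates of a Jacobi system. -/
def jacCoord (e : OpenPartialHomeomorph M (Coord d)) (c : ℝ → M)
    (U J K : (t : ℝ) → TangentSpace (𝓡 d) (c t)) (t : ℝ) :
    (Coord d × Coord d) × Coord d × Coord d :=
  ((e (c t), fieldCoord e c U t), (fieldCoord e c J t, fieldCoord e c K t))

variable [IsContMDiffRiemannianBundle (𝓡 d) ∞ (Coord d) (fun x : M => TangentSpace (𝓡 d) x)]
  {c : ℝ → M} {U J K : (t : ℝ) → TangentSpace (𝓡 d) (c t)} {S S' : Set ℝ}
  {e : OpenPartialHomeomorph M (Coord d)}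

theorem contDiffOn_jacField_Gam (he : e ∈ atlas (Coord d) M) :
    ContDiffOn ℝ ∞ (jacField (Gam e)) {X | X.1.1 ∈ e.target} :=
  contDiffOn_jacField e.open_target (isMetricOn_metricCoord he).contDiffOn_chr

namespace IsJacobiSystemOn

theorem hasDerivWithinAt (h : IsJacobiSystemOn c U J K S) (he : e ∈ atlas (Coord d) M) {t : ℝ}
    (ht : t ∈ S) (hs : c t ∈ e.source) :
    HasDerivWithinAt (jacCoord e c U J K) (jacField (Gam e) (jacCoord e c U J K t)) S t := by
  have h2 := h.geo t ht e he hs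
  have h4 := h.curv t ht e he hs
  rw [map_zero, zero_sub] at h2
  rw [map_neg, chartD_Rm he hs] at h4
  exact (((h.vel t ht).deriv e he hs).prodMk h2).prodMk ((h.jac t ht e he hs).prodMk h4)

theorem of_hasDerivWithinAt (he : e ∈ atlas (Coord d) M) {t : ℝ}
    (hc : ContinuousWithinAt c S t) (hs : c t ∈ e.source)
    (h : HasDerivWithinAt (jacCoord e c U J K) (jacField (Gam e) (jacCoord e c U J K t)) S t) :
    HasVelocityWithinAt c S t (U t) ∧ HasCovDerivWithinAt c U S t (U t) 0 ∧
      HasCovDerivWithinAt c J S t (U t) (K t) ∧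
      HasCovDerivWithinAt c K S t (U t) (-(Rm (c t) (J t) (U t) (U t))) := by
  have hv : HasVelocityWithinAt c S t (U t) := HasVelocityWithinAt.of_chart he hc hs h.fst.fst
  refine ⟨hv, HasCovDerivWithinAt.of_chart he hs hv ?_, HasCovDerivWithinAt.of_chart he hs hv ?_,
    HasCovDerivWithinAt.of_chart he hs hv ?_⟩
  · rw [map_zero, zero_sub]
    exact h.fst.snd
  · exact h.snd.fst
  · rw [map_neg, chartD_Rm he hs]
    exact h.snd.snd

/-- In a chart the system is an integral curve of the smooth field `jacField`, hence smooth by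
bootstrapping; `IsJacobiFieldOn` requires this. -/
theorem contMDiffOn {a b : ℝ} (hab : a < b) (h : IsJacobiSystemOn c U J K (Icc a b)) :
    ContMDiffOn 𝓘(ℝ, ℝ) (𝓡 d).tangent ∞
      (fun t => (⟨c t, J t⟩ : TangentBundle (𝓡 d) M)) (Icc a b) := by
  intro t ht
  set e := chartAt (Coord d) (c t) with he'
  have he : e ∈ atlas (Coord d) M := chart_mem_atlas _ _
  have hsrc : c t ∈ e.source := mem_chart_source _ _
  obtain ⟨a', b', hab', ht', hsub, hnhds, hs⟩ := exists_Icc_subset_source hab ht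
    (h.vel t ht).continuousWithinAt (e.open_source.mem_nhds hsrc)
  have hX : ContDiffOn ℝ ∞ (jacCoord e c U J K) (Icc a' b') :=
    contDiffOn_of_ode (uniqueDiffOn_Icc hab') (contDiffOn_jacField_Gam he)
      (fun s hs' => e.map_source (hs s hs'))
      (fun s hs' => (h.hasDerivWithinAt he (hsub hs') (hs s hs')).mono hsub)
  have hX' := (hX t ht').mono_of_mem_nhdsWithin hnhds
  have hc : ContMDiffWithinAt 𝓘(ℝ, ℝ) (𝓡 d) ∞ c (Icc a' b') t := by
    have h1 := (contMDiffOn_symm_of_atlas he).comp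
      (hX.fst.fst.contMDiffOn) (fun s hs' => e.map_source (hs s hs'))
    exact (h1.congr fun s hs' => (e.left_inv (hs s hs')).symm) t ht'
  rw [Bundle.contMDiffWithinAt_totalSpace]
  refine ⟨hc.mono_of_mem_nhdsWithin hnhds, ?_⟩
  refine ContMDiffWithinAt.congr_of_eventuallyEq hX'.snd.fst.contMDiffWithinAt ?_ ?_
  · filter_upwards [hnhds] with s hs'
    simp only [jacCoord, fieldCoord]
    rw [mfderiv_chartAt_eq_tangentCoordChange (hs s hs')]
    rfl
  · simp only [jacCoord, fieldCoord]
    rw [mfderiv_chartAt_eq_tangentCoordChange hsrc]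
    rfl

theorem isJacobiFieldOn {a b : ℝ} (hab : a < b) (h : IsJacobiSystemOn c U J K (Icc a b)) :
    IsJacobiFieldOn c a b J where
  smooth := h.contMDiffOn hab
  jacobi_eq e he t ht hs := by
    have hd : ∀ s ∈ Ioo a b, c s ∈ e.source →
        HasDerivAt (jacCoord e c U J K) (jacField (Gam e) (jacCoord e c U J K s)) s :=
      fun s hs' hsrc => (h.hasDerivWithinAt he (Ioo_subset_Icc_self hs') hsrc).hasDerivAt
        (Icc_mem_nhds hs'.1 hs'.2)
    have hcov : ∀ s ∈ Ioo a b, c s ∈ e.source →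
        covDerivCoord e c (fieldCoord e c J) s = fieldCoord e c K s := by
      intro s hs' hsrc
      have h1 : HasDerivAt (fun s => e (c s)) (fieldCoord e c U s) s := (hd s hs' hsrc).fst.fst
      have h2 : HasDerivAt (fieldCoord e c J) (fieldCoord e c K s
          - Gam e (e (c s)) (fieldCoord e c U s) (fieldCoord e c J s)) s :=
        (hd s hs' hsrc).snd.fst
      rw [covDerivCoord, h1.deriv, h2.deriv, christoffel_eq]
      abel
    have hct : ContinuousAt c t := (h.vel t (Ioo_subset_Icc_self ht)).continuousWithinAt.continuousAt
      (Icc_mem_nhds ht.1 ht.2)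
    have hev : covDerivCoord e c (fieldCoord e c J) =ᶠ[𝓝 t] fieldCoord e c K := by
      filter_upwards [Ioo_mem_nhds ht.1 ht.2,
        hct.preimage_mem_nhds (e.open_source.mem_nhds hs)] with s h1 h2
      exact hcov s h1 h2
    have h1 : HasDerivAt (fun s => e (c s)) (fieldCoord e c U t) t := (hd t ht hs).fst.fst
    have h2 : HasDerivAt (fieldCoord e c K)
        (-(_root_.curv (Gam e) (e (c t)) (fieldCoord e c J t) (fieldCoord e c U t)
            (fieldCoord e c U t))
          - Gam e (e (c t)) (fieldCoord e c U t) (fieldCoord e c K t)) t :=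
      (hd t ht hs).snd.snd
    rw [covDerivCoord, hev.deriv_eq, h1.deriv, h2.deriv, hcov t ht hs, curvatureCoord_eq he (e.map_source hs),
      christoffel_eq]
    abel

end IsJacobiSystemOn

end JacobiSystem

/-! ### Orthonormal frames and the matrix of the Jacobi operator -/

section FrameAlgebra

variable {d : ℕ} {M : Type*} [TopologicalSpace M] [ChartedSpace (Coord d) M]
  {x : M} {V : Fin d → TangentSpace (𝓡 d) x}

theorem comb_add (y w : Coord d) : comb V (y + w) = comb V y + comb V w := by
  simp [comb, add_smul, Finset.sum_add_distrib]

theorem comb_smul (r : ℝ) (y : Coord d) : comb V (r • y) = r • comb V y := by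
  simp [comb, mul_smul, Finset.smul_sum]

theorem comb_zero : comb V 0 = 0 := by simp [comb]

theorem finrank_tangentSpace (x : M) : Module.finrank ℝ (TangentSpace (𝓡 d) x) = d :=
  (finrank_euclideanSpace_fin (𝕜 := ℝ) (n := d) : Module.finrank ℝ (Coord d) = d)

variable [RiemannianBundle (fun x : M => TangentSpace (𝓡 d) x)]

theorem inner_comb_comb (hV : Orthonormal ℝ V) (y w : Coord d) :
    inner ℝ (comb V y) (comb V w) = inner ℝ y w := by
  rw [comb, comb, hV.inner_sum, PiLp.inner_apply]
  exact Finset.sum_congr rfl fun i _ => by simp [mul_comm]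

theorem norm_comb (hV : Orthonormal ℝ V) (y : Coord d) : ‖comb V y‖ = ‖y‖ := by
  rw [@norm_eq_sqrt_real_inner _ _ _ (comb V y), inner_comb_comb hV, norm_eq_sqrt_real_inner y]

theorem exists_orthonormal_tangentSpace (x : M) :
    ∃ V : Fin d → TangentSpace (𝓡 d) x, Orthonormal ℝ V := by
  have : FiniteDimensional ℝ (TangentSpace (𝓡 d) x) :=
    inferInstanceAs (FiniteDimensional ℝ (Coord d))
  let b := (stdOrthonormalBasis ℝ (TangentSpace (𝓡 d) x)).reindex
    (finCongr (finrank_tangentSpace x))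
  exact ⟨b, b.orthonormal⟩

/-- The coordinates of a vector in an orthonormal frame. -/
def frameCoord (V : Fin d → TangentSpace (𝓡 d) x) (a : TangentSpace (𝓡 d) x) : Coord d :=
  WithLp.toLp 2 fun i => inner ℝ (V i) a

theorem comb_frameCoord (hV : Orthonormal ℝ V) (a : TangentSpace (𝓡 d) x) :
    comb V (frameCoord V a) = a := by
  have : FiniteDimensional ℝ (TangentSpace (𝓡 d) x) :=
    inferInstanceAs (FiniteDimensional ℝ (Coord d))
  have hsp : ⊤ ≤ Submodule.span ℝ (range V) :=
    (hV.linearIndependent.span_eq_top_of_card_eq_finrank'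
      (by rw [finrank_tangentSpace, Fintype.card_fin])).ge
  have := (OrthonormalBasis.mk hV hsp).sum_repr' a
  simpa [comb, frameCoord] using this

theorem inner_frameCoord (a : TangentSpace (𝓡 d) x) (w : Coord d) :
    inner ℝ (frameCoord V a) w = inner ℝ a (comb V w) := by
  rw [PiLp.inner_apply, comb, inner_sum]
  refine Finset.sum_congr rfl fun i _ => ?_
  rw [real_inner_smul_right, show inner ℝ a (V i) = inner ℝ (V i) a from real_inner_comm _ _]
  simp [frameCoord]

variable [IsManifold (𝓡 d) ∞ M]
  [IsContMDiffRiemannianBundle (𝓡 d) ∞ (Coord d) (fun x : M => TangentSpace (𝓡 d) x)]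

/-- The curvature operator `a ↦ R(a, U)U` in a frame. -/
def Rmat (V : Fin d → TangentSpace (𝓡 d) x) (U : TangentSpace (𝓡 d) x) : Coord d →L[ℝ] Coord d :=
  LinearMap.toContinuousLinearMap
    { toFun := fun y => frameCoord V (Rm x (comb V y) U U)
      map_add' := fun y w => by
        ext i
        simp [frameCoord, comb_add, Rm_add_left, inner_add_right]
      map_smul' := fun r y => by
        ext i
        simp [frameCoord, comb_smul, Rm_smul_left, real_inner_smul_right] }

theorem Rmat_apply (U : TangentSpace (𝓡 d) x) (y : Coord d) :
    Rmat V U y = frameCoord V (Rm x (comb V y) U U) := rfl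

theorem inner_Rmat_symm (U : TangentSpace (𝓡 d) x) (y w : Coord d) :
    inner ℝ (Rmat V U y) w = inner ℝ y (Rmat V U w) := by
  rw [← real_inner_comm y, Rmat_apply, Rmat_apply, inner_frameCoord, inner_frameCoord,
    inner_Rm_symm]

theorem Rmat_smul (U : TangentSpace (𝓡 d) x) (r : ℝ) : Rmat V (r • U) = (r * r) • Rmat V U := by
  ext y i
  simp [Rmat_apply, frameCoord, Rm_smul_smul, real_inner_smul_right]

theorem norm_Rmat_le (hV : Orthonormal ℝ V) {U : TangentSpace (𝓡 d) x} {k : ℝ} (hk : 0 ≤ k)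
    (h : ∀ a, ‖Rm x a U U‖ ≤ k * ‖a‖) : ‖Rmat V U‖ ≤ k := by
  refine ContinuousLinearMap.opNorm_le_bound _ hk fun y => ?_
  rw [Rmat_apply, ← norm_comb hV, comb_frameCoord hV, ← norm_comb hV y]
  exact h _

end FrameAlgebra

/-! ### Affine reparametrization of conjugate-free equations -/

section ConjFree

variable {W : Type*} [NormedAddCommGroup W] [InnerProductSpace ℝ W] {R : ℝ → W →L[ℝ] W}

/-- Two time derivatives produce the factor `α²`. Negative `α` is needed for reversing geodesics and
swaps the two zeros; positive `α` serves the time rescaling. -/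
theorem ConjFree.comp_affine {S S' : Set ℝ} (h : ConjFree R S) {α β : ℝ} (hα : α ≠ 0)
    (hS : MapsTo (fun t => α * t + β) S' S) :
    ConjFree (fun t => (α * α) • R (α * t + β)) S' := by
  intro a ha b hb hab y z hyz hya hyb
  set ψ : ℝ → ℝ := fun s => α⁻¹ * s + -(α⁻¹ * β) with hψ
  have hψφ : ∀ t, ψ (α * t + β) = t := fun t => by simp only [hψ]; field_simp; ring
  have hφψ : ∀ s, α * ψ s + β = s := fun s => by simp only [hψ]; field_simp; ring
  have hsolve : ∀ p q, MapsTo ψ (Icc p q) (Icc a b) →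
      SolvesJacobi R (fun s => y (ψ s)) (fun s => α⁻¹ • z (ψ s)) (Icc p q) := by
    intro p q hpq
    have hd : ∀ s, HasDerivWithinAt ψ α⁻¹ (Icc p q) s := fun s => by
      have := (((hasDerivAt_id s).const_mul α⁻¹).add_const
        (-(α⁻¹ * β))).hasDerivWithinAt (s := Icc p q)
      rwa [mul_one] at this
    refine ⟨fun s hs => (hyz.left _ (hpq hs)).scomp s (hd s) hpq, fun s hs => ?_⟩
    have := ((hyz.right _ (hpq hs)).scomp s (hd s) hpq).const_smul α⁻¹
    refine this.congr_deriv ?_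
    rw [_root_.smul_apply, hφψ, smul_neg, smul_neg, smul_smul, smul_smul]
    congr 1
    have : α⁻¹ * (α⁻¹ * (α * α)) = 1 := by field_simp
    rw [← mul_assoc] at this
    rw [this, one_smul]
  intro t ht
  rcases hα.lt_or_gt with hneg | hpos
  · have hi : α⁻¹ < 0 := inv_lt_zero.2 hneg
    have hlt : α * b + β < α * a + β := by nlinarith
    have hmaps : MapsTo ψ (Icc (α * b + β) (α * a + β)) (Icc a b) := by
      intro s hs
      have h1 := mul_le_mul_of_nonpos_left hs.1 hi.le
      have h2 := mul_le_mul_of_nonpos_left hs.2 hi.le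
      have e1 := hψφ a
      have e2 := hψφ b
      simp only [hψ] at e1 e2 ⊢
      constructor <;> linarith
    have := h _ (hS hb) _ (hS ha) hlt _ _ (hsolve _ _ hmaps) (by simp only [hψφ, hyb])
      (by simp only [hψφ, hya]) (α * t + β) (by constructor <;> nlinarith [ht.1, ht.2])
    simpa only [hψφ] using this
  · have hi : 0 < α⁻¹ := inv_pos.2 hpos
    have hlt : α * a + β < α * b + β := by nlinarith
    have hmaps : MapsTo ψ (Icc (α * a + β) (α * b + β)) (Icc a b) := by
      intro s hs
      have h1 := mul_le_mul_of_nonneg_left hs.1 hi.le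
      have h2 := mul_le_mul_of_nonneg_left hs.2 hi.le
      have e1 := hψφ a
      have e2 := hψφ b
      simp only [hψ] at e1 e2 ⊢
      constructor <;> linarith
    have := h _ (hS ha) _ (hS hb) hlt _ _ (hsolve _ _ hmaps) (by simp only [hψφ, hya])
      (by simp only [hψφ, hyb]) (α * t + β) (by constructor <;> nlinarith [ht.1, ht.2])
    simpa only [hψφ] using this

end ConjFree

/-! ### Geodesics with a parallel orthonormal frame -/

section FramedGeodesic

variable {d : ℕ} {M : Type*} [MetricSpace M] [ChartedSpace (Coord d) M]
  [RiemannianBundle (fun x : M => TangentSpace (𝓡 d) x)]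

/-- `c` is a geodesic on `[0, T]` of constant speed `σ` with velocity field `U` and parallel
orthonormal frame `V`. -/
structure IsFramedGeodesicOn (c : ℝ → M) (U : (t : ℝ) → TangentSpace (𝓡 d) (c t))
    (V : Fin d → (t : ℝ) → TangentSpace (𝓡 d) (c t)) (σ T : ℝ) : Prop where
  vel : ∀ t ∈ Icc 0 T, HasVelocityWithinAt c (Icc 0 T) t (U t)
  geo : ∀ t ∈ Icc 0 T, HasCovDerivWithinAt c U (Icc 0 T) t (U t) 0
  par : ∀ i, ∀ t ∈ Icc 0 T, HasCovDerivWithinAt c (V i) (Icc 0 T) t (U t) 0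
  orth : ∀ t ∈ Icc 0 T, Orthonormal ℝ fun i => V i t
  speed : ∀ t ∈ Icc 0 T, ‖U t‖ = σ
  dist_le : ∀ s ∈ Icc 0 T, ∀ t ∈ Icc 0 T, dist (c s) (c t) ≤ σ * |s - t|

namespace IsFramedGeodesicOn

variable {c : ℝ → M} {U : (t : ℝ) → TangentSpace (𝓡 d) (c t)}
  {V : Fin d → (t : ℝ) → TangentSpace (𝓡 d) (c t)} {σ T : ℝ}

theorem comp_affine (h : IsFramedGeodesicOn c U V σ T) {α β T' : ℝ}
    (hT : MapsTo (fun t => α * t + β) (Icc 0 T') (Icc 0 T)) :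
    IsFramedGeodesicOn (fun t => c (α * t + β)) (fun t => α • U (α * t + β))
      (fun i t => V i (α * t + β)) (|α| * σ) T' where
  vel t ht := (h.vel _ (hT ht)).comp_affine hT
  geo t ht := by
    have := ((h.geo _ (hT ht)).comp_affine (W := fun _ => 0) hT).const_smul α
    rwa [smul_zero, smul_zero] at this
  par i t ht := by
    have := (h.par i _ (hT ht)).comp_affine (W := fun _ => 0) hT
    rwa [smul_zero] at this
  orth t ht := h.orth _ (hT ht)
  speed t ht := by rw [norm_smul, h.speed _ (hT ht), Real.norm_eq_abs]
  dist_le s hs t ht := by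
    refine (h.dist_le _ (hT hs) _ (hT ht)).trans (le_of_eq ?_)
    rw [show α * s + β - (α * t + β) = α * (s - t) by ring, abs_mul]
    ring

variable [IsManifold (𝓡 d) ∞ M]
  [IsContMDiffRiemannianBundle (𝓡 d) ∞ (Coord d) (fun x : M => TangentSpace (𝓡 d) x)]

theorem isJacobiSystemOn (h : IsFramedGeodesicOn c U V σ T) {S : Set ℝ} (hS : S ⊆ Icc 0 T)
    {y z : ℝ → Coord d}
    (hyz : SolvesJacobi (fun t => Rmat (fun i => V i t) (U t)) y z S) :
    IsJacobiSystemOn c U (fun t => comb (fun i => V i t) (y t))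
      (fun t => comb (fun i => V i t) (z t)) S where
  vel t ht := (h.vel t (hS ht)).mono hS
  geo t ht := (h.geo t (hS ht)).mono hS
  jac t ht := hasCovDerivWithinAt_comb (fun i => (h.par i t (hS ht)).mono hS) (hyz.left t ht)
  curv t ht := by
    have := hasCovDerivWithinAt_comb (fun i => (h.par i t (hS ht)).mono hS) (hyz.right t ht)
    have e : comb (fun i => V i t) (-(Rmat (fun i => V i t) (U t) (y t)))
        = -(Rm (c t) (comb (fun i => V i t) (y t)) (U t) (U t)) := by
      rw [← neg_one_smul ℝ, comb_smul, Rmat_apply, comb_frameCoord (h.orth t (hS ht)),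
        neg_one_smul]
    rwa [e] at this

theorem continuousOn_Rmat (h : IsFramedGeodesicOn c U V σ T) :
    ContinuousOn (fun t => Rmat (fun i => V i t) (U t)) (Icc 0 T) := by
  rw [continuousOn_clm_apply]
  intro y
  have hcomp : ∀ i, ContinuousOn (fun t => inner ℝ (V i t)
      (Rm (c t) (comb (fun i => V i t) y) (U t) (U t))) (Icc 0 T) := by
    intro i t ht
    set e := chartAt (Coord d) (c t) with he'
    have he : e ∈ atlas (Coord d) M := chart_mem_atlas _ _
    have hs : c t ∈ e.source := mem_chart_source _ _
    have hy : e (c t) ∈ e.target := e.map_source hs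
    have hG := isMetricOn_metricCoord he
    have hx := ((h.vel t ht).deriv e he hs).continuousWithinAt
    have hu := (h.geo t ht e he hs).continuousWithinAt
    have hv := (h.par i t ht e he hs).continuousWithinAt
    have hw := (hasCovDerivWithinAt_comb (fun i => h.par i t ht) (hasDerivWithinAt_const t _ y)
      e he hs).continuousWithinAt
    have hGc : ContinuousWithinAt (fun s => metricCoord e (e (c s))) (Icc 0 T) t :=
      ContinuousAt.comp_continuousWithinAt (f := fun s => e (c s))
        (hG.smooth.continuousOn.continuousAt (e.open_target.mem_nhds hy)) hx
    have hΓc : ContinuousWithinAt (fun s => Gam e (e (c s))) (Icc 0 T) t :=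
      ContinuousAt.comp_continuousWithinAt (f := fun s => e (c s))
        (hG.contDiffOn_chr.continuousOn.continuousAt (e.open_target.mem_nhds hy)) hx
    have hDc : ContinuousWithinAt (fun s => fderiv ℝ (Gam e) (e (c s))) (Icc 0 T) t :=
      ContinuousAt.comp_continuousWithinAt (f := fun s => e (c s))
        ((hG.contDiffOn_chr.continuousOn_fderiv_of_isOpen e.open_target (by simp)).continuousAt
          (e.open_target.mem_nhds hy)) hx
    have hcurv : ContinuousWithinAt (fun s => curv (Gam e) (e (c s))
        (fieldCoord e c (fun t => comb (fun i => V i t) y) s) (fieldCoord e c U s)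
        (fieldCoord e c U s)) (Icc 0 T) t :=
      (((((hDc.clm_apply hw).clm_apply hu).clm_apply hu).sub
        (((hDc.clm_apply hu).clm_apply hw).clm_apply hu)).add
        ((hΓc.clm_apply hw).clm_apply ((hΓc.clm_apply hu).clm_apply hu))).sub
        ((hΓc.clm_apply hu).clm_apply ((hΓc.clm_apply hw).clm_apply hu))
    refine ((hGc.clm_apply hv).clm_apply hcurv).congr_of_eventuallyEq ?_ ?_
    · filter_upwards [(h.vel t ht).continuousWithinAt.preimage_mem_nhdsWithin
        (e.open_source.mem_nhds hs)] with s hs'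
      rw [← metricCoord_chartD he hs', chartD_Rm he hs']
      rfl
    · rw [← metricCoord_chartD he hs, chartD_Rm he hs]
      rfl
  exact (PiLp.continuous_toLp 2 _).comp_continuousOn (continuousOn_pi.2 hcomp)

/-- A solution in the frame gives a genuine Jacobi field, to which the hypothesis applies. The
conclusion keeps only the open interval, which unlike `Ico 0 T` is invariant under reversal. -/
theorem conjFree (h : IsFramedGeodesicOn c U V σ T)
    (hc : NoConjugatePointsOn d c (Ico 0 T)) :
    ConjFree (fun t => Rmat (fun i => V i t) (U t)) (Ioo 0 T) := by
  intro a ha b hb hab y z hyz hya hyb t ht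
  have hsub : Icc a b ⊆ Icc 0 T := Icc_subset_Icc ha.1.le hb.2.le
  by_contra hne
  refine hc a ⟨ha.1.le, ha.2⟩ b ⟨hb.1.le, hb.2⟩ ⟨hab, _,
    (h.isJacobiSystemOn hsub hyz).isJacobiFieldOn hab, ?_, ?_, t, ht, ?_⟩
  · simp only [hya, comb_zero]
  · simp only [hyb, comb_zero]
  · rw [← norm_ne_zero_iff, norm_comb (h.orth t (hsub ht))]
    exact norm_ne_zero_iff.2 hne

end IsFramedGeodesicOn

variable [IsManifold (𝓡 d) ∞ M]
  [IsContMDiffRiemannianBundle (𝓡 d) ∞ (Coord d) (fun x : M => TangentSpace (𝓡 d) x)]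
  [IsRiemannianManifold (𝓡 d) M]

/-- Parallel transport of an orthonormal basis at `c 0`; inner products of parallel fields are
constant. -/
theorem IsGeodesicOn.exists_frame {c : ℝ → M} {T : ℝ} (h : IsGeodesicOn (d := d) c 0 T) :
    ∃ (U : (t : ℝ) → TangentSpace (𝓡 d) (c t))
      (V : Fin d → (t : ℝ) → TangentSpace (𝓡 d) (c t)), IsFramedGeodesicOn c U V 1 T := by
  obtain ⟨V₀, hV₀⟩ := exists_orthonormal_tangentSpace (d := d) (c 0)
  have hv : ∀ t ∈ Icc 0 T, _ := fun t ht => h.hasVelocityWithinAt ht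
  choose V hV hpar using fun i => exists_parallel h.lt.le hv
    (fun e he t ht hs => (h.hasCovDerivWithinAt ht e he hs).continuousWithinAt) (V₀ i)
  refine ⟨velocity c 0 T, V, hv, fun t ht => h.hasCovDerivWithinAt ht, hpar, fun t ht => ?_,
    fun t ht => h.norm_velocity ht, fun s hs t ht => ?_⟩
  · rw [orthonormal_iff_ite] at hV₀ ⊢
    intro i j
    rw [← hV₀ i j, ← hV i, ← hV j]
    exact inner_eq_of_parallel hv (hpar i) (hpar j) ht (left_mem_Icc.2 h.lt.le)
  · rw [one_mul]
    exact h.dist_le hs ht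

end FramedGeodesic

/-! ### Bounds on compact sets of coordinates -/

section LocalBounds

variable {E : Type*} [NormedAddCommGroup E] [NormedSpace ℝ E]

theorem exists_chr_curv_bound {Γ : E → E →L[ℝ] E →L[ℝ] E} {O : Set E} (hO : IsOpen O)
    (hΓ : ContDiffOn ℝ ∞ Γ O) {K : Set E} (hK : IsCompact K) (hKO : K ⊆ O) :
    ∃ g ≥ 0, ∀ y ∈ K, (∀ u v, ‖Γ y u v‖ ≤ g * ‖u‖ * ‖v‖) ∧
      ∀ u v w, ‖curv Γ y u v w‖ ≤ g * ‖u‖ * ‖v‖ * ‖w‖ := by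
  obtain ⟨a, ha⟩ := hK.exists_bound_of_continuousOn
    ((hΓ.continuousOn_fderiv_of_isOpen hO (by simp)).mono hKO)
  obtain ⟨b, hb⟩ := hK.exists_bound_of_continuousOn (hΓ.continuousOn.mono hKO)
  refine ⟨2 * |a| + 2 * |b| ^ 2 + |b|, by positivity, fun y hy => ?_⟩
  have hb' : ∀ u v, ‖Γ y u v‖ ≤ |b| * ‖u‖ * ‖v‖ := fun u v =>
    ((Γ y).le_opNorm₂ u v).trans (by gcongr; exact (hb y hy).trans (le_abs_self b))
  have ha' : ∀ u v w, ‖fderiv ℝ Γ y u v w‖ ≤ |a| * ‖u‖ * ‖v‖ * ‖w‖ := fun u v w =>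
    ((fderiv ℝ Γ y u).le_opNorm₂ v w).trans (by
      gcongr
      exact ((fderiv ℝ Γ y).le_opNorm u).trans
        (by gcongr; exact (ha y hy).trans (le_abs_self a)))
  have hbb : ∀ u v w, ‖Γ y u (Γ y v w)‖ ≤ |b| ^ 2 * (‖u‖ * ‖v‖ * ‖w‖) := fun u v w =>
    calc _ ≤ |b| * ‖u‖ * ‖Γ y v w‖ := hb' _ _
      _ ≤ |b| * ‖u‖ * (|b| * ‖v‖ * ‖w‖) := by gcongr; exact hb' _ _
      _ = _ := by ring
  refine ⟨fun u v => (hb' u v).trans ?_, fun u v w => ?_⟩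
  · gcongr
    have := abs_nonneg a
    nlinarith [sq_nonneg |b|]
  · have h1 := norm_sub_le (fderiv ℝ Γ y u v w - fderiv ℝ Γ y v u w + Γ y u (Γ y v w))
      (Γ y v (Γ y u w))
    have h2 := norm_add_le (fderiv ℝ Γ y u v w - fderiv ℝ Γ y v u w) (Γ y u (Γ y v w))
    have h3 := norm_sub_le (fderiv ℝ Γ y u v w) (fderiv ℝ Γ y v u w)
    have h4 := ha' u v w
    have h5 := ha' v u w
    have h6 := hbb u v w
    have h7 := hbb v u w
    have h8 : 0 ≤ |b| * (‖u‖ * ‖v‖ * ‖w‖) := by positivity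
    have h9 : ‖v‖ * ‖u‖ * ‖w‖ = ‖u‖ * ‖v‖ * ‖w‖ := by ring
    rw [h9] at h7
    unfold curv
    nlinarith

/-- The Jacobi part of the field grows linearly once position and velocity are controlled, so
Grönwall's inequality confines it to a fixed ball. -/
theorem norm_snd_jacField_le {Γ : E → E →L[ℝ] E →L[ℝ] E} {g R : ℝ} (hg0 : 0 ≤ g) (hR : 0 ≤ R)
    {X : (E × E) × E × E} (hΓ : ∀ u v, ‖Γ X.1.1 u v‖ ≤ g * ‖u‖ * ‖v‖)
    (hc : ∀ u v w, ‖curv Γ X.1.1 u v w‖ ≤ g * ‖u‖ * ‖v‖ * ‖w‖) (hX : ‖X.1.2‖ ≤ R) :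
    ‖(jacField Γ X).2‖ ≤ (1 + g * R + g * R ^ 2) * ‖X.2‖ := by
  have hj : ‖X.2.1‖ ≤ ‖X.2‖ := norm_fst_le _
  have hk : ‖X.2.2‖ ≤ ‖X.2‖ := norm_snd_le _
  have h0 : 0 ≤ ‖X.2‖ := norm_nonneg _
  have e1 : ∀ v, ‖v‖ ≤ ‖X.2‖ → ‖Γ X.1.1 X.1.2 v‖ ≤ g * R * ‖X.2‖ := fun v hv =>
    (hΓ _ _).trans (by gcongr)
  have e2 : ‖curv Γ X.1.1 X.2.1 X.1.2 X.1.2‖ ≤ g * R ^ 2 * ‖X.2‖ :=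
    calc _ ≤ g * ‖X.2.1‖ * ‖X.1.2‖ * ‖X.1.2‖ := hc _ _ _
      _ ≤ g * ‖X.2‖ * R * R := by gcongr
      _ = _ := by ring
  have e3 : 0 ≤ g * R * ‖X.2‖ := by positivity
  have e4 : 0 ≤ g * R ^ 2 * ‖X.2‖ := by positivity
  refine max_le ?_ ?_
  · refine (norm_sub_le _ _).trans ?_
    have := e1 _ hj
    nlinarith
  · refine (norm_sub_le _ _).trans ?_
    rw [norm_neg]
    have := e1 _ hk
    nlinarith

theorem IsMetricOn.exists_norm_bounds [FiniteDimensional ℝ E] {G : E → E →L[ℝ] E →L[ℝ] ℝ}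
    {O : Set E} (h : IsMetricOn G O) {K : Set E} (hK : IsCompact K) (hKO : K ⊆ O) :
    ∃ C ≥ 0, ∀ y ∈ K, ∀ v, ‖v‖ ^ 2 ≤ C * G y v v ∧ G y v v ≤ C * ‖v‖ ^ 2 := by
  have hcont : ContinuousOn (fun p : E × E => G p.1 p.2 p.2) (K ×ˢ Metric.sphere 0 1) := by
    have h1 : ContinuousOn (fun p : E × E => G p.1) (K ×ˢ Metric.sphere 0 1) :=
      (h.smooth.continuousOn.mono hKO).comp continuousOn_fst fun p hp => hp.1
    exact (h1.clm_apply continuousOn_snd).clm_apply continuousOn_snd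
  have hpos : ∀ p ∈ K ×ˢ Metric.sphere (0 : E) 1, 0 < G p.1 p.2 p.2 := fun p hp =>
    h.pos _ (hKO hp.1) _ (by
      have := hp.2
      rintro h0
      simp [h0] at this)
  have hcomp : IsCompact (K ×ˢ Metric.sphere (0 : E) 1) := hK.prod (isCompact_sphere 0 1)
  obtain ⟨B, hB⟩ := hcomp.exists_bound_of_continuousOn hcont
  obtain ⟨m, hm0, hm⟩ : ∃ m > 0, ∀ p ∈ K ×ˢ Metric.sphere (0 : E) 1, m ≤ G p.1 p.2 p.2 := by
    rcases (K ×ˢ Metric.sphere (0 : E) 1).eq_empty_or_nonempty with he | hne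
    · exact ⟨1, one_pos, fun p hp => by rw [he] at hp; exact hp.elim⟩
    · obtain ⟨p, hp, hmin⟩ := hcomp.exists_isMinOn hne hcont
      exact ⟨_, hpos p hp, fun q hq => hmin hq⟩
  refine ⟨max |B| m⁻¹, le_max_of_le_left (abs_nonneg _), fun y hy v => ?_⟩
  rcases eq_or_ne v 0 with rfl | hv
  · simp
  have hn : 0 < ‖v‖ := norm_pos_iff.2 hv
  have hmem : (y, ‖v‖⁻¹ • v) ∈ K ×ˢ Metric.sphere (0 : E) 1 :=
    ⟨hy, by simp [norm_smul, hn.ne']⟩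
  have h1 : G y (‖v‖⁻¹ • v) (‖v‖⁻¹ • v) = (‖v‖ ^ 2)⁻¹ * G y v v := by
    simp only [map_smul, _root_.smul_apply, smul_eq_mul]
    rw [← mul_assoc]
    congr 1
    field_simp
  have h2 := hm _ hmem
  have h3 := (le_abs_self _).trans ((hB _ hmem).trans (le_abs_self B))
  simp only [h1] at h2 h3
  have hn2 : 0 < ‖v‖ ^ 2 := by positivity
  have hG : 0 < G y v v := h.pos _ (hKO hy) _ hv
  constructor
  · have h4 : m * ‖v‖ ^ 2 ≤ G y v v := by
      rw [inv_mul_eq_div, le_div_iff₀ hn2] at h2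
      exact h2
    calc ‖v‖ ^ 2 ≤ m⁻¹ * G y v v := by
          rw [inv_mul_eq_div, le_div_iff₀ hm0]; linarith
      _ ≤ _ := mul_le_mul_of_nonneg_right (le_max_right _ _) hG.le
  · rw [inv_mul_eq_div, div_le_iff₀ hn2] at h3
    exact h3.trans (mul_le_mul_of_nonneg_right (le_max_left _ _) hn2.le)

end LocalBounds

/-! ### Uniform norm and curvature bounds near a point -/

section ChartBounds

variable {d : ℕ} {M : Type*} [MetricSpace M] [ChartedSpace (Coord d) M]
  [IsManifold (𝓡 d) ∞ M] [RiemannianBundle (fun x : M => TangentSpace (𝓡 d) x)]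
  [IsContMDiffRiemannianBundle (𝓡 d) ∞ (Coord d) (fun x : M => TangentSpace (𝓡 d) x)]

/-- Around every point there is a ball that a chart maps into a compact ball, on which the
Riemannian norm is equivalent to the norm in the chart. -/
theorem exists_ball_chart_bounds {e : OpenPartialHomeomorph M (Coord d)}
    (he : e ∈ atlas (Coord d) M) {x₀ : M} (hx₀ : x₀ ∈ e.source) :
    ∃ ρ > 0, ∃ r > 0, ∃ C ≥ 0, Metric.closedBall (e x₀) r ⊆ e.target ∧
      ∀ x ∈ Metric.ball x₀ ρ, x ∈ e.source ∧ e x ∈ Metric.closedBall (e x₀) r ∧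
        ∀ a : TangentSpace (𝓡 d) x, ‖chartD e x a‖ ≤ C * ‖a‖ ∧ ‖a‖ ≤ C * ‖chartD e x a‖ := by
  obtain ⟨r, hr, hball⟩ := Metric.nhds_basis_closedBall.mem_iff.1
    (e.open_target.mem_nhds (e.map_source hx₀))
  obtain ⟨C, hC0, hC⟩ := (isMetricOn_metricCoord he).exists_norm_bounds
    (isCompact_closedBall (e x₀) r) hball
  have h1 : e.source ∩ e ⁻¹' Metric.closedBall (e x₀) r ∈ 𝓝 x₀ :=
    inter_mem (e.open_source.mem_nhds hx₀)
      ((e.continuousAt hx₀).preimage_mem_nhds (Metric.closedBall_mem_nhds _ hr))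
  obtain ⟨ρ, hρ, hsub⟩ := Metric.mem_nhds_iff.1 h1
  refine ⟨ρ, hρ, r, hr, Real.sqrt C, Real.sqrt_nonneg _, hball, fun x hx => ?_⟩
  obtain ⟨hxs, hxr⟩ := hsub hx
  refine ⟨hxs, hxr, fun a => ?_⟩
  have h2 := hC _ hxr (chartD e x a)
  rw [metricCoord_chartD he hxs, real_inner_self_eq_norm_sq] at h2
  constructor
  · refine abs_le_of_sq_le_sq' ?_ (by positivity) |>.2
    rw [mul_pow, Real.sq_sqrt hC0]
    exact h2.1
  · refine abs_le_of_sq_le_sq' ?_ (by positivity) |>.2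
    rw [mul_pow, Real.sq_sqrt hC0]
    exact h2.2

theorem exists_ball_Rm_bound (x₀ : M) :
    ∃ ρ > 0, ∃ k ≥ 0, ∀ x ∈ Metric.ball x₀ ρ, ∀ a b w : TangentSpace (𝓡 d) x,
      ‖Rm x a b w‖ ≤ k * ‖a‖ * ‖b‖ * ‖w‖ := by
  have he := chart_mem_atlas (Coord d) x₀
  obtain ⟨ρ, hρ, r, hr, C, hC0, hsub, hC⟩ := exists_ball_chart_bounds he (mem_chart_source _ x₀)
  obtain ⟨g, hg0, hg⟩ := exists_chr_curv_bound (isMetricOn_metricCoord he).isOpen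
    (isMetricOn_metricCoord he).contDiffOn_chr (isCompact_closedBall _ r) hsub
  refine ⟨ρ, hρ, C * (g * C * C * C), by positivity, fun x hx a b w => ?_⟩
  obtain ⟨hxs, hxr, hx'⟩ := hC x hx
  calc ‖Rm x a b w‖ ≤ C * ‖chartD _ x (Rm x a b w)‖ := (hx' _).2
    _ ≤ C * (g * (C * ‖a‖) * (C * ‖b‖) * (C * ‖w‖)) := by
        rw [chartD_Rm he hxs]
        refine mul_le_mul_of_nonneg_left (((hg _ hxr).2 _ _ _).trans ?_) hC0
        gcongr
        · exact (hx' a).1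
        · exact (hx' b).1
        · exact (hx' w).1
    _ = _ := by ring

end ChartBounds

/-! ### Convergence of states independently of charts -/

section Jets

variable {d : ℕ} {M : Type*} [TopologicalSpace M] [ChartedSpace (Coord d) M]

variable (d M) in
/-- A point of `M` with three tangent vectors: the state of a Jacobi system. -/
abbrev JacState : Type _ :=
  Σ x : M, TangentSpace (𝓡 d) x × TangentSpace (𝓡 d) x × TangentSpace (𝓡 d) x

/-- The coordinates of a state. -/
def stateCoord (e : OpenPartialHomeomorph M (Coord d)) (p : JacState d M) :
    (Coord d × Coord d) × Coord d × Coord d :=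
  ((e p.1, chartD e p.1 p.2.1), (chartD e p.1 p.2.2.1, chartD e p.1 p.2.2.2))

/-- Convergence of states in all charts. -/
def StateTendsto (P : ℕ → JacState d M) (p : JacState d M) : Prop :=
  Tendsto (fun n => (P n).1) atTop (𝓝 p.1) ∧ ∀ e ∈ atlas (Coord d) M, p.1 ∈ e.source →
    Tendsto (fun n => stateCoord e (P n)) atTop (𝓝 (stateCoord e p))

/-- The state of a Jacobi system at time `t`. -/
abbrev jacState (c : ℝ → M) (U J K : (t : ℝ) → TangentSpace (𝓡 d) (c t)) (t : ℝ) :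
    JacState d M :=
  ⟨c t, U t, J t, K t⟩

variable [IsManifold (𝓡 d) ∞ M] {P : ℕ → JacState d M} {p : JacState d M}
  {e : OpenPartialHomeomorph M (Coord d)}

theorem StateTendsto.of_chart (he : e ∈ atlas (Coord d) M) (hp : p.1 ∈ e.source)
    (h0 : ∀ᶠ n in atTop, (P n).1 ∈ e.source)
    (h : Tendsto (fun n => stateCoord e (P n)) atTop (𝓝 (stateCoord e p))) : StateTendsto P p := by
  have hx : Tendsto (fun n => e (P n).1) atTop (𝓝 (e p.1)) := h.fst_nhds.fst_nhds
  have h1 : Tendsto (fun n => (P n).1) atTop (𝓝 p.1) := by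
    have := (e.symm.continuousAt (e.map_source hp)).tendsto.comp hx
    rw [e.left_inv hp] at this
    refine this.congr' ?_
    filter_upwards [h0] with n hn
    exact e.left_inv hn
  refine ⟨h1, fun e' he' hp' => ?_⟩
  have hO := mem_overlap hp hp'
  have hτ := contDiffOn_transition he he'
  have hD : Tendsto (fun n => fderiv ℝ (transition e e') (e (P n).1)) atTop
      (𝓝 (fderiv ℝ (transition e e') (e p.1))) :=
    ((hτ.continuousOn_fderiv_of_isOpen isOpen_overlap (by simp)).continuousAt
      (isOpen_overlap.mem_nhds hO)).tendsto.comp hx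
  have hT : Tendsto (fun n => transition e e' (e (P n).1)) atTop
      (𝓝 (transition e e' (e p.1))) :=
    (hτ.continuousOn.continuousAt (isOpen_overlap.mem_nhds hO)).tendsto.comp hx
  have hap : ∀ {v : ℕ → Coord d} {v₀ : Coord d}, Tendsto v atTop (𝓝 v₀) →
      Tendsto (fun n => fderiv ℝ (transition e e') (e (P n).1) (v n)) atTop
        (𝓝 (fderiv ℝ (transition e e') (e p.1) v₀)) := fun hv =>
    (isBoundedBilinearMap_apply.continuous.tendsto _).comp (hD.prodMk_nhds hv)
  have key := (hT.prodMk_nhds (hap h.fst_nhds.snd_nhds)).prodMk_nhds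
    ((hap h.snd_nhds.fst_nhds).prodMk_nhds (hap h.snd_nhds.snd_nhds))
  have hcoord : ∀ q : JacState d M, q.1 ∈ e.source → q.1 ∈ e'.source →
      ((transition e e' (e q.1), fderiv ℝ (transition e e') (e q.1) (stateCoord e q).1.2),
        (fderiv ℝ (transition e e') (e q.1) (stateCoord e q).2.1,
          fderiv ℝ (transition e e') (e q.1) (stateCoord e q).2.2)) = stateCoord e' q := by
    intro q hq hq'
    simp only [stateCoord, transition_apply hq, fderiv_transition_chartD he he' hq hq']
  rw [hcoord p hp hp'] at key
  refine key.congr' ?_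
  filter_upwards [h0, h1 (e'.open_source.mem_nhds hp')] with n hn hn'
  exact hcoord _ hn hn'

theorem exists_stateTendsto (he : e ∈ atlas (Coord d) M)
    (h0 : ∀ᶠ n in atTop, (P n).1 ∈ e.source) {X : (Coord d × Coord d) × Coord d × Coord d}
    (hX : X.1.1 ∈ e.target) (h : Tendsto (fun n => stateCoord e (P n)) atTop (𝓝 X)) :
    ∃ p : JacState d M, StateTendsto P p ∧ p.1 ∈ e.source ∧ stateCoord e p = X := by
  have hs : e.symm X.1.1 ∈ e.source := e.map_target hX
  let p : JacState d M := ⟨e.symm X.1.1, chartV e _ X.1.2, chartV e _ X.2.1, chartV e _ X.2.2⟩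
  have hp : stateCoord e p = X := by
    simp only [stateCoord, p, e.right_inv hX, chartD_chartV he hs]
  exact ⟨p, StateTendsto.of_chart he hs h0 (by rwa [hp]), hs, hp⟩

/-- The limit point is not assumed to lie in the chart; uniqueness of limits puts it there. -/
theorem StateTendsto.stateCoord_eq [T2Space M] (hp : StateTendsto P p)
    (he : e ∈ atlas (Coord d) M) (h0 : ∀ᶠ n in atTop, (P n).1 ∈ e.source)
    {X : (Coord d × Coord d) × Coord d × Coord d} (hX : X.1.1 ∈ e.target)
    (h : Tendsto (fun n => stateCoord e (P n)) atTop (𝓝 X)) :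
    p.1 ∈ e.source ∧ stateCoord e p = X := by
  obtain ⟨q, hq, hqs, -⟩ := exists_stateTendsto he h0 hX h
  have hps : p.1 ∈ e.source := by
    rw [tendsto_nhds_unique hp.1 hq.1]
    exact hqs
  exact ⟨hps, tendsto_nhds_unique (hp.2 e he hps) h⟩

end Jets

/-! ### Limits of geodesics with Jacobi fields -/

section Convergence

variable {d : ℕ} {M : Type*} [MetricSpace M] [ChartedSpace (Coord d) M]
  [IsManifold (𝓡 d) ∞ M] [RiemannianBundle (fun x : M => TangentSpace (𝓡 d) x)]
  [IsContMDiffRiemannianBundle (𝓡 d) ∞ (Coord d) (fun x : M => TangentSpace (𝓡 d) x)]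
  {T σ : ℝ} {c : ℕ → ℝ → M} {U J K : (n : ℕ) → (t : ℝ) → TangentSpace (𝓡 d) (c n t)}

/-- Near a limit point of the curves, convergence of the states of Jacobi systems propagates
forward in time, and the limit solves the Jacobi system. -/
theorem exists_propagation (hσ : 0 ≤ σ)
    (hsys : ∀ n, IsJacobiSystemOn (c n) (U n) (J n) (K n) (Icc 0 T))
    (hdist : ∀ n, ∀ s ∈ Icc 0 T, ∀ t ∈ Icc 0 T, dist (c n s) (c n t) ≤ σ * |s - t|)
    (hspeed : ∀ n, ∀ t ∈ Icc 0 T, ‖U n t‖ ≤ σ) {t₀ : ℝ} (ht₀ : t₀ ∈ Icc 0 T) {x₀ : M}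
    (hx₀ : Tendsto (fun n => c n t₀) atTop (𝓝 x₀)) :
    ∃ e ∈ atlas (Coord d) M, ∃ δ > 0, ∀ s ∈ Icc 0 T, ∀ t ∈ Icc 0 T, |s - t₀| < δ → |t - t₀| < δ →
      s ≤ t → (∃ p, StateTendsto (fun n => jacState (c n) (U n) (J n) (K n) s) p) →
      ∃ (N : ℕ) (A : Set (Coord d × Coord d)), IsCompact A ∧ Convex ℝ A ∧ (∀ X ∈ A, X.1 ∈ e.target) ∧
      (∀ n ≥ N, ∀ τ ∈ Icc s t, c n τ ∈ e.source ∧ (e (c n τ), fieldCoord e (c n) (U n) τ) ∈ A) ∧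
      ∃ Y : ℝ → (Coord d × Coord d) × Coord d × Coord d, ∀ τ ∈ Icc s t,
        Tendsto (fun n => jacCoord e (c n) (U n) (J n) (K n) τ) atTop (𝓝 (Y τ)) ∧
        (Y τ).1 ∈ A ∧ HasDerivWithinAt Y (jacField (Gam e) (Y τ)) (Icc s t) τ := by
  set e := chartAt (Coord d) x₀ with he'
  have he : e ∈ atlas (Coord d) M := chart_mem_atlas _ _
  have hsrc : x₀ ∈ e.source := mem_chart_source _ _
  obtain ⟨ρ, hρ, r, hr, C, hC0, hball, hC⟩ := exists_ball_chart_bounds he hsrc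
  have hG := isMetricOn_metricCoord he
  obtain ⟨g, hg0, hg⟩ := exists_chr_curv_bound hG.isOpen hG.contDiffOn_chr
    (isCompact_closedBall _ r) hball
  -- Curves within `ρ / 4` of `x₀` at time `t₀` stay within `ρ / 2` throughout a window of radius
  -- `δ`, hence in the chart.
  obtain ⟨δ, hδ, hδρ⟩ : ∃ δ > 0, σ * δ < ρ / 4 := by
    refine ⟨ρ / (4 * (σ + 1)) , by positivity, ?_⟩
    rw [← mul_div_assoc, div_lt_div_iff₀ (by positivity) (by norm_num)]
    nlinarith
  refine ⟨e, he, δ, hδ, fun s hs t ht hsδ htδ hst hp => ?_⟩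
  obtain ⟨p, hp⟩ := hp
  have hsub : Icc s t ⊆ Icc 0 T := Icc_subset_Icc hs.1 ht.2
  have hτδ : ∀ τ ∈ Icc s t, |τ - t₀| < δ := by
    intro τ hτ
    rw [abs_lt] at hsδ htδ ⊢
    constructor <;> linarith [hτ.1, hτ.2]
  have hnear : ∀ᶠ n in atTop, dist (c n t₀) x₀ < ρ / 4 :=
    (tendsto_iff_dist_tendsto_zero.1 hx₀).eventually (gt_mem_nhds (by positivity))
  have hdist' : ∀ n, dist (c n t₀) x₀ < ρ / 4 → ∀ τ ∈ Icc s t, dist (c n τ) x₀ < ρ / 2 := by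
    intro n hn τ hτ
    have h1 := hdist n τ (hsub hτ) t₀ ht₀
    have h2 : σ * |τ - t₀| ≤ σ * δ := mul_le_mul_of_nonneg_left (hτδ τ hτ).le hσ
    have := dist_triangle (c n τ) (c n t₀) x₀
    linarith
  have hps : p.1 ∈ Metric.ball x₀ ρ := by
    have h1 : dist p.1 x₀ ≤ ρ / 2 := by
      refine le_of_tendsto (hp.1.dist tendsto_const_nhds) ?_
      filter_upwards [hnear] with n hn
      exact (hdist' n hn s ⟨le_rfl, hst⟩).le
    rw [Metric.mem_ball]
    linarith
  have hlim := hp.2 e he (hC _ hps).1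
  set B := ‖(stateCoord e p).2‖ + 1 with hB
  have hbound : ∀ᶠ n in atTop, ‖(jacCoord e (c n) (U n) (J n) (K n) s).2‖ ≤ B := by
    have h1 : Tendsto (fun n => ‖(jacCoord e (c n) (U n) (J n) (K n) s).2‖) atTop
      (𝓝 ‖(stateCoord e p).2‖) := hlim.snd_nhds.norm
    filter_upwards [h1.eventually (gt_mem_nhds (lt_add_one _))] with n hn using hn.le
  set A := Metric.closedBall (e x₀) r ×ˢ Metric.closedBall (0 : Coord d) (C * σ) with hA
  have hAc : IsCompact A := (isCompact_closedBall _ _).prod (isCompact_closedBall _ _)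
  have hAconv : Convex ℝ A := (convex_closedBall _ _).prod (convex_closedBall _ _)
  have hAt : ∀ X ∈ A, X.1 ∈ e.target := fun X hX => hball hX.1
  obtain ⟨N, hN⟩ := eventually_atTop.1 (hnear.and hbound)
  have hmem : ∀ n ≥ N, ∀ τ ∈ Icc s t,
      c n τ ∈ e.source ∧ (e (c n τ), fieldCoord e (c n) (U n) τ) ∈ A := by
    intro n hn τ hτ
    obtain ⟨h1, h2, h3⟩ := hC (c n τ) (Metric.mem_ball.2
      ((hdist' n (hN n hn).1 τ hτ).trans (by linarith)))
    refine ⟨h1, h2, ?_⟩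
    rw [mem_closedBall_zero_iff]
    exact (h3 _).1.trans (mul_le_mul_of_nonneg_left (hspeed n τ (hsub hτ)) hC0)
  refine ⟨N, A, hAc, hAconv, hAt, hmem, ?_⟩
  set κ := 1 + g * (C * σ) + g * (C * σ) ^ 2 with hκ
  set B' := B * Real.exp (κ * (t - s)) with hB'
  have hκ0 : 0 ≤ κ := by positivity
  have hB0 : 0 ≤ B := by positivity
  have hd : ∀ n ≥ N, ∀ τ ∈ Icc s t, HasDerivWithinAt (jacCoord e (c n) (U n) (J n) (K n))
      (jacField (Gam e) (jacCoord e (c n) (U n) (J n) (K n) τ)) (Icc s t) τ := fun n hn τ hτ =>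
    ((hsys n).hasDerivWithinAt he (hsub hτ) (hmem n hn τ hτ).1).mono hsub
  have hjk : ∀ n ≥ N, ∀ τ ∈ Icc s t, ‖(jacCoord e (c n) (U n) (J n) (K n) τ).2‖ ≤ B' := by
    intro n hn τ hτ
    have h1 := norm_le_gronwallBound_of_norm_deriv_right_le (K := κ) (ε := 0)
      (f := fun τ => (jacCoord e (c n) (U n) (J n) (K n) τ).2)
      (f' := fun τ => (jacField (Gam e) (jacCoord e (c n) (U n) (J n) (K n) τ)).2)
      (fun r hr => (hd n hn r hr).continuousWithinAt.snd)
      (fun r hr => ((hd n hn r ⟨hr.1, hr.2.le⟩).Ici_of_Icc hr).snd) (hN n hn).2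
      (fun r hr => by
        rw [add_zero]
        have h2 := (hmem n hn r ⟨hr.1, hr.2.le⟩).2
        exact norm_snd_jacField_le hg0 (by positivity) (hg _ h2.1).1 (hg _ h2.1).2
          (mem_closedBall_zero_iff.1 h2.2)) τ hτ
    rw [gronwallBound_ε0] at h1
    refine h1.trans (mul_le_mul_of_nonneg_left (Real.exp_le_exp.2 ?_) hB0)
    exact mul_le_mul_of_nonneg_left (by linarith [hτ.2]) hκ0
  -- One compact convex set contains all late states over the window, so `exists_tendsto_ode`
  -- applies.
  set Kc := A ×ˢ Metric.closedBall (0 : Coord d × Coord d) B' with hKc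
  have hO : IsOpen {X : (Coord d × Coord d) × Coord d × Coord d | X.1.1 ∈ e.target} :=
    e.open_target.preimage (continuous_fst.comp continuous_fst)
  have hKcomp : IsCompact Kc := hAc.prod (isCompact_closedBall _ _)
  obtain ⟨L, -, B₂, hL, hB₂, -, -, -⟩ := exists_bounds_of_contDiffOn hO
    (contDiffOn_jacField_Gam he) hKcomp (hAconv.prod (convex_closedBall _ _))
    (fun X hX => hAt _ hX.1)
  obtain ⟨Y, hY⟩ := exists_tendsto_ode hL hB₂ hKcomp.isClosed
    (X := fun n => jacCoord e (c n) (U n) (J n) (K n)) (s := s) (t := t)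
    (eventually_atTop.2 ⟨N, fun n hn τ hτ =>
      ⟨⟨(hmem n hn τ hτ).2, mem_closedBall_zero_iff.2 (hjk n hn τ hτ)⟩, hd n hn τ hτ⟩⟩) hlim
  exact ⟨Y, fun τ hτ => ⟨(hY τ hτ).1, (hY τ hτ).2.1.1, (hY τ hτ).2.2⟩⟩

variable [CompleteSpace M]

/-- Jacobi systems whose initial states converge converge to a Jacobi system. -/
theorem exists_limit_jacobiSystem (hσ : 0 ≤ σ)
    (hsys : ∀ n, IsJacobiSystemOn (c n) (U n) (J n) (K n) (Icc 0 T))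
    (hdist : ∀ n, ∀ s ∈ Icc 0 T, ∀ t ∈ Icc 0 T, dist (c n s) (c n t) ≤ σ * |s - t|)
    (hspeed : ∀ n, ∀ t ∈ Icc 0 T, ‖U n t‖ ≤ σ) {p : JacState d M}
    (h0 : StateTendsto (fun n => jacState (c n) (U n) (J n) (K n) 0) p) :
    ∃ f : ℝ → JacState d M,
      (∀ t ∈ Icc 0 T, StateTendsto (fun n => jacState (c n) (U n) (J n) (K n) t) (f t)) ∧
      IsJacobiSystemOn (fun t => (f t).1) (fun t => (f t).2.1) (fun t => (f t).2.2.1)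
        (fun t => (f t).2.2.2) (Icc 0 T) := by
  have key : ∀ t ∈ Icc 0 T,
      ∃ q, StateTendsto (fun n => jacState (c n) (U n) (J n) (K n) t) q := by
    refine Icc_forward_induction ⟨p, h0⟩ fun t₀ ht₀ hprev => ?_
    -- Positions at `t₀` are uniformly close to those at slightly earlier times, where they already
    -- converge; being Cauchy, they converge by completeness.
    obtain ⟨x₀, hx₀⟩ : ∃ x₀, Tendsto (fun n => c n t₀) atTop (𝓝 x₀) := by
      rcases ht₀.1.eq_or_lt with h | h
      · exact ⟨p.1, h ▸ h0.1⟩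
      apply cauchySeq_tendsto_of_complete
      rw [Metric.cauchySeq_iff]
      intro ε hε
      obtain ⟨s, hs, hsε⟩ : ∃ s ∈ Ico 0 t₀, σ * |t₀ - s| < ε / 3 := by
        refine ⟨max 0 (t₀ - ε / (4 * (σ + 1))), ⟨le_max_left _ _, max_lt h ?_⟩, ?_⟩
        · have : 0 < ε / (4 * (σ + 1)) := by positivity
          linarith
        · have h1 := le_max_right 0 (t₀ - ε / (4 * (σ + 1)))
          have h2 : max 0 (t₀ - ε / (4 * (σ + 1))) ≤ t₀ := max_le h.le (by
            have : 0 < ε / (4 * (σ + 1)) := by positivity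
            linarith)
          rw [abs_of_nonneg (by linarith)]
          have h3 : σ * (t₀ - max 0 (t₀ - ε / (4 * (σ + 1)))) ≤ σ * (ε / (4 * (σ + 1))) :=
            mul_le_mul_of_nonneg_left (by linarith) hσ
          refine h3.trans_lt ?_
          rw [← mul_div_assoc, div_lt_div_iff₀ (by positivity) (by norm_num)]
          nlinarith
      obtain ⟨q, hq⟩ := hprev s hs
      obtain ⟨N, hN⟩ := Metric.cauchySeq_iff.1 hq.1.cauchySeq (ε / 3) (by positivity)
      have hsT : s ∈ Icc 0 T := ⟨hs.1, hs.2.le.trans ht₀.2⟩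
      refine ⟨N, fun m hm n hn => ?_⟩
      have h1 := hdist m t₀ ht₀ s hsT
      have h2 := hdist n t₀ ht₀ s hsT
      have h3 := hN m hm n hn
      have h4 := dist_triangle4_right (c m t₀) (c n t₀) (c m s) (c n s)
      simp only at h3
      linarith
    obtain ⟨e, he, δ, hδ, H⟩ := exists_propagation hσ hsys hdist hspeed ht₀ hx₀
    refine ⟨δ, hδ, fun s hs t ht hsδ htδ hst hP => ?_⟩
    obtain ⟨N, A, -, -, hAt, hmem, Y, hY⟩ := H s hs t ht hsδ htδ hst hP
    obtain ⟨h1, h2, -⟩ := hY t ⟨hst, le_rfl⟩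
    obtain ⟨q, hq, -, -⟩ := exists_stateTendsto he
      (P := fun n => jacState (c n) (U n) (J n) (K n) t)
      (eventually_atTop.2 ⟨N, fun n hn => (hmem n hn t ⟨hst, le_rfl⟩).1⟩) (hAt _ h2) h1
    exact ⟨q, hq⟩
  have : Nonempty (JacState d M) := ⟨p⟩
  choose! f hf using key
  refine ⟨f, hf, ?_⟩
  have hall : ∀ t ∈ Icc 0 T, HasVelocityWithinAt (fun t => (f t).1) (Icc 0 T) t (f t).2.1 ∧
      HasCovDerivWithinAt (fun t => (f t).1) (fun t => (f t).2.1) (Icc 0 T) t (f t).2.1 0 ∧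
      HasCovDerivWithinAt (fun t => (f t).1) (fun t => (f t).2.2.1) (Icc 0 T) t (f t).2.1
        (f t).2.2.2 ∧
      HasCovDerivWithinAt (fun t => (f t).1) (fun t => (f t).2.2.2) (Icc 0 T) t (f t).2.1
        (-(Rm (f t).1 (f t).2.2.1 (f t).2.1 (f t).2.1)) := by
    intro t₀ ht₀
    obtain ⟨e, he, δ, hδ, H⟩ := exists_propagation hσ hsys hdist hspeed ht₀ (hf t₀ ht₀).1
    set s := max 0 (t₀ - δ / 2) with hs
    set t := min T (t₀ + δ / 2) with ht
    have hst₀ : s ≤ t₀ := max_le ht₀.1 (by linarith)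
    have htt₀ : t₀ ≤ t := le_min ht₀.2 (by linarith)
    have hs' : s ∈ Icc 0 T := ⟨le_max_left _ _, hst₀.trans ht₀.2⟩
    have ht' : t ∈ Icc 0 T := ⟨ht₀.1.trans htt₀, min_le_left _ _⟩
    obtain ⟨N, A, -, -, hAt, hmem, Y, hY⟩ := H s hs' t ht'
      (by
        have := le_max_right 0 (t₀ - δ / 2)
        rw [abs_lt]; constructor <;> linarith)
      (by
        have := min_le_right T (t₀ + δ / 2)
        rw [abs_lt]; constructor <;> linarith) (hst₀.trans htt₀) ⟨f s, hf s hs'⟩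
    have hsub : Icc s t ⊆ Icc 0 T := Icc_subset_Icc hs'.1 ht'.2
    have hfe : ∀ τ ∈ Icc s t, (f τ).1 ∈ e.source ∧ stateCoord e (f τ) = Y τ := by
      intro τ hτ
      obtain ⟨h1, h2, -⟩ := hY τ hτ
      exact (hf τ (hsub hτ)).stateCoord_eq he
        (eventually_atTop.2 ⟨N, fun n hn => (hmem n hn τ hτ).1⟩) (hAt _ h2) h1
    have hnhds : Icc s t ∈ 𝓝[Icc 0 T] t₀ := by
      have : Icc (t₀ - δ / 2) (t₀ + δ / 2) ∈ 𝓝 t₀ := Icc_mem_nhds (by linarith) (by linarith)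
      filter_upwards [self_mem_nhdsWithin, mem_nhdsWithin_of_mem_nhds this] with r hr hr'
      exact ⟨max_le hr.1 hr'.1, le_min hr.2 hr'.2⟩
    have hmt₀ : t₀ ∈ Icc s t := ⟨hst₀, htt₀⟩
    have hd : HasDerivWithinAt (jacCoord e (fun t => (f t).1) (fun t => (f t).2.1)
        (fun t => (f t).2.2.1) (fun t => (f t).2.2.2))
        (jacField (Gam e) (jacCoord e (fun t => (f t).1) (fun t => (f t).2.1)
          (fun t => (f t).2.2.1) (fun t => (f t).2.2.2) t₀)) (Icc s t) t₀ := by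
      have h1 : jacCoord e (fun t => (f t).1) (fun t => (f t).2.1)
          (fun t => (f t).2.2.1) (fun t => (f t).2.2.2) t₀ = Y t₀ := (hfe t₀ hmt₀).2
      rw [h1]
      exact (hY t₀ hmt₀).2.2.congr (fun τ hτ => (hfe τ hτ).2) h1
    have hct : ContinuousWithinAt (fun t => (f t).1) (Icc s t) t₀ := by
      have h1 := hd.continuousWithinAt.fst.fst
      have h2 := ContinuousAt.comp_continuousWithinAt (g := e.symm) (f := fun t => e (f t).1)
        (e.symm.continuousAt (e.map_source (hfe t₀ hmt₀).1)) h1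
      exact h2.congr (fun τ hτ => (e.left_inv (hfe τ hτ).1).symm)
        (e.left_inv (hfe t₀ hmt₀).1).symm
    have := IsJacobiSystemOn.of_hasDerivWithinAt he (hct.mono_of_mem_nhdsWithin hnhds)
      (hfe t₀ hmt₀).1 (hd.mono_of_mem_nhdsWithin hnhds)
    exact this
  exact ⟨fun t ht => (hall t ht).1, fun t ht => (hall t ht).2.1, fun t ht => (hall t ht).2.2.1,
    fun t ht => (hall t ht).2.2.2⟩

end Convergence

/-! ### Jacobi fields as solutions of the linearized geodesic equation -/

section Linearization

variable {E : Type*} [NormedAddCommGroup E] [NormedSpace ℝ E]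

/-- The geodesic vector field of the connection with Christoffel symbols `Γ`. -/
def geoField (Γ : E → E →L[ℝ] E →L[ℝ] E) (X : E × E) : E × E := (X.2, -(Γ X.1 X.2 X.2))

theorem contDiffOn_geoField {Γ : E → E →L[ℝ] E →L[ℝ] E} {O : Set E} (hΓ : ContDiffOn ℝ ∞ Γ O) :
    ContDiffOn ℝ ∞ (geoField Γ) {X | X.1 ∈ O} := by
  have h1 : ContDiffOn ℝ ∞ (fun X : E × E => Γ X.1) {X | X.1 ∈ O} :=
    hΓ.comp contDiff_fst.contDiffOn fun X hX => hX
  have h2 : ContDiffOn ℝ ∞ (fun X : E × E => X.2) {X | X.1 ∈ O} := contDiff_snd.contDiffOn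
  exact h2.prodMk ((h1.clm_apply h2).clm_apply h2).neg

theorem fderiv_geoField {Γ : E → E →L[ℝ] E →L[ℝ] E} {X : E × E} (hΓ : DifferentiableAt ℝ Γ X.1)
    (ζ : E × E) : fderiv ℝ (geoField Γ) X ζ =
      (ζ.2, -(fderiv ℝ Γ X.1 ζ.1 X.2 X.2 + Γ X.1 ζ.2 X.2 + Γ X.1 X.2 ζ.2)) := by
  have h1 : HasFDerivAt (fun X : E × E => Γ X.1)
      (fderiv ℝ Γ X.1 ∘L ContinuousLinearMap.fst ℝ E E) X := hΓ.hasFDerivAt.comp X hasFDerivAt_fst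
  have h2 : HasFDerivAt (fun X : E × E => X.2) (ContinuousLinearMap.snd ℝ E E) X := hasFDerivAt_snd
  have h3 : HasFDerivAt (geoField Γ) _ X := h2.prodMk ((h1.clm_apply h2).clm_apply h2).neg
  rw [h3.fderiv]
  refine Prod.ext rfl ?_
  simp
  abel

variable [FiniteDimensional ℝ E] {G G' : E → E →L[ℝ] E →L[ℝ] ℝ} {O O' : Set E}

/-- Jacobi fields solve the linearized geodesic equation. -/
theorem IsMetricOn.hasDerivWithinAt_variation (h : IsMetricOn G O) {S : Set ℝ} {τ : ℝ}
    {Y : ℝ → (E × E) × E × E} (hO : (Y τ).1.1 ∈ O)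
    (hY : HasDerivWithinAt Y (jacField (chr G) (Y τ)) S τ) :
    HasDerivWithinAt (fun τ => ((Y τ).2.1, (Y τ).2.2 - chr G (Y τ).1.1 (Y τ).1.2 (Y τ).2.1))
      (fderiv ℝ (geoField (chr G)) (Y τ).1
        ((Y τ).2.1, (Y τ).2.2 - chr G (Y τ).1.1 (Y τ).1.2 (Y τ).2.1)) S τ := by
  have hx : HasDerivWithinAt (fun τ => (Y τ).1.1) (Y τ).1.2 S τ := hY.fst.fst
  have hu : HasDerivWithinAt (fun τ => (Y τ).1.2)
    (-(chr G (Y τ).1.1 (Y τ).1.2 (Y τ).1.2)) S τ := hY.fst.snd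
  have hj : HasDerivWithinAt (fun τ => (Y τ).2.1)
    ((Y τ).2.2 - chr G (Y τ).1.1 (Y τ).1.2 (Y τ).2.1) S τ := hY.snd.fst
  have hk : HasDerivWithinAt (fun τ => (Y τ).2.2)
    (-(curv (chr G) (Y τ).1.1 (Y τ).2.1 (Y τ).1.2 (Y τ).1.2)
      - chr G (Y τ).1.1 (Y τ).1.2 (Y τ).2.2) S τ := hY.snd.snd
  have hΓ : HasDerivWithinAt (fun τ => chr G (Y τ).1.1) (fderiv ℝ (chr G) (Y τ).1.1 (Y τ).1.2)
    S τ := HasFDerivAt.comp_hasDerivWithinAt (f := fun τ => (Y τ).1.1) τ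
      (h.differentiableAt_chr hO).hasFDerivAt hx
  refine (hj.prodMk (hk.sub ((hΓ.clm_apply hu).clm_apply hj))).congr_deriv ?_
  rw [fderiv_geoField (h.differentiableAt_chr hO)]
  refine Prod.ext rfl ?_
  have e1 := h.fderiv_chr_comm hO (Y τ).1.2 (Y τ).2.1 (Y τ).1.2
  have e2 := fun u v => h.chr_comm hO u v
  simp only [curv, map_sub, map_neg, _root_.add_apply, _root_.neg_apply, _root_.sub_apply]
  rw [e1, e2 (chr G _ (Y τ).1.2 (Y τ).1.2), e2 (Y τ).2.2, e2 (Y τ).2.1 (Y τ).1.2,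
    e2 (chr G _ (Y τ).1.2 (Y τ).2.1)]
  abel

/-- Variation fields transform like tangent vectors to the tangent bundle. -/
theorem IsMetricOn.Transition.tendsto_variation {τ : E → E} {D : Set E}
    (T : IsMetricOn.Transition G G' O O' τ D) (h : IsMetricOn G O) (h' : IsMetricOn G' O')
    {X : ℕ → E × E} {x u j k : E} (hx : x ∈ D) (hX : Tendsto X atTop (𝓝 (x, u))) {δ : ℕ → ℝ}
    (hq : Tendsto (fun n => (δ n)⁻¹ • (X n - (x, u))) atTop (𝓝 (j, k - chr G x u j))) :
    Tendsto (fun n => (δ n)⁻¹ • ((τ (X n).1, fderiv ℝ τ (X n).1 (X n).2) - (τ x, fderiv ℝ τ x u)))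
      atTop (𝓝 (fderiv ℝ τ x j,
        fderiv ℝ τ x k - chr G' (τ x) (fderiv ℝ τ x u) (fderiv ℝ τ x j))) := by
  have h1 : HasFDerivAt (fun X : E × E => τ X.1) _ (x, u) :=
    (T.hasFDerivAt hx).comp (x, u) hasFDerivAt_fst
  have h2 : HasFDerivAt (fun X : E × E => fderiv ℝ τ X.1) _ (x, u) :=
    (T.hasFDerivAt_fderiv hx).comp (x, u) hasFDerivAt_fst
  have h3 : HasFDerivAt (fun X : E × E => (τ X.1, fderiv ℝ τ X.1 X.2)) _ (x, u) :=
    h1.prodMk (h2.clm_apply hasFDerivAt_snd)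
  have hd : Tendsto (fun n => X n - (x, u)) atTop (𝓝 0) := by
    simpa using hX.sub_const (x, u)
  have h4 := h3.hasFDerivWithinAt (s := univ) |>.lim (d := fun n => X n - (x, u)) hd
    (Eventually.of_forall fun _ => mem_univ _) hq
  simp only [add_sub_cancel] at h4
  convert h4 using 2
  refine Prod.ext (by simp) ?_
  -- The second derivative of `τ` from differentiating `Dτ u` is absorbed by the change of the
  -- Christoffel term in `k - Γ(u, j)`.
  have e1 := T.chr_eq h h' hx u j
  have e2 := T.fderiv_fderiv_comm hx u j
  simp [e1, e2]
  abel

end Linearization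

/-! ### Difference quotients of geodesics converge to Jacobi fields -/

section Quotients

variable {d : ℕ} {M : Type*} [MetricSpace M] [ChartedSpace (Coord d) M]
  [IsManifold (𝓡 d) ∞ M] [RiemannianBundle (fun x : M => TangentSpace (𝓡 d) x)]

/-- The coordinates of the variation of the position and the velocity given by a Jacobi field. -/
def varCoord (e : OpenPartialHomeomorph M (Coord d)) (p : JacState d M) : Coord d × Coord d :=
  ((stateCoord e p).2.1, (stateCoord e p).2.2
    - Gam e (stateCoord e p).1.1 (stateCoord e p).1.2 (stateCoord e p).2.1)

/-- The difference quotients of positions and velocities converge to the variation given by the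
Jacobi field of the limit state. -/
def VarTendsto (δ : ℕ → ℝ) (P : ℕ → JacState d M) (p : JacState d M) : Prop :=
  ∀ e ∈ atlas (Coord d) M, p.1 ∈ e.source →
    Tendsto (fun n => (δ n)⁻¹ • ((stateCoord e (P n)).1 - (stateCoord e p).1)) atTop
      (𝓝 (varCoord e p))

variable [IsContMDiffRiemannianBundle (𝓡 d) ∞ (Coord d) (fun x : M => TangentSpace (𝓡 d) x)]

theorem VarTendsto.of_chart {δ : ℕ → ℝ} {P : ℕ → JacState d M} {p : JacState d M}
    {e : OpenPartialHomeomorph M (Coord d)} (he : e ∈ atlas (Coord d) M) (hp : p.1 ∈ e.source)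
    (hP : StateTendsto P p)
    (h : Tendsto (fun n => (δ n)⁻¹ • ((stateCoord e (P n)).1 - (stateCoord e p).1)) atTop
      (𝓝 (varCoord e p))) : VarTendsto δ P p := by
  intro e' he' hp'
  have h1 := (transition_metricCoord he he').tendsto_variation (isMetricOn_metricCoord he)
    (isMetricOn_metricCoord he') (mem_overlap hp hp') (hP.2 e he hp).fst_nhds h
  have hcoord : ∀ q : JacState d M, q.1 ∈ e.source → q.1 ∈ e'.source →
      (transition e e' (stateCoord e q).1.1,
        fderiv ℝ (transition e e') (stateCoord e q).1.1 (stateCoord e q).1.2)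
        = (stateCoord e' q).1 := by
    intro q hq hq'
    simp only [stateCoord, transition_apply hq, fderiv_transition_chartD he he' hq hq']
  have h2 : (fderiv ℝ (transition e e') (e p.1) (stateCoord e p).2.1,
      fderiv ℝ (transition e e') (e p.1) (stateCoord e p).2.2
        - chr (metricCoord e') (transition e e' (e p.1))
          (fderiv ℝ (transition e e') (e p.1) (chartD e p.1 p.2.1))
          (fderiv ℝ (transition e e') (e p.1) (stateCoord e p).2.1)) = varCoord e' p := by
    simp only [varCoord, Gam, stateCoord, transition_apply hp,
      fderiv_transition_chartD he he' hp hp']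
  rw [h2] at h1
  refine h1.congr' ?_
  filter_upwards [hP.1 (e.open_source.mem_nhds hp), hP.1 (e'.open_source.mem_nhds hp')]
    with n hn hn'
  rw [hcoord (P n) hn hn', ← hcoord p hp hp']
  rfl

variable {T σ : ℝ} {c : ℕ → ℝ → M} {U J K : (n : ℕ) → (t : ℝ) → TangentSpace (𝓡 d) (c n t)}

/-- If geodesics converge and the difference quotients of their initial states converge to the
initial data of a Jacobi field, then the difference quotients converge to the Jacobi field. -/
theorem varTendsto_of_initial (hσ : 0 ≤ σ)
    (hsys : ∀ n, IsJacobiSystemOn (c n) (U n) (J n) (K n) (Icc 0 T))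
    (hdist : ∀ n, ∀ s ∈ Icc 0 T, ∀ t ∈ Icc 0 T, dist (c n s) (c n t) ≤ σ * |s - t|)
    (hspeed : ∀ n, ∀ t ∈ Icc 0 T, ‖U n t‖ ≤ σ) {f : ℝ → JacState d M}
    (hf : ∀ t ∈ Icc 0 T, StateTendsto (fun n => jacState (c n) (U n) (J n) (K n) t) (f t))
    {δ : ℕ → ℝ} (hδ : ∀ n, 0 < δ n) (hδ0 : Tendsto δ atTop (𝓝 0))
    (h0 : VarTendsto δ (fun n => jacState (c n) (U n) (J n) (K n) 0) (f 0)) :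
    ∀ t ∈ Icc 0 T, VarTendsto δ (fun n => jacState (c n) (U n) (J n) (K n) t) (f t) := by
  refine Icc_forward_induction h0 fun t₀ ht₀ _ => ?_
  obtain ⟨e, he, η, hη, H⟩ := exists_propagation hσ hsys hdist hspeed ht₀ (hf t₀ ht₀).1
  refine ⟨η, hη, fun s hs t ht hsδ htδ hst hP => ?_⟩
  obtain ⟨N, A, hA, hAc, hAt, hmem, Y, hY⟩ := H s hs t ht hsδ htδ hst ⟨f s, hf s hs⟩
  have hsub : Icc s t ⊆ Icc 0 T := Icc_subset_Icc hs.1 ht.2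
  have hfe : ∀ τ ∈ Icc s t, (f τ).1 ∈ e.source ∧ stateCoord e (f τ) = Y τ := fun τ hτ =>
    (hf τ (hsub hτ)).stateCoord_eq he (eventually_atTop.2 ⟨N, fun n hn => (hmem n hn τ hτ).1⟩)
      (hAt _ (hY τ hτ).2.1) (hY τ hτ).1
  have hG := isMetricOn_metricCoord he
  have hO : IsOpen {X : Coord d × Coord d | X.1 ∈ e.target} :=
    e.open_target.preimage continuous_fst
  obtain ⟨C, C₂, -, -, -, hF, hC, hC₂⟩ := exists_bounds_of_contDiffOn hO
    (contDiffOn_geoField hG.contDiffOn_chr) hA hAc hAt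
  have hsm : s ∈ Icc s t := ⟨le_rfl, hst⟩
  have htm : t ∈ Icc s t := ⟨hst, le_rfl⟩
  have hinit := hP e he (hfe s hsm).1
  rw [varCoord, (hfe s hsm).2] at hinit
  have key := tendsto_ode_quotient hAc hF hC hC₂ (s := s) (t := t)
    (X := fun n τ => (jacCoord e (c n) (U n) (J n) (K n) τ).1) (Y := fun τ => (Y τ).1)
    (ζ := fun τ => ((Y τ).2.1, (Y τ).2.2 - chr (metricCoord e) (Y τ).1.1 (Y τ).1.2 (Y τ).2.1))
    (eventually_atTop.2 ⟨N, fun n hn τ hτ => ⟨(hmem n hn τ hτ).2,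
      (((hsys n).hasDerivWithinAt he (hsub hτ) (hmem n hn τ hτ).1).mono hsub).fst⟩⟩)
    (fun τ hτ => ⟨(hY τ hτ).2.1, (hY τ hτ).2.2.fst⟩)
    (fun τ hτ => hG.hasDerivWithinAt_variation (hAt _ (hY τ hτ).2.1) (hY τ hτ).2.2) hδ hδ0
    hinit t htm
  refine VarTendsto.of_chart he (hfe t htm).1 (hf t ht) ?_
  rw [varCoord, (hfe t htm).2]
  exact key

/-- Along convergent curves the curvature tensor is uniformly bounded. -/
theorem exists_uniform_Rm_bound {c : ℕ → ℝ → M} {x : ℝ → M} (hσ : 0 ≤ σ)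
    (hdist : ∀ n, ∀ s ∈ Icc 0 T, ∀ t ∈ Icc 0 T, dist (c n s) (c n t) ≤ σ * |s - t|)
    (hx : ∀ t ∈ Icc 0 T, Tendsto (fun n => c n t) atTop (𝓝 (x t))) :
    ∃ k ≥ 0, ∀ᶠ n in atTop, ∀ t ∈ Icc 0 T, ∀ a b w : TangentSpace (𝓡 d) (c n t),
      ‖Rm (c n t) a b w‖ ≤ k * ‖a‖ * ‖b‖ * ‖w‖ := by
  refine isCompact_Icc.induction_on (p := fun S => ∃ k ≥ 0, ∀ᶠ n in atTop, ∀ t ∈ S,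
    ∀ a b w : TangentSpace (𝓡 d) (c n t), ‖Rm (c n t) a b w‖ ≤ k * ‖a‖ * ‖b‖ * ‖w‖)
    ⟨0, le_rfl, Eventually.of_forall fun n t ht => ht.elim⟩ ?_ ?_ ?_
  · rintro S S' hS ⟨k, hk, h⟩
    exact ⟨k, hk, h.mono fun n hn t ht => hn t (hS ht)⟩
  · rintro S S' ⟨k, hk, h⟩ ⟨k', hk', h'⟩
    refine ⟨k + k', add_nonneg hk hk', ?_⟩
    filter_upwards [h, h'] with n hn hn' t ht a b w
    have h0 : 0 ≤ ‖a‖ * ‖b‖ * ‖w‖ := by positivity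
    rcases ht with ht | ht
    · have := hn t ht a b w
      nlinarith
    · have := hn' t ht a b w
      nlinarith
  · intro t₀ ht₀
    obtain ⟨ρ, hρ, k, hk, H⟩ := exists_ball_Rm_bound (d := d) (x t₀)
    have hη : 0 < ρ / (4 * (σ + 1)) := by positivity
    refine ⟨Icc 0 T ∩ Metric.ball t₀ (ρ / (4 * (σ + 1))),
      inter_mem self_mem_nhdsWithin (mem_nhdsWithin_of_mem_nhds (Metric.ball_mem_nhds _ hη)),
      k, hk, ?_⟩
    have hnear : ∀ᶠ n in atTop, dist (c n t₀) (x t₀) < ρ / 4 :=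
      (tendsto_iff_dist_tendsto_zero.1 (hx t₀ ht₀)).eventually (gt_mem_nhds (by positivity))
    filter_upwards [hnear] with n hn t ht
    refine H _ ?_
    have h1 := hdist n t ht.1 t₀ ht₀
    have h2 : |t - t₀| < ρ / (4 * (σ + 1)) := by
      have := ht.2
      rwa [Metric.mem_ball, Real.dist_eq] at this
    have h3 : σ * |t - t₀| ≤ σ * (ρ / (4 * (σ + 1))) := mul_le_mul_of_nonneg_left h2.le hσ
    have h4 : σ * (ρ / (4 * (σ + 1))) < ρ / 3 := by
      rw [← mul_div_assoc, div_lt_div_iff₀ (by positivity) (by norm_num)]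
      nlinarith
    have := dist_triangle (c n t) (c n t₀) (x t₀)
    rw [Metric.mem_ball]
    linarith

end Quotients

/-! ### Geodesics without conjugate points through a common point -/

section Rigidity

variable {d : ℕ} {M : Type*} [MetricSpace M] [CompleteSpace M] [ChartedSpace (Coord d) M]
  [IsManifold (𝓡 d) ∞ M] [RiemannianBundle (fun x : M => TangentSpace (𝓡 d) x)]
  [IsContMDiffRiemannianBundle (𝓡 d) ∞ (Coord d) (fun x : M => TangentSpace (𝓡 d) x)]

theorem IsFramedGeodesicOn.restrict {c : ℝ → M} {U : (t : ℝ) → TangentSpace (𝓡 d) (c t)}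
    {V : Fin d → (t : ℝ) → TangentSpace (𝓡 d) (c t)} {σ T T' : ℝ}
    (h : IsFramedGeodesicOn c U V σ T) (hT : T' ≤ T) : IsFramedGeodesicOn c U V σ T' where
  vel t ht := (h.vel t ⟨ht.1, ht.2.trans hT⟩).mono (Icc_subset_Icc_right hT)
  geo t ht := (h.geo t ⟨ht.1, ht.2.trans hT⟩).mono (Icc_subset_Icc_right hT)
  par i t ht := (h.par i t ⟨ht.1, ht.2.trans hT⟩).mono (Icc_subset_Icc_right hT)
  orth t ht := h.orth t ⟨ht.1, ht.2.trans hT⟩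
  speed t ht := h.speed t ⟨ht.1, ht.2.trans hT⟩
  dist_le s hs t ht := h.dist_le s ⟨hs.1, hs.2.trans hT⟩ t ⟨ht.1, ht.2.trans hT⟩

/-- Geodesics are determined by their initial position and velocity. -/
theorem eq_of_initial {c : Bool → ℝ → M} {U : (i : Bool) → (t : ℝ) → TangentSpace (𝓡 d) (c i t)}
    {V : (i : Bool) → Fin d → (t : ℝ) → TangentSpace (𝓡 d) (c i t)} {σ T : ℝ} (hσ : 0 ≤ σ)
    (h : ∀ i, IsFramedGeodesicOn (c i) (U i) (V i) σ T) {p : M} (hp : ∀ i, c i 0 = p)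
    {e : OpenPartialHomeomorph M (Coord d)} (he : e ∈ atlas (Coord d) M) (hpe : p ∈ e.source)
    {v : Coord d} (hv : ∀ i, fieldCoord e (c i) (U i) 0 = v) {t : ℝ} (ht : t ∈ Icc 0 T) :
    c true t = c false t := by
  have hzero : ∀ i, SolvesJacobi (fun t => Rmat (fun k => V i k t) (U i t))
      (fun _ => (0 : Coord d)) (fun _ => 0) (Icc 0 T) := fun i =>
    ⟨fun t _ => hasDerivWithinAt_const t _ _, fun t _ => by
      simpa using hasDerivWithinAt_const t (Icc 0 T) (0 : Coord d)⟩
  have hsys := fun i => (h i).isJacobiSystemOn Subset.rfl (hzero i)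
  have hX : ∀ i, stateCoord e (jacState (c i) (U i) (fun t => comb (fun k => V i k t) 0)
      (fun t => comb (fun k => V i k t) 0) 0) = ((e p, v), (0, 0)) := by
    intro i
    have h1 : chartD e (c i 0) (U i 0) = v := hv i
    simp only [stateCoord, h1, comb_zero, map_zero, hp i]
  -- Uniqueness from convergence: the sequence alternates between the two geodesics, with zero
  -- Jacobi fields. Its initial coordinates are constant, so it converges at time `t`, and the even
  -- and odd terms have the same limit.
  obtain ⟨q, hq, -⟩ := exists_stateTendsto he
    (P := fun n : ℕ => jacState (c n.bodd) (U n.bodd) (fun t => comb (fun k => V n.bodd k t) 0)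
      (fun t => comb (fun k => V n.bodd k t) 0) 0)
    (Eventually.of_forall fun n => by simpa only [hp] using hpe)
    (X := ((e p, v), (0, 0))) (e.map_source hpe)
    (by simp only [hX]; exact tendsto_const_nhds)
  obtain ⟨f, hf, -⟩ := exists_limit_jacobiSystem (c := fun n : ℕ => c n.bodd) hσ
    (fun n => hsys n.bodd) (fun n => (h n.bodd).dist_le) (fun n t ht => ((h n.bodd).speed t ht).le)
    hq
  have hlim := (hf t ht).1
  have h0 : Tendsto (fun n : ℕ => 2 * n) atTop atTop :=
    tendsto_atTop_mono (fun n : ℕ => (by omega : n ≤ 2 * n)) tendsto_id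
  have h1 : Tendsto (fun n : ℕ => 2 * n + 1) atTop atTop :=
    tendsto_atTop_mono (fun n : ℕ => (by omega : n ≤ 2 * n + 1)) tendsto_id
  have e0 := hlim.comp h0
  have e1 := hlim.comp h1
  have b0 : ∀ n : ℕ, (2 * n).bodd = false := fun n => by simp
  have b1 : ∀ n : ℕ, (2 * n + 1).bodd = true := fun n => by simp
  simp only [Function.comp_def, b0] at e0
  simp only [Function.comp_def, b1] at e1
  exact (tendsto_const_nhds_iff.1 e1).trans (tendsto_const_nhds_iff.1 e0).symm

/-- Geodesics without conjugate points from `p` through a common point at the same time `s` cannot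
have initial velocities accumulating at another one. -/
theorem variation_eq_zero {γ : ℕ → ℝ → M} {U : (n : ℕ) → (t : ℝ) → TangentSpace (𝓡 d) (γ n t)}
    {V : (n : ℕ) → Fin d → (t : ℝ) → TangentSpace (𝓡 d) (γ n t)} {ς : ℕ → ℝ} {σ T s : ℝ}
    (h : ∀ n, IsFramedGeodesicOn (γ n) (U n) (V n) (ς n) T) (hσ : 0 ≤ σ) (hς : ∀ n, ς n ≤ σ)
    (hconj : ∀ n, ConjFree (fun t => Rmat (fun k => V n k t) (U n t)) (Ioo 0 T))
    (hs : 0 < s) (hsT : s < T) {p b : M} (hp : ∀ n, γ n 0 = p) (hb : ∀ n, γ n s = b)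
    {e : OpenPartialHomeomorph M (Coord d)} (he : e ∈ atlas (Coord d) M) (hpe : p ∈ e.source)
    {v η : Coord d} {δ : ℕ → ℝ} (hδ : ∀ n, 0 < δ n) (hδ0 : Tendsto δ atTop (𝓝 0))
    (hv : Tendsto (fun n => fieldCoord e (γ n) (U n) 0) atTop (𝓝 v))
    (hη : Tendsto (fun n => (δ n)⁻¹ • (fieldCoord e (γ n) (U n) 0 - v)) atTop (𝓝 η)) :
    η = 0 := by
  have hT0 : (0 : ℝ) ∈ Icc 0 T := ⟨le_rfl, (hs.trans hsT).le⟩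
  have hsmem : s ∈ Icc 0 T := ⟨hs.le, hsT.le⟩
  -- Along each geodesic, take the Jacobi field that vanishes at 0 and whose covariant derivative
  -- there has coordinates `η`.
  choose y z hy0 hz0 hyz using fun n => exists_solvesJacobi hT0.2 (h n).continuousOn_Rmat 0
    (frameCoord (fun k => V n k 0) (chartV e (γ n 0) η))
  set J : (n : ℕ) → (t : ℝ) → TangentSpace (𝓡 d) (γ n t) :=
    fun n t => comb (fun k => V n k t) (y n t) with hJ
  set K : (n : ℕ) → (t : ℝ) → TangentSpace (𝓡 d) (γ n t) :=
    fun n t => comb (fun k => V n k t) (z n t) with hK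
  have hsys : ∀ n, IsJacobiSystemOn (γ n) (U n) (J n) (K n) (Icc 0 T) := fun n =>
    (h n).isJacobiSystemOn Subset.rfl (hyz n)
  have hdist : ∀ n, ∀ s ∈ Icc 0 T, ∀ t ∈ Icc 0 T, dist (γ n s) (γ n t) ≤ σ * |s - t| :=
    fun n s hs t ht => ((h n).dist_le s hs t ht).trans
      (mul_le_mul_of_nonneg_right (hς n) (abs_nonneg _))
  have hspeed : ∀ n, ∀ t ∈ Icc 0 T, ‖U n t‖ ≤ σ := fun n t ht =>
    ((h n).speed t ht).le.trans (hς n)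
  have hK0 : ∀ n, K n 0 = chartV e (γ n 0) η := fun n => by
    simp only [hK, hz0]
    exact comb_frameCoord ((h n).orth 0 hT0) _
  have hX : ∀ n, stateCoord e (jacState (γ n) (U n) (J n) (K n) 0)
      = ((e p, fieldCoord e (γ n) (U n) 0), (0, η)) := by
    intro n
    have h1 : γ n 0 ∈ e.source := by rw [hp]; exact hpe
    simp only [stateCoord, hK0, chartD_chartV he h1, hJ, hy0, comb_zero, map_zero,
      fieldCoord_eq_chartD, hp n]
  have hsrc : ∀ᶠ n in atTop, (jacState (γ n) (U n) (J n) (K n) 0).1 ∈ e.source :=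
    Eventually.of_forall fun n => by simpa only [hp] using hpe
  have hlim : Tendsto (fun n => stateCoord e (jacState (γ n) (U n) (J n) (K n) 0)) atTop
      (𝓝 ((e p, v), (0, η))) := by
    simp only [hX]
    exact (tendsto_const_nhds.prodMk_nhds hv).prodMk_nhds tendsto_const_nhds
  obtain ⟨q, hq, -⟩ := exists_stateTendsto he hsrc (e.map_source hpe) hlim
  obtain ⟨f, hf, -⟩ := exists_limit_jacobiSystem hσ hsys hdist hspeed hq
  obtain ⟨hf0s, hf0⟩ := (hf 0 hT0).stateCoord_eq he hsrc (e.map_source hpe) hlim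
  have hvar0 : VarTendsto δ (fun n => jacState (γ n) (U n) (J n) (K n) 0) (f 0) := by
    refine VarTendsto.of_chart he hf0s (hf 0 hT0) ?_
    simp only [varCoord, hf0, hX, map_zero, sub_zero, Prod.mk_sub_mk, sub_self, Prod.smul_mk,
      smul_zero]
    exact tendsto_const_nhds.prodMk_nhds hη
  have hvar := varTendsto_of_initial hσ hsys hdist hspeed hf hδ hδ0 hvar0 s hsmem
  have hfb : (f s).1 = b := tendsto_nhds_unique (hf s hsmem).1
    (by simp only [hb]; exact tendsto_const_nhds)
  set e' := chartAt (Coord d) b with he'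
  have hbe' : b ∈ e'.source := mem_chart_source _ _
  -- All curves and their limit are at `b` at time `s`, so the position quotients vanish and so does
  -- the limiting Jacobi field.
  have hJ0 : (stateCoord e' (f s)).2.1 = 0 := by
    have h1 := (hvar e' (chart_mem_atlas _ _) (by rw [hfb]; exact hbe')).fst_nhds
    have h2 : ∀ n, ((δ n)⁻¹ • ((stateCoord e' (jacState (γ n) (U n) (J n) (K n) s)).1
        - (stateCoord e' (f s)).1)).1 = 0 := by
      intro n
      simp only [stateCoord, hb n, hfb, Prod.mk_sub_mk, sub_self, Prod.smul_mk, smul_zero]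
    simp only [h2] at h1
    exact tendsto_nhds_unique h1 tendsto_const_nhds
  have hJlim := (((hf s hsmem).2 e' (chart_mem_atlas _ _)
    (by rw [hfb]; exact hbe')).snd_nhds.fst_nhds).norm
  rw [hJ0, norm_zero] at hJlim
  obtain ⟨ρ, hρ, _, _, C, hC0, -, hC⟩ :=
    exists_ball_chart_bounds (chart_mem_atlas (Coord d) b) hbe'
  obtain ⟨ρ', hρ', _, _, C', hC'0, -, hC'⟩ := exists_ball_chart_bounds he hpe
  obtain ⟨k, hk0, hk⟩ := exists_uniform_Rm_bound (d := d) hσ hdist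
    (fun t ht => (hf t ht).1)
  obtain ⟨D, hD0, hD⟩ := exists_conjFree_bound (V := Coord d) hs hsT
    (show 0 ≤ k * σ ^ 2 by positivity)
  -- The bound is applied along the approximating geodesics, where conjugate points are excluded,
  -- with a constant independent of `n`; its right-hand side tends to 0.
  have hbound : ∀ᶠ n in atTop, ‖η‖ ≤ C' * (D * (C *
      ‖(stateCoord e' (jacState (γ n) (U n) (J n) (K n) s)).2.1‖)) := by
    filter_upwards [hk] with n hn
    have hRk : ∀ t ∈ Icc 0 T, ‖Rmat (fun k => V n k t) (U n t)‖ ≤ k * σ ^ 2 := by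
      intro t ht
      refine norm_Rmat_le ((h n).orth t ht) (by positivity) fun a => ?_
      calc _ ≤ k * ‖a‖ * ‖U n t‖ * ‖U n t‖ := hn t ht _ _ _
        _ ≤ k * ‖a‖ * σ * σ := by
          have := hspeed n t ht
          gcongr
        _ = _ := by ring
    have h1 := hD _ (h n).continuousOn_Rmat (fun t _ v w => inner_Rmat_symm _ v w) hRk (hconj n)
      (y n) (z n) (hyz n) (hy0 n)
    have h2 : ‖y n s‖ = ‖J n s‖ := (norm_comb ((h n).orth s hsmem) _).symm
    have h3 : ‖z n 0‖ = ‖K n 0‖ := (norm_comb ((h n).orth 0 hT0) _).symm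
    have h4 : ‖J n s‖ ≤ C * ‖(stateCoord e' (jacState (γ n) (U n) (J n) (K n) s)).2.1‖ :=
      ((hC (γ n s) (by rw [hb]; exact Metric.mem_ball_self hρ)).2.2 _).2
    have h5 : ‖η‖ ≤ C' * ‖K n 0‖ := by
      have h6 := ((hC' (γ n 0) (by rw [hp]; exact Metric.mem_ball_self hρ')).2.2 (K n 0)).1
      rwa [hK0, chartD_chartV he (by rw [hp]; exact hpe), ← hK0] at h6
    rw [h2, h3] at h1
    refine h5.trans (mul_le_mul_of_nonneg_left (h1.trans ?_) hC'0)
    exact mul_le_mul_of_nonneg_left h4 hD0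
  have hle := ge_of_tendsto (((hJlim.const_mul C).const_mul D).const_mul C') hbound
  simp only [mul_zero] at hle
  exact norm_le_zero_iff.1 hle

variable {c : ℕ → ℝ → M} {U : (n : ℕ) → (t : ℝ) → TangentSpace (𝓡 d) (c n t)}
  {V : (n : ℕ) → Fin d → (t : ℝ) → TangentSpace (𝓡 d) (c n t)} {L t : ℕ → ℝ} {p b : M}

/-- The factor `t n / s` makes every geodesic reach `b` at time `s`. Were the rescaled velocities
eventually different from `v`, their normalized differences would accumulate at a unit vector, which
`variation_eq_zero` forces to be 0. -/
theorem frequently_velocity_eq (h : ∀ n, IsFramedGeodesicOn (c n) (U n) (V n) 1 (L n))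
    (hconj : ∀ n, ConjFree (fun t => Rmat (fun k => V n k t) (U n t)) (Ioo 0 (L n)))
    (hL : Tendsto L atTop atTop) (ht : ∀ n, 0 < t n) (hp : ∀ n, c n 0 = p)
    (hb : ∀ n, c n (t n) = b) {s : ℝ} (hs : 0 < s) (hts : Tendsto t atTop (𝓝 s))
    {e : OpenPartialHomeomorph M (Coord d)} (he : e ∈ atlas (Coord d) M) (hpe : p ∈ e.source)
    {v : Coord d} (hv : Tendsto (fun n => fieldCoord e (c n) (U n) 0) atTop (𝓝 v)) :
    ∃ᶠ n in atTop, (t n / s) • fieldCoord e (c n) (U n) 0 = v := by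
  intro hne
  have hα : Tendsto (fun n => t n / s) atTop (𝓝 1) := by
    simpa [hs.ne'] using hts.div_const s
  set w : ℕ → Coord d := fun n => (t n / s) • fieldCoord e (c n) (U n) 0 with hw
  have hwv : Tendsto w atTop (𝓝 v) := by simpa using hα.smul hv
  -- Once `t n / s < 2` and `L n ≥ 2 (s + 1)`, the rescaled geodesics are defined on `[0, s + 1]`,
  -- which leaves room beyond `s`.
  obtain ⟨N, hN⟩ := eventually_atTop.1 ((hne.and (hα.eventually (gt_mem_nhds one_lt_two))).and
    (hL.eventually_ge_atTop (2 * (s + 1))))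
  have hδ : ∀ n ≥ N, 0 < ‖w n - v‖ := fun n hn =>
    norm_pos_iff.2 (sub_ne_zero.2 (hN n hn).1.1)
  obtain ⟨η, hη, ψ, hψ, hlim⟩ := (isCompact_sphere (0 : Coord d) 1).tendsto_subseq
    (x := fun n => ‖w (n + N) - v‖⁻¹ • (w (n + N) - v)) (fun n => by
      have := hδ (n + N) (Nat.le_add_left _ _)
      rw [mem_sphere_zero_iff_norm, norm_smul, norm_inv, norm_norm, inv_mul_cancel₀ this.ne'])
  have hκ : Tendsto (fun n => ψ n + N) atTop atTop :=
    tendsto_atTop_mono (fun n => (Nat.le_add_right (ψ n) N)) hψ.tendsto_atTop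
  have hmaps : ∀ n ≥ N, ∀ r, 0 < r → r ≤ s + 1 → t n / s * r ≤ L n := by
    intro n hn r hr hrs
    refine le_trans ?_ (hN n hn).2
    exact mul_le_mul (hN n hn).1.2.le hrs hr.le two_pos.le
  have hα0 : ∀ n, 0 < t n / s := fun n => div_pos (ht n) hs
  have hfield : ∀ n r, r = 0 → chartD e (c n r) ((t n / s) • U n r) = w n := by
    rintro n _ rfl
    rw [map_smul]
    rfl
  have hwn : ∀ n, fieldCoord e (fun r => c n (t n / s * r + 0))
      (fun r => (t n / s) • U n (t n / s * r + 0)) 0 = w n := fun n =>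
    hfield n _ (by simp)
  have key := variation_eq_zero (d := d) (M := M) (σ := 2) (T := s + 1) (s := s) (p := p) (b := b)
    (γ := fun n r => c (ψ n + N) (t (ψ n + N) / s * r + 0))
    (U := fun n r => (t (ψ n + N) / s) • U (ψ n + N) (t (ψ n + N) / s * r + 0))
    (V := fun n k r => V (ψ n + N) k (t (ψ n + N) / s * r + 0))
    (ς := fun n => |t (ψ n + N) / s| * 1) (δ := fun n => ‖w (ψ n + N) - v‖) (v := v) (η := η)
    (fun n => (h (ψ n + N)).comp_affine (fun r hr => by
      have h0 := (hα0 (ψ n + N)).le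
      rcases hr.1.eq_or_lt with h1 | h1
      · rw [← h1]
        simp only [mul_zero, add_zero]
        exact ⟨le_rfl, (by positivity : 0 ≤ 2 * (s + 1)).trans (hN _ (Nat.le_add_left _ _)).2⟩
      · simp only [add_zero]
        exact ⟨mul_nonneg h0 hr.1, hmaps _ (Nat.le_add_left _ _) r h1 hr.2⟩)) zero_le_two
    (fun n => by
      rw [mul_one, abs_of_pos (hα0 _)]
      exact (hN _ (Nat.le_add_left _ _)).1.2.le)
    (fun n => by
      simp only [Rmat_smul]
      refine (hconj (ψ n + N)).comp_affine (hα0 _).ne' fun r hr => ?_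
      simp only [add_zero]
      refine ⟨mul_pos (hα0 _) hr.1, ?_⟩
      exact (mul_lt_mul_of_pos_left hr.2 (hα0 _)).trans_le
        (hmaps _ (Nat.le_add_left _ _) (s + 1) (by positivity) le_rfl))
    hs (lt_add_one s) (fun n => by simp only [mul_zero, add_zero, hp])
    (fun n => by simp only [div_mul_cancel₀ _ hs.ne', add_zero, hb]) he hpe
    (fun n => hδ _ (Nat.le_add_left _ _))
    (by
      have := (tendsto_iff_norm_sub_tendsto_zero.1 hwv).comp hκ
      exact this)
    (by simp only [hwn]; exact hwv.comp hκ) (by simp only [hwn]; exact hlim)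
  rw [mem_sphere_zero_iff_norm, key, norm_zero] at hη
  exact zero_ne_one hη

/-- Among geodesics without conjugate points from `p` that pass through `b` within bounded time,
infinitely many agree. -/
theorem exists_subseq_eq (h : ∀ n, IsFramedGeodesicOn (c n) (U n) (V n) 1 (L n))
    (hconj : ∀ n, ConjFree (fun t => Rmat (fun k => V n k t) (U n t)) (Ioo 0 (L n)))
    (hL : Tendsto L atTop atTop) (ht : ∀ n, t n ∈ Ioo 0 (L n)) {T : ℝ} (htT : ∀ n, t n ≤ T)
    (hp : ∀ n, c n 0 = p) (hb : ∀ n, c n (t n) = b) (hbp : b ≠ p) :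
    ∃ φ : ℕ → ℕ, StrictMono φ ∧ ∀ m n, ∀ s, 0 ≤ s → s ≤ L (φ m) → s ≤ L (φ n) →
      c (φ m) s = c (φ n) s := by
  set e := chartAt (Coord d) p with he'
  have he : e ∈ atlas (Coord d) M := chart_mem_atlas _ _
  have hpe : p ∈ e.source := mem_chart_source _ _
  have hL0 : ∀ n, 0 ≤ L n := fun n => ((ht n).1.trans (ht n).2).le
  obtain ⟨ρ, hρ, _, _, C, hC0, -, hC⟩ := exists_ball_chart_bounds he hpe
  have hω : ∀ n, ‖fieldCoord e (c n) (U n) 0‖ ≤ C := by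
    intro n
    have h1 := ((hC (c n 0) (by rw [hp]; exact Metric.mem_ball_self hρ)).2.2 (U n 0)).1
    rwa [(h n).speed 0 ⟨le_rfl, hL0 n⟩, mul_one] at h1
  obtain ⟨⟨s, v⟩, -, ψ, hψ, hlim⟩ :=
    (isCompact_Icc.prod (isCompact_closedBall (0 : Coord d) C)).tendsto_subseq
      (x := fun n => (t n, fieldCoord e (c n) (U n) 0)) (s := Icc 0 T ×ˢ Metric.closedBall 0 C)
      (fun n => ⟨⟨(ht n).1.le, htT n⟩, mem_closedBall_zero_iff.2 (hω n)⟩)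
  have hts : Tendsto (fun n => t (ψ n)) atTop (𝓝 s) := hlim.fst_nhds
  have hv : Tendsto (fun n => fieldCoord e (c (ψ n)) (U (ψ n)) 0) atTop (𝓝 v) := hlim.snd_nhds
  -- Unit speed gives `t n ≥ dist b p > 0`.
  have hs : 0 < s := by
    refine lt_of_lt_of_le (dist_pos.2 hbp) (ge_of_tendsto' hts fun n => ?_)
    have := (h (ψ n)).dist_le _ ⟨(ht (ψ n)).1.le, (ht (ψ n)).2.le⟩ 0 ⟨le_rfl, hL0 _⟩
    rwa [hb, hp, one_mul, sub_zero, abs_of_pos (ht _).1] at this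
  have hfreq := frequently_velocity_eq (fun n => h (ψ n)) (fun n => hconj (ψ n))
    (hL.comp hψ.tendsto_atTop) (fun n => (ht (ψ n)).1) (fun n => hp (ψ n)) (fun n => hb (ψ n)) hs
    hts he hpe hv
  obtain ⟨φ, hφ, hφv⟩ := extraction_of_frequently_atTop hfreq
  -- By unit speed the rescaling factor is the length of the common vector `v`; it is therefore the
  -- same for all terms, and so are the original initial velocities.
  have hα : ∀ n, t (ψ (φ n)) / s = ‖chartV e p v‖ := by
    intro n
    have h1 : ∀ x, x = p → ‖chartV e x v‖ = ‖chartV e p v‖ := by rintro _ rfl; rfl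
    rw [← h1 _ (hp (ψ (φ n))), ← hφv n, map_smul, norm_smul, fieldCoord_eq_chartD,
      chartV_chartD he (by rw [hp]; exact hpe), (h _).speed 0 ⟨le_rfl, hL0 _⟩, mul_one,
      Real.norm_of_nonneg (div_pos (ht _).1 hs).le]
  refine ⟨ψ ∘ φ, hψ.comp hφ, fun m n r hr0 hrm hrn => ?_⟩
  have hvel : ∀ n, fieldCoord e (c (ψ (φ n))) (U (ψ (φ n))) 0 = ‖chartV e p v‖⁻¹ • v := by
    intro n
    have h0 : t (ψ (φ n)) / s ≠ 0 := (div_pos (ht _).1 hs).ne'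
    rw [← hα n, eq_inv_smul_iff₀ h0]
    exact hφv n
  exact eq_of_initial (c := fun i => c (ψ (φ (cond i m n)))) (U := fun i => U (ψ (φ (cond i m n))))
    (V := fun i => V (ψ (φ (cond i m n)))) zero_le_one (T := r)
    (fun i => (h _).restrict (by cases i <;> assumption)) (fun i => hp _) he hpe
    (fun i => hvel _) ⟨hr0, le_rfl⟩

/-- Two agreeing geodesics of different lengths put `q` at an interior parameter of the longer one.
This keeps `q` out of `A`, yet lengths chosen far enough apart bring `q` too close to `A`. -/
theorem false_of_common_point (h : ∀ n, IsFramedGeodesicOn (c n) (U n) (V n) 1 (L n))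
    (hconj : ∀ n, ConjFree (fun t => Rmat (fun k => V n k t) (U n t)) (Ioo 0 (L n)))
    (hL : Tendsto L atTop atTop) {q : M} (hp : ∀ n, c n 0 = p) (hq : ∀ n, c n (L n) = q)
    {A : Set M} (hAne : A.Nonempty) (hAcl : IsClosed A) (hA : ∀ n, ∀ t ∈ Ioo 0 (L n), c n t ∉ A)
    (hd : ∀ ε > 0, ∃ T > 0, ∀ n t, T < t → t < L n - T → Metric.infDist (c n t) A < ε)
    (ht : ∀ n, t n ∈ Ioo 0 (L n)) {T : ℝ} (htT : ∀ n, t n ≤ T) (hb : ∀ n, c n (t n) = b)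
    (hbp : b ≠ p) : False := by
  obtain ⟨φ, hφ, heq⟩ := exists_subseq_eq h hconj hL ht htT hp hb hbp
  have hLφ : Tendsto (fun n => L (φ n)) atTop atTop := hL.comp hφ.tendsto_atTop
  have hpass : ∀ S > 0, ∃ m n, S < L (φ m) ∧ L (φ m) < L (φ n) - S ∧
      c (φ n) (L (φ m)) = q := by
    intro S hS
    obtain ⟨m, hm⟩ := (hLφ.eventually_gt_atTop S).exists
    obtain ⟨n, hn⟩ := (hLφ.eventually_gt_atTop (L (φ m) + S)).exists
    refine ⟨m, n, hm, by linarith, ?_⟩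
    rw [← heq m n (L (φ m)) (hS.trans hm).le le_rfl (by linarith), hq]
  -- Any positive margin serves to show `q ∉ A`; the second use of `hpass` takes the margin attached
  -- to the distance from `q` to `A`.
  obtain ⟨m, n, h1, h2, h3⟩ := hpass 1 one_pos
  have hqA : q ∉ A := h3 ▸ hA (φ n) (L (φ m)) ⟨by linarith, by linarith⟩
  have hε : 0 < Metric.infDist q A := (hAcl.notMem_iff_infDist_pos hAne).1 hqA
  obtain ⟨S, hS, hSd⟩ := hd _ hε
  obtain ⟨m, n, h1, h2, h3⟩ := hpass S hS
  have := hSd (φ n) (L (φ m)) h1 h2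
  rw [h3] at this
  exact lt_irrefl _ this

end Rigidity

end

/-! ### The theorem: pigeonhole and reduction to one end -/

theorem proposition6p1 (d : ℕ) {M : Type*} [MetricSpace M] [ConnectedSpace M] [CompleteSpace M]
    [ChartedSpace (Coord d) M] [IsManifold (𝓡 d) ∞ M]
    [RiemannianBundle (fun x : M => TangentSpace (𝓡 d) x)]
    [IsContMDiffRiemannianBundle (𝓡 d) ∞ (Coord d) (fun x : M => TangentSpace (𝓡 d) x)]
    [IsRiemannianManifold (𝓡 d) M]
    (p q : M) (A : Set M) (hA_nonempty : A.Nonempty) (hA_closed : IsClosed A)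
    (L : ℕ → ℝ) (c : ℕ → ℝ → M)
    (hc : ∀ n, IsGeodesicFromTo d (c n) (L n) p q)
    (ha : Tendsto L atTop atTop)
    (hb : ∀ n, ∀ t ∈ Ioo 0 (L n), c n t ∉ A)
    (hconj : ∀ n, NoConjugatePointsOn d (c n) (Ico 0 (L n)))
    (hd : ∀ ε > 0, ∃ T > 0, ∀ n t, T < t → t < L n - T → Metric.infDist (c n t) A < ε) :
    IsInsecure d p q := by
  rintro ⟨B, hBfin, hBsub, hB⟩
  choose U V hframe using fun n => (hc n).geodesic.exists_frame
  have hfree := fun n => (hframe n).conjFree (hconj n)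
  choose t ht htB using fun n => hB (L n) (c n) (hc n)
  have : Finite B := hBfin
  obtain ⟨⟨b, hbB⟩, hinf⟩ := Finite.exists_infinite_fiber fun n => (⟨c n (t n), htB n⟩ : B)
  have hfreq : ∃ᶠ n in atTop, c n (t n) = b := by
    rw [Nat.frequently_atTop_iff_infinite]
    have h1 : ((fun n => (⟨c n (t n), htB n⟩ : B)) ⁻¹' {⟨b, hbB⟩}).Infinite :=
      Set.infinite_coe_iff.1 hinf
    refine h1.mono fun n hn => ?_
    exact congrArg Subtype.val hn
  have hbp : b ≠ p := fun h => hBsub hbB (Or.inl h)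
  have hbq : b ≠ q := fun h => hBsub hbB (Or.inr h)
  have hbA : b ∉ A := by
    obtain ⟨n, hn⟩ := hfreq.exists
    exact hn ▸ hb n (t n) (ht n)
  obtain ⟨T, -, hT⟩ := hd _ ((hA_closed.notMem_iff_infDist_pos hA_nonempty).1 hbA)
  -- For `T` belonging to the distance from `b` to `A`, no geodesic can be at `b` in its middle
  -- part.
  have hends : ∀ n, c n (t n) = b → t n ≤ T ∨ L n - t n ≤ T := by
    intro n hn
    by_contra! hcon
    have := hT n (t n) hcon.1 (by linarith)
    rw [hn] at this
    exact lt_irrefl _ this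
  have hcases : (∃ᶠ n in atTop, c n (t n) = b ∧ t n ≤ T) ∨
      ∃ᶠ n in atTop, c n (t n) = b ∧ L n - t n ≤ T := by
    rw [← frequently_or_distrib]
    exact hfreq.mono fun n hn => (hends n hn).imp (⟨hn, ·⟩) (⟨hn, ·⟩)
  rcases hcases with hfr | hfr
  · obtain ⟨φ, hφ, hφb⟩ := extraction_of_frequently_atTop hfr
    exact false_of_common_point (fun n => hframe (φ n)) (fun n => hfree (φ n))
      (ha.comp hφ.tendsto_atTop) (fun n => (hc (φ n)).source) (fun n => (hc (φ n)).target)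
      hA_nonempty hA_closed (fun n => hb (φ n))
      (fun ε hε => (hd ε hε).imp fun T hT => ⟨hT.1, fun n => hT.2 (φ n)⟩) (fun n => ht (φ n))
      (fun n => (hφb n).2) (fun n => (hφb n).1) hbp
  · obtain ⟨φ, hφ, hφb⟩ := extraction_of_frequently_atTop hfr
    -- Passages near the far end become passages near the start after reversal, with `p` and `q`
    -- exchanged.
    have hrev : ∀ n, IsFramedGeodesicOn (fun r => c (φ n) (-1 * r + L (φ n)))
        (fun r => (-1 : ℝ) • U (φ n) (-1 * r + L (φ n))) (fun k r => V (φ n) k (-1 * r + L (φ n)))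
        1 (L (φ n)) := by
      intro n
      have := (hframe (φ n)).comp_affine (α := -1) (β := L (φ n)) (T' := L (φ n))
        (fun r hr => ⟨by linarith [hr.2], by linarith [hr.1]⟩)
      rwa [abs_neg, abs_one, one_mul] at this
    refine false_of_common_point hrev (fun n => ?_) (ha.comp hφ.tendsto_atTop)
      (p := q) (q := p) (b := b) (t := fun n => L (φ n) - t (φ n)) (fun n => ?_) (fun n => ?_)
      hA_nonempty hA_closed (fun n r hr => ?_) (fun ε hε => ?_) (fun n => ?_)
      (fun n => (hφb n).2) (fun n => ?_) hbq
    · simp only [Rmat_smul]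
      exact (hfree (φ n)).comp_affine (by norm_num)
        fun r hr => ⟨by linarith [hr.2], by linarith [hr.1]⟩
    · simpa using (hc (φ n)).target
    · simpa using (hc (φ n)).source
    · exact hb (φ n) _ ⟨by linarith [hr.2], by linarith [hr.1]⟩
    · obtain ⟨T, hT0, hT⟩ := hd ε hε
      exact ⟨T, hT0, fun n r h1 h2 => hT (φ n) _ (by linarith) (by linarith)⟩
    · exact ⟨by linarith [(ht (φ n)).2], by linarith [(ht (φ n)).1]⟩
    · simp only [neg_mul, one_mul, neg_sub, sub_add_cancel]
      exact (hφb n).1
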